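/- Let $$\pi_1(\mathcal G_2)=\langle x,y,z:\ xyx^{-1}y^{-1}=1,\ zxz^{-1}=x^{-1},\ zyz^{-1}=y^{-1}\rangle,$$ $$\pi_1(\mathcal G_3)=\langle x,y,z:\ xyx^{-1}y^{-1}=1,\ zxz^{-1}=y,\ zyz^{-1}=(xy)^{-1}\rangle,$$ $$\pi_1(\mathcal G_5)=\langle x,y,z:\ xyx^{-1}y^{-1}=1,\ zxz^{-1}=xy,\ zyz^{-1}=x^{-1}\rangle,$$ and let $\mathcal G_5$ be the closed flat $3$-manifold $(\mathbb C\times\mathbb R)/\Gamma$, where $\Gamma$ is the group generated by the translations $(w,t)\mapsto(w+1,t)$ and $(w,t)\mapsto(w+e^{2\pi i/3},t)$ and the screw motion $(w,t)\mapsto(e^{\pi i/3}w,t+1)$. For groups $H,G$ and an integer $n\ge 1$ let $c_{H,G}(n)$ be the number of conjugacy classes of subgroups of index $n$ in $G$ that are isomorphic to $H$. Put $$\sigma_1(n)=\sum_{k\mid n}k,\quad \sigma_2(n)=\sum_{k\mid n}\sigma_1(k),\quad \omega(n)=\sum_{k\mid n}k\,\sigma_1(k),$$ $$\theta(n)=\bigl|\{(p,q)\in\mathbb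 Z^2:\ p>q\ge 0,\ p^2-pq+q^2=n\}\bigr|.$$ All these functions, and all sums over the divisors of an argument, are taken to be $0$ when the argument is not a positive integer. Then for every integer $n\ge 1$ the following numbers are finite, and $$c_{\pi_1(\mathcal G_5),\pi_1(\mathcal G_5)}(n)=\sum_{k\mid n,\ (\frac nk,6)=1}\theta(k),\tag{i}$$ $$c_{\pi_1(\mathcal G_3),\pi_1(\mathcal G_5)}(n)=\sum_{k\mid \frac n2}\theta(k)-\sum_{k\mid\frac n{18}}\theta(k),\tag{ii}$$ $$c_{\pi_1(\mathcal G_2),\pi_1(\mathcal G_5)}(n)=\frac13\Bigl(\sigma_2(\tfrac n3)+2\sigma_2(\tfrac n6)-3\sigma_2(\tfrac n{12})+2\sum_{k\mid\frac n3}\theta(k)-2\sum_{k\mid\frac n6}\theta(k)\Bigr),\tag{iii}$$ $$c_{\mathbb Z^3,\pi_1(\mathcal G_5)}(n)=\frac16\Bigl(\omega(\tfrac n6)+\sigma_2(\tfrac n6)+3\sigma_2(\tfrac n{12})+4\sum_{k\mid\frac n6}\theta(k)+4\sum_{k\mid\frac n{18}}\theta(k)\Bigr).\tag{iv}$$ Moreover,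 for $H=\pi_1(\mathcal G_5),\ \pi_1(\mathcal G_3),\ \pi_1(\mathcal G_2),\ \mathbb Z^3$ the right-hand sides of (i), (ii), (iii), (iv), respectively, are also the numbers of equivalence classes of connected $n$-fold coverings $p:\mathcal N\to\mathcal G_5$ with $\pi_1(\mathcal N)\cong H$, where $p_1:\mathcal N_1\to\mathcal G_5$ and $p_2:\mathcal N_2\to\mathcal G_5$ are equivalent if $p_1=p_2\circ h$ for some homeomorphism $h:\mathcal N_1\to\mathcal N_2$. -/

import Mathlib

open scoped Pointwise

namespace Platycosm

section Arithmetic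

/-- `σ₁(n)`, the sum of the divisors of `n`. -/
def sigmaOne (n : ℕ) : ℕ := ∑ k ∈ n.divisors, k

/-- `σ₂(n) = ∑_{k ∣ n} σ₁(k)` (not the sum of the squares of the divisors). -/
def sigmaTwo (n : ℕ) : ℕ := ∑ k ∈ n.divisors, sigmaOne k

/-- `ω(n) = ∑_{k ∣ n} k σ₁(k)`. -/
def omega (n : ℕ) : ℕ := ∑ k ∈ n.divisors, k * sigmaOne k

/-- `θ(n)`, the number of pairs of integers `p > q ≥ 0` with `p² - pq + q² = n`.
These pairs represent the six-element orbits of the units of the Eisenstein integers on the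
elements of norm `n`. -/
noncomputable def theta (n : ℕ) : ℕ :=
  {v : ℤ × ℤ | 0 ≤ v.2 ∧ v.2 < v.1 ∧ v.1 ^ 2 - v.1 * v.2 + v.2 ^ 2 = (n : ℤ)}.ncard

/-- `∑_{k ∣ n} θ(k)`. -/
noncomputable def thetaSum (n : ℕ) : ℕ := ∑ k ∈ n.divisors, theta k

/-- The rational number `f(n / d)`, where `f` vanishes at arguments that are not integers. -/
def atQuot (f : ℕ → ℕ) (n d : ℕ) : ℚ := if d ∣ n then (f (n / d) : ℚ) else 0

end Arithmetic

section Groups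

/-- Three generators `x`, `y`, `z`. -/
inductive Gen
  | x
  | y
  | z

/-- The generator `g` as an element of the free group. -/
def fg (g : Gen) : FreeGroup Gen := FreeGroup.of g

/-- `π₁(G₂) = ⟨x, y, z : xyx⁻¹y⁻¹ = 1, zxz⁻¹ = x⁻¹, zyz⁻¹ = y⁻¹⟩`. -/
abbrev PiG2 : Type := PresentedGroup
  ({fg .x * fg .y * (fg .x)⁻¹ * (fg .y)⁻¹,
    (fg .z * fg .x * (fg .z)⁻¹) * ((fg .x)⁻¹)⁻¹,
    (fg .z * fg .y * (fg .z)⁻¹) * ((fg .y)⁻¹)⁻¹} : Set (FreeGroup Gen))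

/-- `π₁(G₃) = ⟨x, y, z : xyx⁻¹y⁻¹ = 1, zxz⁻¹ = y, zyz⁻¹ = (xy)⁻¹⟩`. -/
abbrev PiG3 : Type := PresentedGroup
  ({fg .x * fg .y * (fg .x)⁻¹ * (fg .y)⁻¹,
    (fg .z * fg .x * (fg .z)⁻¹) * (fg .y)⁻¹,
    (fg .z * fg .y * (fg .z)⁻¹) * ((fg .x * fg .y)⁻¹)⁻¹} : Set (FreeGroup Gen))

/-- `π₁(G₅) = ⟨x, y, z : xyx⁻¹y⁻¹ = 1, zxz⁻¹ = xy, zyz⁻¹ = x⁻¹⟩`. -/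
abbrev PiG5 : Type := PresentedGroup
  ({fg .x * fg .y * (fg .x)⁻¹ * (fg .y)⁻¹,
    (fg .z * fg .x * (fg .z)⁻¹) * (fg .x * fg .y)⁻¹,
    (fg .z * fg .y * (fg .z)⁻¹) * ((fg .x)⁻¹)⁻¹} : Set (FreeGroup Gen))

/-- The group `ℤ³`, written multiplicatively; it is `π₁(G₁)`. -/
abbrev PiG1 : Type := Multiplicative (Fin 3 → ℤ)

/-- The subgroups of index `n` of `G` that are isomorphic to `H`. -/
def SubgroupsOfType (H G : Type) [Group H] [Group G] (n : ℕ) : Type :=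
  {D : Subgroup G // D.index = n ∧ Nonempty (D ≃* H)}

/-- Conjugacy of subgroups of `G`. -/
def conjSetoid (H G : Type) [Group H] [Group G] (n : ℕ) : Setoid (SubgroupsOfType H G n) where
  r D E := ∃ g : G, MulAut.conj g • D.1 = E.1
  iseqv :=
    { refl := fun _ => ⟨1, by simp⟩
      symm := by
        rintro D E ⟨g, hg⟩
        exact ⟨g⁻¹, by rw [← hg, smul_smul, ← map_mul]; simp⟩
      trans := by
        rintro D E F ⟨g, hg⟩ ⟨h, hh⟩
        exact ⟨h * g, by rw [map_mul, mul_smul, hg, hh]⟩ }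

/-- The conjugacy classes of subgroups of index `n` of `G` that are isomorphic to `H`. -/
def SubgroupClasses (H G : Type) [Group H] [Group G] (n : ℕ) : Type :=
  Quotient (conjSetoid H G n)

end Groups

section Coverings

/-- The translation of Euclidean space `ℂ × ℝ` by `(a, 0)`. -/
def translation (a : ℂ) : Equiv.Perm (ℂ × ℝ) := Equiv.addRight (a, (0 : ℝ))

/-- The screw motion `(w, t) ↦ (e^{πi/3} w, t + 1)` of Euclidean space `ℂ × ℝ`. -/
noncomputable def screw : Equiv.Perm (ℂ × ℝ) :=
  Equiv.prodCongr
    (Equiv.mulLeft₀ (Complex.exp (Real.pi * Complex.I / 3)) (Complex.exp_ne_zero _))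
    (Equiv.addRight (1 : ℝ))

/-- The group of isometries of Euclidean space `ℂ × ℝ` that is generated by the translations by
`1` and `e^{2πi/3}` in the horizontal plane and by the vertical screw motion of order six. -/
noncomputable def deckGroup : Subgroup (Equiv.Perm (ℂ × ℝ)) :=
  Subgroup.closure
    {translation 1, translation (Complex.exp (2 * Real.pi * Complex.I / 3)), screw}

/-- The Euclidean manifold `G₅`, the quotient of Euclidean space by `deckGroup`, with the quotient
topology. -/
abbrev G5 : Type := Quotient (MulAction.orbitRel deckGroup (ℂ × ℝ))

/-- A connected `n`-fold covering `p : N → X` such that the fundamental group of `N` is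
isomorphic to `H`. -/
structure Covering (X : Type) [TopologicalSpace X] (H : Type) [Group H] (n : ℕ) where
  N : Type
  [top : TopologicalSpace N]
  [conn : ConnectedSpace N]
  p : N → X
  isCoveringMap : IsCoveringMap p
  card_fiber : ∀ x : X, Nat.card (p ⁻¹' {x}) = n
  fundamentalGroup : ∀ e : N, Nonempty (FundamentalGroup N e ≃* H)

attribute [instance] Covering.top Covering.conn

/-- Equivalence of coverings: a homeomorphism `h` of the total spaces with `p₁ = p₂ ∘ h`. -/
def coveringSetoid (X : Type) [TopologicalSpace X] (H : Type) [Group H] (n : ℕ) :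
    Setoid (Covering X H n) where
  r C D := ∃ h : C.N ≃ₜ D.N, C.p = D.p ∘ h
  iseqv :=
    { refl := fun _ => ⟨Homeomorph.refl _, rfl⟩
      symm := by
        rintro C D ⟨h, hh⟩
        exact ⟨h.symm, by rw [hh]; ext x; simp⟩
      trans := by
        rintro C D E ⟨h, hh⟩ ⟨k, hk⟩
        exact ⟨h.trans k, by rw [hh, hk]; rfl⟩ }

/-- The equivalence classes of connected `n`-fold coverings of `X` whose total space has a
fundamental group isomorphic to `H`. -/
def CoveringClasses (X : Type) [TopologicalSpace X] (H : Type) [Group H] (n : ℕ) : Type 1 :=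
  Quotient (coveringSetoid X H n)

end Coverings

/-- The collection `A` is finite, and the number of its elements is `q`. -/
def HasCard.{u} (A : Type u) (q : ℚ) : Prop := Finite A ∧ (Nat.card A : ℚ) = q

end Platycosm

/-! Let `A` be the ring of Eisenstein integers and `ζ = 1 + ω` a primitive sixth root of unity. Then
`π₁(G₅)` is `A ⋊ ℤ`, with `1 ∈ ℤ` acting as `ζ`. A subgroup `D` of index `n` is determined by the
generator `k > 0` of its image in `ℤ` (its step), the lattice `Λ = D ∩ A` and the coset of `Λ`
formed by the `a` with `(a, k) ∈ D`. The only constraints are `ζ ^ k Λ = Λ` and `k [A : Λ] = n`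
(`IsStep.index_eq`, `ofData`). Conjugation by `(c, j)` applies `ζ ^ j` to these data and shifts `a`
by an element of `(ζ ^ k - 1) A`. Conjugacy classes are therefore the orbits of the powers of `ζ` on
pairs of a stable `Λ` and a coset of `Λ + (ζ ^ k - 1) A` (`invariant_eq_iff`,
`card_subgroupClasses`).

Burnside's lemma counts these orbits. An endomorphism of a finite abelian group has kernel and
cokernel of equal size, so the number of pairs fixed by `ζ ^ j` depends only on `l = [A : Λ]` and `g
= gcd(k, j, 6)`: it is the sum of `|A / (Λ + (ζ ^ g - 1) A)|` over the `ζ ^ g`-stable `Λ` of index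
`l` (`ncard_fixed_latCosets`). For `g = 1, 2` the stable lattices are the ideals, which are
principal and are counted by `θ`. For `g = 3, 6` every lattice is stable, and `σ₁` counts them. The
four values are `θ(l)`, `θ(l) + 2θ(l/3)`, `σ₁(l) + 3σ₁(l/2)` and `l σ₁(l)`.

The isomorphism type of `D` depends only on `gcd(k, 6)`: the values 1, 2, 3, 6 give `π₁(G₅)`,
`π₁(G₃)`, `π₁(G₂)`, `ℤ³`. These four groups are told apart by whether they map onto `(ℤ/2)²` and
onto `(ℤ/3)²` (`nonempty_mulEquiv_iff`). Summing the orbit counts over the divisors `k` of `n` with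
prescribed `gcd(k, 6)` gives the formulas.

For coverings, `ℂ × ℝ` is a simply connected quotient covering of `G5` with deck group isomorphic to
`π₁(G₅)`. The Galois correspondence then identifies equivalence classes of connected coverings with
conjugacy classes of subgroups. -/

namespace Platycosm

/-! ### Subgroups of `A ⋊ ℤ` in terms of a step, a lattice and a coset. -/

/-- The semidirect product `A ⋊ ℤ`, where `1 : ℤ` acts on `A` as the element `φ` of a group `C`
of automorphisms. -/
@[ext]
structure CyclicExt (A : Type) {C : Type} (φ : C) where
  v : A
  k : ℤ

namespace CyclicExt

variable {A C : Type} [AddCommGroup A] [Group C] [DistribMulAction C A] {φ : C}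

instance : Mul (CyclicExt A φ) := ⟨fun g h => ⟨g.v + φ ^ g.k • h.v, g.k + h.k⟩⟩
instance : One (CyclicExt A φ) := ⟨⟨0, 0⟩⟩
instance : Inv (CyclicExt A φ) := ⟨fun g => ⟨-(φ ^ (-g.k) • g.v), -g.k⟩⟩

@[simp] lemma mul_v (g h : CyclicExt A φ) : (g * h).v = g.v + φ ^ g.k • h.v := rfl
@[simp] lemma mul_k (g h : CyclicExt A φ) : (g * h).k = g.k + h.k := rfl
omit [Group C] [DistribMulAction C A] in
@[simp] lemma one_v : (1 : CyclicExt A φ).v = 0 := rfl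
omit [Group C] [DistribMulAction C A] in
@[simp] lemma one_k : (1 : CyclicExt A φ).k = 0 := rfl
@[simp] lemma inv_v (g : CyclicExt A φ) : (g⁻¹).v = -(φ ^ (-g.k) • g.v) := rfl
@[simp] lemma inv_k (g : CyclicExt A φ) : (g⁻¹).k = -g.k := rfl

instance : Group (CyclicExt A φ) := Group.ofLeftAxioms
  (fun a b c => by ext <;> simp [zpow_add, mul_smul, add_assoc])
  (fun a => by ext <;> simp) (fun a => by ext <;> simp)

/-- The projection onto the quotient `ℤ`. -/
def toInt : CyclicExt A φ →* Multiplicative ℤ where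
  toFun g := Multiplicative.ofAdd g.k
  map_one' := rfl
  map_mul' _ _ := rfl

@[simp] lemma zpow_k (g : CyclicExt A φ) (m : ℤ) : (g ^ m).k = m * g.k := by
  have h := map_zpow (toInt (A := A) (φ := φ)) g m
  have := congrArg Multiplicative.toAdd h
  simpa [toInt] using this

@[simp] lemma pow_k (g : CyclicExt A φ) (m : ℕ) : (g ^ m).k = m * g.k := by
  simpa using zpow_k g m

/-- The inclusion of the kernel `A`. -/
def inl : Multiplicative A →* CyclicExt A φ where
  toFun v := ⟨v.toAdd, 0⟩
  map_one' := rfl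
  map_mul' _ _ := by ext <;> simp

lemma mk_zero_zpow (v : A) (m : ℤ) : (⟨v, 0⟩ : CyclicExt A φ) ^ m = ⟨m • v, 0⟩ := by
  have h := map_zpow (inl (A := A) (φ := φ)) (Multiplicative.ofAdd v) m
  exact h.symm

/-- The intersection of a subgroup with the kernel `A`. -/
def lat (D : Subgroup (CyclicExt A φ)) : AddSubgroup A where
  carrier := {v | (⟨v, 0⟩ : CyclicExt A φ) ∈ D}
  zero_mem' := D.one_mem
  add_mem' {a b} ha hb := by
    have := D.mul_mem ha hb
    rw [Set.mem_ofPred_eq]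
    convert this using 1
    ext <;> simp
  neg_mem' {a} ha := by
    have := D.inv_mem ha
    rw [Set.mem_ofPred_eq]
    convert this using 1
    ext <;> simp

lemma mem_lat {D : Subgroup (CyclicExt A φ)} {v : A} : v ∈ lat D ↔ ⟨v, 0⟩ ∈ D := Iff.rfl

/-- The image of `D` in `ℤ` is generated by `k`. -/
def IsStep (D : Subgroup (CyclicExt A φ)) (k : ℕ) : Prop :=
  (∀ g ∈ D, (k : ℤ) ∣ g.k) ∧ ∃ a, ⟨a, k⟩ ∈ D

lemma exists_isStep (D : Subgroup (CyclicExt A φ)) : ∃ k, IsStep D k := by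
  obtain ⟨g, hg⟩ := Int.subgroup_cyclic (Subgroup.toAddSubgroup' (D.map toInt))
  have key : ∀ j : ℤ, g ∣ j ↔ ∃ v, ⟨v, j⟩ ∈ D := by
    intro j
    have h1 : j ∈ Subgroup.toAddSubgroup' (D.map toInt) ↔ ∃ v, ⟨v, j⟩ ∈ D := by
      constructor
      · rintro ⟨x, hx, hj⟩
        have : x.k = j := congrArg Multiplicative.toAdd hj
        exact ⟨x.v, by rw [← this]; exact hx⟩
      · rintro ⟨v, hv⟩
        exact ⟨_, hv, rfl⟩
    rw [← h1, hg, ← Int.mem_zmultiples_iff, AddSubgroup.zmultiples_eq_closure]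
  refine ⟨g.natAbs, fun x hx => ?_, ?_⟩
  · rw [Int.natAbs_dvd, key]; exact ⟨x.v, hx⟩
  · rw [← key]; exact Int.dvd_natAbs.2 dvd_rfl

lemma IsStep.unique {D : Subgroup (CyclicExt A φ)} {k l : ℕ} (hk : IsStep D k)
    (hl : IsStep D l) : k = l := by
  obtain ⟨a, ha⟩ := hk.2
  obtain ⟨b, hb⟩ := hl.2
  exact Nat.dvd_antisymm (Int.natCast_dvd_natCast.1 (hk.1 _ hb))
    (Int.natCast_dvd_natCast.1 (hl.1 _ ha))

/-- Finite index puts a positive power of `(0, 1)` into `D`, so the image of `D` in `ℤ` is not zero.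
-/
lemma IsStep.pos {D : Subgroup (CyclicExt A φ)} {k : ℕ} (hk : IsStep D k)
    (hD : D.index ≠ 0) : 0 < k := by
  obtain ⟨m, hm, -, h⟩ := Subgroup.exists_pow_mem_of_index_ne_zero hD ⟨0, 1⟩
  have := hk.1 _ h
  rcases Nat.eq_zero_or_pos k with rfl | h0
  · simp at this; omega
  · exact h0

/-- Since `A` is abelian, conjugation by `(a, k) ∈ D` acts on `A` as `φ ^ k`, and it preserves `D ∩
A`. -/
lemma IsStep.smul_lat {D : Subgroup (CyclicExt A φ)} {k : ℕ} (hk : IsStep D k) :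
    φ ^ k • lat D = lat D := by
  obtain ⟨a, ha⟩ := hk.2
  have h1 : ∀ v ∈ lat D, φ ^ k • v ∈ lat D := by
    intro v hv
    have := D.mul_mem (D.mul_mem ha hv) (D.inv_mem ha)
    rw [mem_lat]
    convert this using 1
    ext <;> simp
  have h2 : ∀ v ∈ lat D, (φ ^ k)⁻¹ • v ∈ lat D := by
    intro v hv
    have := D.mul_mem (D.mul_mem (D.inv_mem ha) hv) ha
    rw [mem_lat]
    convert this using 1
    ext <;> simp
  ext v
  rw [AddSubgroup.mem_pointwise_smul_iff_inv_smul_mem]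
  refine ⟨fun h => by simpa using h1 _ h, h2 v⟩

/-- The products `(0, r)(v, 0)` with `0 ≤ r < k` and `v` running over `A / lat D` represent the left
cosets of `D`, each once. -/
theorem IsStep.index_eq {D : Subgroup (CyclicExt A φ)} {k : ℕ} (hk : IsStep D k) (h0 : 0 < k) :
    D.index = k * (lat D).index := by
  obtain ⟨a, ha⟩ := hk.2
  rw [Subgroup.index_eq_card, AddSubgroup.index, ← Nat.card_fin k, ← Nat.card_prod]
  symm
  let F : Fin k × (A ⧸ lat D) → CyclicExt A φ ⧸ D := fun x =>
    Quotient.liftOn' x.2 (fun v => ((⟨0, (x.1 : ℕ)⟩ * ⟨v, 0⟩ : CyclicExt A φ) : CyclicExt A φ ⧸ D))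
      (fun v w h => by
        rw [QuotientAddGroup.leftRel_apply, mem_lat] at h
        rw [QuotientGroup.eq]
        convert h using 1
        ext <;> simp)
  refine Nat.card_congr (Equiv.ofBijective F ⟨?_, ?_⟩)
  · rintro ⟨r, v⟩ ⟨s, w⟩ h
    induction v using QuotientAddGroup.induction_on with | H v => ?_
    induction w using QuotientAddGroup.induction_on with | H w => ?_
    have h : _ ∈ D := QuotientGroup.eq.1 h
    have hrs : (k : ℤ) ∣ (s : ℕ) - (r : ℕ) := by
      have := hk.1 _ h
      simp at this
      convert this using 1; ring
    have : r = s := by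
      have h1 := r.2; have h2 := s.2
      have h3 := Int.eq_zero_of_abs_lt_dvd hrs (by rw [abs_lt]; omega)
      ext; omega
    subst this
    congr 1
    rw [QuotientAddGroup.eq, mem_lat]
    convert h using 1
    ext <;> simp
  · intro g
    induction g using QuotientGroup.induction_on with | H g => ?_
    obtain ⟨v, j⟩ := g
    have hk0 : (k : ℤ) ≠ 0 := by exact_mod_cast h0.ne'
    have e1 := Int.emod_nonneg j hk0
    have e2 := Int.emod_lt_of_pos j (by exact_mod_cast h0 : (0 : ℤ) < k)
    have e3 := Int.emod_add_mul_ediv j k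
    -- Right multiplication by a power of `(a, k) ∈ D` keeps the coset and reduces the
    -- `ℤ`-coordinate to `j % k`. The untwisting by `φ ^ (-(j % k))` below inverts `(0, r)(v, 0) =
    -- (φ ^ r v, r)`.
    set Z : CyclicExt A φ := ⟨v, j⟩ * ⟨a, k⟩ ^ (-(j / k)) with hZ
    have hZk : Z.k = j % k := by simp [hZ]; linarith
    refine ⟨(⟨(j % k).toNat, by omega⟩, ((φ ^ (-(j % k)) • Z.v : A) : A ⧸ lat D)), ?_⟩
    refine QuotientGroup.eq.2 ?_
    have : (⟨0, ((j % k).toNat : ℕ)⟩ * ⟨φ ^ (-(j % k)) • Z.v, 0⟩ : CyclicExt A φ) = Z := by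
      ext
      · simp [e1]
      · simp [hZk, e1]
    rw [this, hZ]
    convert D.zpow_mem ha (j / k) using 1
    simp

/-- The subgroup generated by `Λ` and `(a, k)`. -/
def ofData (k : ℕ) (Λ : AddSubgroup A) (hΛ : φ ^ k • Λ = Λ) (a : A) :
    Subgroup (CyclicExt A φ) where
  carrier := {g | ∃ w ∈ Λ, ∃ m : ℤ, g = ⟨w, 0⟩ * ⟨a, k⟩ ^ m}
  one_mem' := ⟨0, Λ.zero_mem, 0, by ext <;> simp⟩
  mul_mem' := by
    -- Moving an element of `Λ` past `(a, k) ^ m` twists it by `φ ^ (m k)`, which preserves `Λ`.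
    have hm : ∀ m : ℤ, ∀ w ∈ Λ, φ ^ (m * k) • w ∈ Λ := by
      intro m w hw
      have h : (φ ^ k) ∈ MulAction.stabilizer C Λ := hΛ
      have h2 : (φ ^ k) ^ m • Λ = Λ := (MulAction.stabilizer C Λ).zpow_mem h m
      rw [mul_comm, zpow_mul, zpow_natCast, ← h2]
      exact AddSubgroup.smul_mem_pointwise_smul _ _ _ hw
    rintro _ _ ⟨w, hw, m, rfl⟩ ⟨u, hu, l, rfl⟩
    refine ⟨w + φ ^ (m * k) • u, Λ.add_mem hw (hm m u hu), m + l, ?_⟩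
    rw [zpow_add]
    generalize hz : (⟨a, k⟩ : CyclicExt A φ) ^ l = y
    have hx : ((⟨a, k⟩ : CyclicExt A φ) ^ m).k = m * k := by simp
    -- Only the `ℤ`-coordinate of the power matters, so no formula for its `A`-coordinate is needed.
    generalize (⟨a, k⟩ : CyclicExt A φ) ^ m = x at *
    ext
    · simp [hx]; abel
    · simp
  inv_mem' := by
    have hm : ∀ m : ℤ, ∀ w ∈ Λ, φ ^ (m * k) • w ∈ Λ := by
      intro m w hw
      have h : (φ ^ k) ∈ MulAction.stabilizer C Λ := hΛ
      have h2 : (φ ^ k) ^ m • Λ = Λ := (MulAction.stabilizer C Λ).zpow_mem h m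
      rw [mul_comm, zpow_mul, zpow_natCast, ← h2]
      exact AddSubgroup.smul_mem_pointwise_smul _ _ _ hw
    rintro _ ⟨w, hw, m, rfl⟩
    refine ⟨-(φ ^ (-m * k) • w), Λ.neg_mem (hm _ _ hw), -m, ?_⟩
    rw [mul_inv_rev, zpow_neg]
    have hx : ((⟨a, k⟩ : CyclicExt A φ) ^ m).k = m * k := by simp
    generalize (⟨a, k⟩ : CyclicExt A φ) ^ m = x at *
    ext
    · simp [hx]; abel
    · simp

section ofData

variable {k : ℕ} {Λ : AddSubgroup A} {hΛ : φ ^ k • Λ = Λ} {a : A}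

lemma isStep_ofData : IsStep (ofData k Λ hΛ a) k := by
  refine ⟨?_, a, 0, Λ.zero_mem, 1, by ext <;> simp⟩
  rintro _ ⟨w, hw, m, rfl⟩
  simp

lemma lat_ofData (h0 : 0 < k) : lat (ofData k Λ hΛ a) = Λ := by
  ext v
  rw [mem_lat]
  constructor
  · rintro ⟨w, hw, m, h⟩
    have h1 := congrArg CyclicExt.k h
    have : m = 0 := by simpa [h0.ne'] using h1.symm
    subst this
    have h2 := congrArg CyclicExt.v h
    simp at h2
    rwa [h2]
  · intro hv
    exact ⟨v, hv, 0, by simp⟩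

lemma mk_mem_ofData (h0 : 0 < k) {b : A} : ⟨b, k⟩ ∈ ofData k Λ hΛ a ↔ b - a ∈ Λ := by
  constructor
  · rintro ⟨w, hw, m, h⟩
    have h1 := congrArg CyclicExt.k h
    have : m = 1 := by
      simp at h1
      have : (k : ℤ) ≠ 0 := by exact_mod_cast h0.ne'
      have h3 : (m - 1) * (k : ℤ) = 0 := by linarith
      rcases mul_eq_zero.1 h3 with h | h
      · linarith
      · exact absurd h this
    subst this
    have h2 := congrArg CyclicExt.v h
    simp at h2
    simpa [h2] using hw
  · intro hb
    exact ⟨b - a, hb, 1, by ext <;> simp⟩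

end ofData

lemma mk_mem_iff {D : Subgroup (CyclicExt A φ)} {k : ℤ} {a b : A}
    (ha : (⟨a, k⟩ : CyclicExt A φ) ∈ D) :
    (⟨b, k⟩ : CyclicExt A φ) ∈ D ↔ b - a ∈ lat D := by
  have : (⟨b, k⟩ : CyclicExt A φ) = ⟨b - a, 0⟩ * ⟨a, k⟩ := by ext <;> simp
  rw [mem_lat, this, D.mul_mem_cancel_right ha]

/-- Dividing an element of `D` by a suitable power of `(a, k)` lands in `D ∩ A`. Hence the step, the
lattice and one `a` determine `D`. -/
lemma IsStep.eq_ofData {D : Subgroup (CyclicExt A φ)} {k : ℕ} (hk : IsStep D k) {a : A}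
    (ha : (⟨a, k⟩ : CyclicExt A φ) ∈ D) : D = ofData k (lat D) hk.smul_lat a := by
  ext g
  constructor
  · intro hg
    obtain ⟨m, hm⟩ := hk.1 g hg
    have h1 := D.mul_mem hg (D.zpow_mem ha (-m))
    have h2 : (g * ⟨a, k⟩ ^ (-m)).k = 0 := by simp [hm]; ring
    refine ⟨(g * ⟨a, k⟩ ^ (-m)).v, ?_, m, ?_⟩
    · rw [mem_lat]
      convert h1 using 1
      ext
      · rfl
      · exact h2.symm
    · rw [← mul_inv_eq_iff_eq_mul, ← zpow_neg]
      ext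
      · rfl
      · exact h2
  · rintro ⟨w, hw, m, rfl⟩
    exact D.mul_mem hw (D.zpow_mem ha m)

end CyclicExt
end Platycosm

/-! ### Burnside's lemma, and lattices with cosets under a cyclic group. -/

namespace Platycosm

/-- The orbit-counting theorem for an invariant finite set. -/
theorem sum_ncard_fixed_eq {G S : Type*} [Group G] [Fintype G] [MulAction G S] (Y : Set S)
    (hY : Y.Finite) (hinv : ∀ g : G, ∀ y ∈ Y, g • y ∈ Y) :
    ∑ g : G, {y ∈ Y | g • y = y}.ncard =
      ((Quotient.mk (MulAction.orbitRel G S)) '' Y).ncard * Fintype.card G := by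
  classical
  -- `S` may be infinite, so Burnside's lemma is applied to `Y` as a `G`-set of its own. Its orbits
  -- are then matched with the orbits of `S` that meet `Y`.
  let Y' : SubMulAction G S := ⟨Y, fun g y => hinv g y⟩
  have : Finite Y' := hY
  have := Fintype.ofFinite Y'
  have := Fintype.ofFinite (Quotient (MulAction.orbitRel G Y'))
  have h := MulAction.sum_card_fixedBy_eq_card_orbits_mul_card_group G Y'
  have h1 : ∀ g : G, Fintype.card (MulAction.fixedBy Y' g) = {y ∈ Y | g • y = y}.ncard := by
    intro g
    rw [← Nat.card_eq_fintype_card, ← Nat.card_coe_set_eq]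
    refine Nat.card_congr
      { toFun x := ⟨x.1.1, x.1.2, congrArg Subtype.val x.2⟩
        invFun y := ⟨⟨y.1, y.2.1⟩, Subtype.ext y.2.2⟩
        left_inv _ := rfl
        right_inv _ := rfl }
  have h2 : Fintype.card (Quotient (MulAction.orbitRel G Y')) =
      ((Quotient.mk (MulAction.orbitRel G S)) '' Y).ncard := by
    rw [← Nat.card_eq_fintype_card, ← Nat.card_coe_set_eq]
    have hrel : ∀ a b : Y', (MulAction.orbitRel G Y') a b ↔ (MulAction.orbitRel G S) a.1 b.1 := by
      intro a b
      constructor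
      · rintro ⟨g, hg⟩
        exact ⟨g, congrArg Subtype.val hg⟩
      · rintro ⟨g, hg⟩
        exact ⟨g, Subtype.ext hg⟩
    refine Nat.card_congr (Equiv.ofBijective
      (Quotient.lift (fun y : Y' => (⟨Quotient.mk _ y.1, y.1, y.2, rfl⟩ :
        (Quotient.mk (MulAction.orbitRel G S)) '' Y))
        (fun a b hab => Subtype.ext (Quotient.sound ((hrel a b).1 hab)))) ⟨?_, ?_⟩)
    · intro a b
      refine Quotient.inductionOn₂ a b fun a b hab => ?_
      exact Quotient.sound ((hrel a b).2 (Quotient.exact (congrArg Subtype.val hab)))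
    · rintro ⟨_, y, hy, rfl⟩
      exact ⟨Quotient.mk _ ⟨y, hy⟩, rfl⟩
  rw [← h2, ← h]
  exact Finset.sum_congr rfl fun g _ => (h1 g).symm

section Twist

variable {A C : Type} [AddCommGroup A] [Group C] [DistribMulAction C A]

/-- The endomorphism `a ↦ c a - a`. -/
def subOne (c : C) : A →+ A := DistribSMul.toAddMonoidHom A c - AddMonoidHom.id A

@[simp] lemma subOne_apply (c : C) (a : A) : subOne c a = c • a - a := rfl

lemma subOne_comm {c d : C} (h : Commute c d) (a : A) :
    subOne c (d • a) = d • subOne c a := by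
  simp [smul_sub, ← mul_smul, h.eq]

lemma smul_range_subOne {c d : C} (h : Commute c d) :
    d • (subOne c : A →+ A).range = (subOne c).range := by
  ext x
  rw [AddSubgroup.mem_pointwise_smul_iff_inv_smul_mem]
  constructor
  · rintro ⟨y, hy⟩
    exact ⟨d • y, by rw [subOne_comm h, hy, smul_inv_smul]⟩
  · rintro ⟨y, rfl⟩
    exact ⟨d⁻¹ • y, subOne_comm h.inv_right y⟩

variable (φ : C)

/-- For fixed `V`, the exponents `i` with `(φ ^ i - 1) A ⊆ V` form a subgroup of `ℤ`, because `φ ^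
(i + j) - 1 = (φ ^ i - 1) φ ^ j + (φ ^ j - 1)`. Bézout then handles the gcd. -/
lemma range_subOne_gcd (m n : ℤ) :
    (subOne (φ ^ m) : A →+ A).range ⊔ (subOne (φ ^ n)).range =
      (subOne (φ ^ (Int.gcd m n : ℤ))).range := by
  have key : ∀ V : AddSubgroup A, ∃ T : AddSubgroup ℤ,
      ∀ i : ℤ, i ∈ T ↔ (subOne (φ ^ i) : A →+ A).range ≤ V := by
    intro V
    have e : ∀ i : ℤ, (subOne (φ ^ i) : A →+ A).range ≤ V ↔ ∀ a : A, φ ^ i • a - a ∈ V := by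
      intro i
      exact ⟨fun h a => h ⟨a, rfl⟩, by rintro h _ ⟨a, rfl⟩; exact h a⟩
    refine ⟨⟨⟨⟨{i : ℤ | ∀ a : A, φ ^ i • a - a ∈ V}, ?_⟩, ?_⟩, ?_⟩, fun i => (e i).symm⟩
    · intro i j hi hj a
      have := V.add_mem (hi (φ ^ j • a)) (hj a)
      rwa [sub_add_sub_cancel, ← mul_smul, ← zpow_add] at this
    · intro a
      simp
    · intro i hi a
      have := V.neg_mem (hi (φ ^ (-i) • a))
      rwa [neg_sub, ← mul_smul, ← zpow_add, add_neg_cancel, zpow_zero, one_smul] at this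
  have dvd_le : ∀ i j : ℤ, i ∣ j → (subOne (φ ^ j) : A →+ A).range ≤ (subOne (φ ^ i)).range := by
    rintro i j ⟨t, rfl⟩
    obtain ⟨T, hT⟩ := key (subOne (φ ^ i)).range
    rw [← hT, mul_comm]
    exact T.zsmul_mem ((hT i).2 le_rfl) t
  apply le_antisymm
  · exact sup_le (dvd_le _ _ (Int.gcd_dvd_left ..)) (dvd_le _ _ (Int.gcd_dvd_right ..))
  · obtain ⟨T, hT⟩ := key ((subOne (φ ^ m)).range ⊔ (subOne (φ ^ n)).range)
    rw [← hT, Int.gcd_eq_gcd_ab, mul_comm m, mul_comm n]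
    exact T.add_mem (T.zsmul_mem ((hT _).2 le_sup_left) _) (T.zsmul_mem ((hT _).2 le_sup_right) _)

lemma zpow_smul_gcd {S : Type*} [MulAction C S] (m n : ℤ) (x : S) :
    φ ^ (Int.gcd m n : ℤ) • x = x ↔ φ ^ m • x = x ∧ φ ^ n • x = x := by
  have dvd : ∀ i j : ℤ, i ∣ j → φ ^ i • x = x → φ ^ j • x = x := by
    rintro i j ⟨t, rfl⟩ h
    rw [zpow_mul]
    exact (MulAction.stabilizer C x).zpow_mem h t
  refine ⟨fun h => ⟨dvd _ _ (Int.gcd_dvd_left ..) h, dvd _ _ (Int.gcd_dvd_right ..) h⟩, ?_⟩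
  rintro ⟨h1, h2⟩
  rw [Int.gcd_eq_gcd_ab, zpow_add, mul_smul, dvd _ _ (Dvd.intro _ rfl) h2,
    dvd _ _ (Dvd.intro _ rfl) h1]

lemma smul_sup_addSubgroup (c : C) (V W : AddSubgroup A) : c • (V ⊔ W) = c • V ⊔ c • W :=
  AddSubgroup.map_sup _ _ _

lemma finite_quotient_of_index_ne_zero {W : AddSubgroup A} (hW : W.index ≠ 0) : Finite (A ⧸ W) :=
  @AddSubgroup.finite_quotient_of_finiteIndex _ _ _ ⟨hW⟩

/-- An endomorphism of a finite quotient has as many elements in its kernel as in its cokernel. -/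
lemma card_fixed_quotient (W : AddSubgroup A) (hW : W.index ≠ 0) (h : A →+ A)
    (hh : W ≤ W.comap h) :
    Nat.card {x : A ⧸ W // QuotientAddGroup.map W W h hh x = 0} = (W ⊔ h.range).index := by
  set f := QuotientAddGroup.map W W h hh with hf
  have : Finite (A ⧸ W) := finite_quotient_of_index_ne_zero (hW)
  have h1 : Nat.card {x : A ⧸ W // f x = 0} = Nat.card f.ker := rfl
  have h2 : (W ⊔ h.range).index = f.range.index := by
    rw [← AddSubgroup.index_comap_of_surjective f.range (QuotientAddGroup.mk'_surjective W)]
    congr 1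
    have : f.range = h.range.map (QuotientAddGroup.mk' W) := by
      ext x
      constructor
      · rintro ⟨y, rfl⟩
        induction y using QuotientAddGroup.induction_on with | H y => ?_
        exact ⟨h y, ⟨y, rfl⟩, rfl⟩
      · rintro ⟨_, ⟨y, rfl⟩, rfl⟩
        exact ⟨(y : A ⧸ W), rfl⟩
    rw [this, AddSubgroup.comap_map_eq, QuotientAddGroup.ker_mk', sup_comm]
  rw [h1, h2]
  have e1 := f.range.card_mul_index
  have e2 := f.ker.card_mul_index
  have e3 : f.ker.index = Nat.card f.range := AddSubgroup.index_ker f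
  rw [e3, mul_comm, ← e1] at e2
  exact Nat.eq_of_mul_eq_mul_left Nat.card_pos e2

/-- The coset of `W` that contains `a`. -/
def cosetOf (W : AddSubgroup A) (a : A) : Set A := {x | x - a ∈ W}

lemma cosetOf_eq_iff {W : AddSubgroup A} {a b : A} :
    cosetOf W a = cosetOf W b ↔ a - b ∈ W := by
  constructor
  · intro h
    have : a ∈ cosetOf W a := by simp [cosetOf]
    rw [h] at this
    exact this
  · intro h
    ext x
    change x - a ∈ W ↔ x - b ∈ W
    rw [← sub_add_sub_cancel x a b, W.add_mem_cancel_right h]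

lemma smul_cosetOf (c : C) (W : AddSubgroup A) (a : A) :
    c • cosetOf W a = cosetOf (c • W) (c • a) := by
  ext x
  rw [Set.mem_smul_set_iff_inv_smul_mem]
  change c⁻¹ • x - a ∈ W ↔ x - c • a ∈ c • W
  rw [AddSubgroup.mem_pointwise_smul_iff_inv_smul_mem, smul_sub, inv_smul_smul]

/-- Pairs of a subgroup `Λ` of index `l` that is stable under `φ ^ k` and a coset of
`Λ + (φ ^ k - 1) A`. -/
def latCosets (k l : ℕ) : Set (AddSubgroup A × Set A) :=
  {x | x.1.index = l ∧ φ ^ k • x.1 = x.1 ∧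
    ∃ a, x.2 = cosetOf (x.1 ⊔ (subOne (φ ^ k)).range) a}

lemma smul_mem_latCosets (k l : ℕ) (j : ℤ) {x : AddSubgroup A × Set A}
    (hx : x ∈ latCosets φ k l) : φ ^ j • x ∈ latCosets φ k l := by
  obtain ⟨h1, h2, a, h3⟩ := hx
  refine ⟨?_, ?_, φ ^ j • a, ?_⟩
  · rw [← h1]
    exact AddSubgroup.index_map_of_bijective (f := DistribSMul.toAddMonoidHom A (φ ^ j))
      (MulAction.bijective (φ ^ j)) x.1
  · rw [Prod.smul_fst, ← mul_smul, ((Commute.refl φ).pow_left k |>.zpow_right j).eq, mul_smul, h2]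
  · rw [Prod.smul_snd, h3, smul_cosetOf, smul_sup_addSubgroup, Prod.smul_fst, smul_range_subOne]
    exact ((Commute.refl φ).pow_left k).zpow_right j

variable (A) in
/-- The number of elements of `latCosets φ g l`. -/
noncomputable def latCount (g l : ℕ) : ℕ :=
  Nat.card (Σ Λ : {Λ : AddSubgroup A // Λ.index = l ∧ φ ^ g • Λ = Λ},
    A ⧸ (Λ.1 ⊔ (subOne (φ ^ g)).range))

lemma finite_latCosets {k l : ℕ} (hl : l ≠ 0) (hfin : {Λ : AddSubgroup A | Λ.index = l}.Finite) :
    (latCosets (A := A) φ k l).Finite := by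
  refine (hfin.biUnion (t := fun Λ => (fun x : A ⧸ (Λ ⊔ (subOne (φ ^ k)).range) =>
    (Λ, {y : A | (y : A ⧸ (Λ ⊔ (subOne (φ ^ k)).range)) = x})) '' Set.univ) ?_).subset ?_
  · intro Λ hΛ
    have h : (Λ ⊔ (subOne (φ ^ k)).range).index ≠ 0 := by
      have := AddSubgroup.index_dvd_of_le (le_sup_left : Λ ≤ Λ ⊔ (subOne (φ ^ k)).range)
      rw [show Λ.index = l from hΛ] at this
      exact ne_zero_of_dvd_ne_zero hl this
    have : Finite (A ⧸ (Λ ⊔ (subOne (φ ^ k)).range)) :=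
      finite_quotient_of_index_ne_zero (h)
    exact Set.finite_univ.image _
  · rintro ⟨Λ, c⟩ ⟨h1, h2, a, h3⟩
    simp only [Set.mem_iUnion]
    refine ⟨Λ, h1, (a : A ⧸ _), trivial, ?_⟩
    dsimp only at h3
    rw [h3]
    refine Prod.ext rfl (Set.ext fun x => ?_)
    change (x : A ⧸ (Λ ⊔ (subOne (φ ^ k)).range)) = a ↔ x - a ∈ Λ ⊔ (subOne (φ ^ k)).range
    rw [eq_comm, QuotientAddGroup.eq, neg_add_eq_sub]

/-- A fixed pair has `Λ` stable under both `φ ^ k` and `φ ^ j`, hence under `φ ^ g`. With `W = Λ +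
(φ ^ k - 1) A`, its fixed cosets form the kernel of `φ ^ j - 1` on `A / W`, which is as large as the
cokernel `A / (Λ + (φ ^ g - 1) A)`. As `φ ^ N = 1`, including `N` in the gcd changes neither
condition. -/
lemma ncard_fixed_latCosets {k l j N : ℕ} (hl : l ≠ 0) (hN : φ ^ N = 1) :
    {x ∈ latCosets (A := A) φ k l | φ ^ j • x = x}.ncard =
      latCount A φ ((k.gcd j).gcd N) l := by
  set g := (k.gcd j).gcd N with hg
  have hgk : ∀ {S : Type} [MulAction C S] (x : S),
      φ ^ g • x = x ↔ φ ^ k • x = x ∧ φ ^ j • x = x := by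
    intro S _ x
    have h1 := zpow_smul_gcd φ ((k.gcd j : ℕ) : ℤ) (N : ℤ) x
    have h2 := zpow_smul_gcd φ (k : ℤ) (j : ℤ) x
    simp only [Int.gcd_natCast_natCast, zpow_natCast, hN, one_smul, and_true] at h1 h2
    rw [h1, h2]
  have hR : (subOne (φ ^ k) : A →+ A).range ⊔ (subOne (φ ^ j)).range = (subOne (φ ^ g)).range := by
    have h1 := range_subOne_gcd (A := A) φ ((k.gcd j : ℕ) : ℤ) (N : ℤ)
    have h2 := range_subOne_gcd (A := A) φ (k : ℤ) (j : ℤ)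
    simp only [Int.gcd_natCast_natCast, zpow_natCast, hN] at h1 h2
    have h3 : (subOne (1 : C) : A →+ A).range = ⊥ := by
      rw [eq_bot_iff]
      rintro _ ⟨y, rfl⟩
      simp
    rw [h2, ← h1, h3, sup_bot_eq]
  have hW : ∀ Λ : AddSubgroup A, φ ^ j • Λ = Λ →
      Λ ⊔ (subOne (φ ^ k)).range ≤ (Λ ⊔ (subOne (φ ^ k)).range).comap (subOne (φ ^ j)) := by
    intro Λ hΛ x hx
    refine AddSubgroup.sub_mem _ ?_ hx
    have : φ ^ j • (Λ ⊔ (subOne (φ ^ k)).range) = Λ ⊔ (subOne (φ ^ k)).range := by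
      rw [smul_sup_addSubgroup, hΛ, smul_range_subOne ((Commute.refl φ).pow_pow k j)]
    have h := AddSubgroup.smul_mem_pointwise_smul x (φ ^ j) _ hx
    rwa [this] at h
  have e : ∀ Λ : {Λ : AddSubgroup A // Λ.index = l ∧ φ ^ g • Λ = Λ},
      Nonempty ({x : A ⧸ (Λ.1 ⊔ (subOne (φ ^ k)).range) //
        QuotientAddGroup.map _ _ (subOne (φ ^ j)) (hW Λ.1 ((hgk _).1 Λ.2.2).2) x = 0} ≃
        A ⧸ (Λ.1 ⊔ (subOne (φ ^ g)).range)) := by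
    intro Λ
    have hi : ∀ V, Λ.1 ≤ V → V.index ≠ 0 := by
      intro V hV
      have := AddSubgroup.index_dvd_of_le hV
      rw [Λ.2.1] at this
      exact ne_zero_of_dvd_ne_zero hl this
    have h := card_fixed_quotient _ (hi _ le_sup_left) (subOne (φ ^ j))
      (hW Λ.1 ((hgk _).1 Λ.2.2).2)
    rw [sup_assoc, hR] at h
    have f1 : Finite (A ⧸ (Λ.1 ⊔ (subOne (φ ^ g)).range)) :=
      finite_quotient_of_index_ne_zero (hi _ le_sup_left)
    have f2 : Finite (A ⧸ (Λ.1 ⊔ (subOne (φ ^ k)).range)) :=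
      finite_quotient_of_index_ne_zero (hi _ le_sup_left)
    exact (Finite.card_eq).1 h
  rw [← Nat.card_coe_set_eq, latCount, ← Nat.card_congr (Equiv.sigmaCongrRight fun Λ => (e Λ).some)]
  symm
  have fixed : ∀ (Λ : AddSubgroup A) (hΛ : φ ^ j • Λ = Λ) (a : A),
      φ ^ j • cosetOf (Λ ⊔ (subOne (φ ^ k)).range) a = cosetOf (Λ ⊔ (subOne (φ ^ k)).range) a ↔
      QuotientAddGroup.map _ _ (subOne (φ ^ j)) (hW Λ hΛ)
        (a : A ⧸ (Λ ⊔ (subOne (φ ^ k)).range)) = 0 := by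
    intro Λ hΛ a
    rw [smul_cosetOf, smul_sup_addSubgroup, hΛ,
      smul_range_subOne ((Commute.refl φ).pow_pow k j), cosetOf_eq_iff, QuotientAddGroup.map_mk,
      QuotientAddGroup.eq_zero_iff]
    rfl
  have pre : ∀ (W : AddSubgroup A) (a : A), {y : A | (y : A ⧸ W) = (a : A ⧸ W)} = cosetOf W a := by
    intro W a
    ext x
    change (x : A ⧸ W) = a ↔ x - a ∈ W
    rw [eq_comm, QuotientAddGroup.eq, neg_add_eq_sub]
  refine Nat.card_congr (Equiv.ofBijective (fun x => ⟨(x.1.1,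
    {y : A | (y : A ⧸ (x.1.1 ⊔ (subOne (φ ^ k)).range)) = x.2.1}), ?_⟩) ⟨?_, ?_⟩)
  · obtain ⟨⟨Λ, h1, h2⟩, x, hx⟩ := x
    induction x using QuotientAddGroup.induction_on with | H a => ?_
    have h3 := (hgk Λ).1 h2
    refine ⟨⟨h1, h3.1, a, pre _ a⟩, ?_⟩
    dsimp only
    rw [pre, Prod.smul_mk, h3.2, (fixed Λ h3.2 a).2 hx]
  · rintro ⟨⟨Λ, h1, h2⟩, x, hx⟩ ⟨⟨Λ', h1', h2'⟩, x', hx'⟩ h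
    have h' := congrArg Subtype.val h
    obtain ⟨rfl, h4⟩ := Prod.mk.inj h'
    congr 2
    induction x using QuotientAddGroup.induction_on with | H a => ?_
    have : a ∈ {y : A | (y : A ⧸ (Λ ⊔ (subOne (φ ^ k)).range)) = (a : A ⧸ _)} := rfl
    rw [h4] at this
    exact this
  · rintro ⟨⟨Λ, c⟩, ⟨h1, h2, a, h3⟩, h4⟩
    dsimp only at h1 h2 h3
    subst h3
    rw [Prod.smul_mk, Prod.mk.injEq] at h4
    refine ⟨⟨⟨Λ, h1, (hgk Λ).2 ⟨h2, h4.1⟩⟩, (a : A ⧸ _), (fixed Λ h4.1 a).1 h4.2⟩, ?_⟩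
    apply Subtype.ext
    dsimp only
    rw [pre]

variable (A) in
/-- The number of orbits of the powers of `φ` on `latCosets φ k l`. -/
noncomputable def orbCount (k l : ℕ) : ℕ :=
  ((Quotient.mk (MulAction.orbitRel (Subgroup.zpowers φ) (AddSubgroup A × Set A))) ''
    latCosets φ k l).ncard

/-- Burnside's lemma for the cyclic group generated by `φ`, with its elements listed as `φ ^ j` for
`j` below the order. -/
theorem orbCount_mul {k l : ℕ} (hl : l ≠ 0) (hfin : {Λ : AddSubgroup A | Λ.index = l}.Finite)
    (hφ : IsOfFinOrder φ) :
    orbCount A φ k l * orderOf φ =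
      ∑ j ∈ Finset.range (orderOf φ), latCount A φ ((k.gcd j).gcd (orderOf φ)) l := by
  classical
  have := Fintype.ofEquiv _ (finEquivZPowers hφ)
  have h := sum_ncard_fixed_eq (G := Subgroup.zpowers φ) (latCosets (A := A) φ k l)
    (finite_latCosets φ hl hfin) (by
      rintro ⟨_, j, rfl⟩ y hy
      exact smul_mem_latCosets φ k l j hy)
  rw [← Nat.card_eq_fintype_card, Nat.card_zpowers] at h
  rw [orbCount, ← h, ← Equiv.sum_comp (finEquivZPowers hφ), Finset.sum_range]
  refine Finset.sum_congr rfl fun j _ => ?_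
  rw [← ncard_fixed_latCosets φ hl (pow_orderOf_eq_one φ)]
  rfl

end Twist

end Platycosm

/-! ### Conjugacy classes as orbits of pairs. -/

namespace Platycosm
namespace CyclicExt

variable {A C : Type} [AddCommGroup A] [Group C] [DistribMulAction C A] {φ : C}

lemma IsStep.ext {D E : Subgroup (CyclicExt A φ)} {k : ℕ} (hD : IsStep D k) (hE : IsStep E k)
    (hl : lat D = lat E) {a b : A} (ha : (⟨a, k⟩ : CyclicExt A φ) ∈ D)
    (hb : (⟨b, k⟩ : CyclicExt A φ) ∈ E) (hab : b - a ∈ lat D) : D = E := by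
  have ha' : (⟨a, k⟩ : CyclicExt A φ) ∈ E := by
    rw [mk_mem_iff hb, ← hl, ← neg_sub]
    exact (lat D).neg_mem hab
  rw [hD.eq_ofData ha, hE.eq_ofData ha']
  congr 1

section Conj

variable {D : Subgroup (CyclicExt A φ)} (g : CyclicExt A φ)

lemma mem_conj {x : CyclicExt A φ} : x ∈ MulAut.conj g • D ↔ g⁻¹ * x * g ∈ D := by
  rw [Subgroup.mem_pointwise_smul_iff_inv_smul_mem, ← map_inv, MulAut.smul_def, MulAut.conj_apply,
    inv_inv]

lemma conj_mem {x : CyclicExt A φ} (hx : x ∈ D) : g * x * g⁻¹ ∈ MulAut.conj g • D :=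
  Subgroup.smul_mem_pointwise_smul _ _ _ hx

lemma lat_conj : lat (MulAut.conj g • D) = φ ^ g.k • lat D := by
  ext v
  rw [mem_lat, mem_conj, AddSubgroup.mem_pointwise_smul_iff_inv_smul_mem, mem_lat]
  have : g⁻¹ * ⟨v, 0⟩ * g = ⟨(φ ^ g.k)⁻¹ • v, 0⟩ := by
    ext <;> simp
  rw [this]

lemma IsStep.conj {k : ℕ} (hk : IsStep D k) : IsStep (MulAut.conj g • D) k := by
  obtain ⟨h, a, ha⟩ := hk
  refine ⟨fun x hx => ?_, (g * ⟨a, k⟩ * g⁻¹).v, ?_⟩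
  · have := h _ ((mem_conj g).1 hx)
    simpa using this
  · convert conj_mem g ha using 1
    ext <;> simp

/-- The term `(φ ^ k - 1) g.v` is why a conjugacy class retains `a` only modulo `lat D + (φ ^ k - 1)
A`. -/
lemma mk_conj_mem {k : ℕ} {a : A} (ha : (⟨a, k⟩ : CyclicExt A φ) ∈ D) :
    ⟨φ ^ g.k • a - subOne (φ ^ k) g.v, k⟩ ∈ MulAut.conj g • D := by
  convert conj_mem g ha using 1
  ext
  · simp only [mul_v, mul_k, inv_v, subOne_apply, smul_neg, ← mul_smul, ← zpow_add,
      add_neg_cancel_comm, zpow_natCast]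
    abel
  · simp

end Conj

variable (φ) in
/-- The orbit, under the powers of `φ`, of the pair that a subgroup determines. -/
noncomputable def invariant (D : Subgroup (CyclicExt A φ)) :
    ℕ × Quotient (MulAction.orbitRel (Subgroup.zpowers φ) (AddSubgroup A × Set A)) :=
  let k := (exists_isStep D).choose
  (k, Quotient.mk _ (lat D, cosetOf (lat D ⊔ (subOne (φ ^ k)).range)
    (exists_isStep D).choose_spec.2.choose))

lemma invariant_eq {D : Subgroup (CyclicExt A φ)} {k : ℕ} (hk : IsStep D k) {a : A}
    (ha : (⟨a, k⟩ : CyclicExt A φ) ∈ D) :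
    invariant φ D = (k, Quotient.mk _ (lat D, cosetOf (lat D ⊔ (subOne (φ ^ k)).range) a)) := by
  obtain rfl := hk.unique (exists_isStep D).choose_spec
  have h := (exists_isStep D).choose_spec.2.choose_spec
  rw [invariant]
  have e : cosetOf (lat D ⊔ (subOne (φ ^ (exists_isStep D).choose)).range)
      (exists_isStep D).choose_spec.2.choose =
      cosetOf (lat D ⊔ (subOne (φ ^ (exists_isStep D).choose)).range) a := by
    rw [cosetOf_eq_iff]
    exact AddSubgroup.mem_sup_left ((mk_mem_iff ha).1 h)
  rw [e]

/-- Conjugation by `(c, j)` acts on the data by `φ ^ j` and a shift in `(φ ^ k - 1) A`. The orbit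
absorbs the first effect and the coset the second. Conversely, both can be solved for. -/
lemma invariant_eq_iff {D E : Subgroup (CyclicExt A φ)} :
    invariant φ D = invariant φ E ↔ ∃ g : CyclicExt A φ, MulAut.conj g • D = E := by
  obtain ⟨k, hk⟩ := exists_isStep D
  obtain ⟨a, ha⟩ := hk.2
  constructor
  · intro h
    obtain ⟨l, hl⟩ := exists_isStep E
    obtain ⟨b, hb⟩ := hl.2
    rw [invariant_eq hk ha, invariant_eq hl hb, Prod.mk.injEq] at h
    obtain ⟨rfl, h⟩ := h
    obtain ⟨⟨_, j, rfl⟩, h⟩ := Quotient.exact h.symm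
    have h1 : φ ^ j • lat D = lat E := congrArg Prod.fst h
    have h2 : φ ^ j • cosetOf (lat D ⊔ (subOne (φ ^ k)).range) a =
      cosetOf (lat E ⊔ (subOne (φ ^ k)).range) b := congrArg Prod.snd h
    have hc : Commute (φ ^ k) (φ ^ j) := ((Commute.refl φ).pow_left k).zpow_right j
    rw [smul_cosetOf, smul_sup_addSubgroup, h1, smul_range_subOne hc, eq_comm, cosetOf_eq_iff,
      AddSubgroup.mem_sup] at h2
    obtain ⟨w, hw, _, ⟨c, rfl⟩, hs⟩ := h2
    -- Here `b - φ ^ j a = w + (φ ^ k - 1) c`. Conjugation by `(-c, j)` moves `a` to `φ ^ j a + (φ ^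
    -- k - 1) c`, which differs from `b` only by `w ∈ lat E`.
    refine ⟨⟨-c, j⟩, ?_⟩
    have hlat : lat (MulAut.conj (⟨-c, j⟩ : CyclicExt A φ) • D) = lat E := by
      rw [lat_conj, h1]
    refine (hk.conj _).ext hl hlat (mk_conj_mem _ ha) hb ?_
    rw [hlat]
    convert hw using 1
    rw [map_neg, sub_neg_eq_add]
    dsimp only
    rw [← sub_sub, ← hs]
    abel
  · rintro ⟨g, rfl⟩
    rw [invariant_eq hk ha, invariant_eq (hk.conj g) (mk_conj_mem g ha), Prod.mk.injEq]
    refine ⟨rfl, Eq.symm (Quotient.sound ⟨⟨φ ^ g.k, g.k, rfl⟩, ?_⟩)⟩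
    change φ ^ g.k • (_, _) = _
    have hc : Commute (φ ^ k) (φ ^ g.k) := ((Commute.refl φ).pow_left k).zpow_right _
    rw [Prod.smul_mk, lat_conj, smul_cosetOf, smul_sup_addSubgroup, smul_range_subOne hc]
    congr 1
    rw [cosetOf_eq_iff]
    refine AddSubgroup.mem_sup_right ⟨g.v, ?_⟩
    rw [sub_sub_cancel]

end CyclicExt

open CyclicExt

variable {A C : Type} [AddCommGroup A] [Group C] [DistribMulAction C A] {φ : C}

/-- The number of conjugacy classes of subgroups of a given index and type, if the type of a
subgroup can be read off from the generator of its image in `ℤ`. -/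
theorem card_subgroupClasses {H : Type} [Group H] {n : ℕ} (hn : n ≠ 0) (p : ℕ → Prop)
    [DecidablePred p]
    (hfin : ∀ l, l ≠ 0 → {Λ : AddSubgroup A | Λ.index = l}.Finite)
    (hH : ∀ (D : Subgroup (CyclicExt A φ)) (k : ℕ), D.index = n → IsStep D k →
      (Nonempty (D ≃* H) ↔ p k)) :
    Finite (SubgroupClasses H (CyclicExt A φ) n) ∧
    Nat.card (SubgroupClasses H (CyclicExt A φ) n) =
      ∑ k ∈ n.divisors with p k, orbCount A φ k (n / k) := by
  classical
  let O : ℕ → Set (Quotient (MulAction.orbitRel (Subgroup.zpowers φ) (AddSubgroup A × Set A))) :=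
    fun k => Quotient.mk _ '' latCosets φ k (n / k)
  let F := n.divisors.filter p
  have hO : ∀ k ∈ F, (O k).Finite := by
    intro k hk
    have hk' := Nat.mem_divisors.1 (Finset.mem_filter.1 hk).1
    have : n / k ≠ 0 := (Nat.div_pos (Nat.le_of_dvd (by omega) hk'.1)
      (Nat.pos_of_dvd_of_pos hk'.1 (by omega))).ne'
    exact (finite_latCosets φ this (hfin _ this)).image _
  let f : SubgroupClasses H (CyclicExt A φ) n →
      ℕ × Quotient (MulAction.orbitRel (Subgroup.zpowers φ) (AddSubgroup A × Set A)) :=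
    Quotient.lift (fun D => invariant φ D.1) (fun D E h => invariant_eq_iff.2 h)
  have hf : Function.Injective f := by
    intro D E
    refine Quotient.inductionOn₂ D E fun D E h => ?_
    exact Quotient.sound (invariant_eq_iff.1 h)
  let h : (Σ k : F, O k) →
      ℕ × Quotient (MulAction.orbitRel (Subgroup.zpowers φ) (AddSubgroup A × Set A)) :=
    fun x => (x.1.1, x.2.1)
  have hh : Function.Injective h := by
    rintro ⟨⟨k, hk⟩, x, hx⟩ ⟨⟨l, hl⟩, y, hy⟩ e
    obtain ⟨rfl, rfl⟩ := Prod.mk.inj e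
    rfl
  -- The invariant is injective on classes, and its range is the disjoint union, over the admissible
  -- steps `k`, of the orbits of pairs with lattice index `n / k`. Every such pair is realised by
  -- `ofData`.
  have hr : Set.range f = Set.range h := by
    ext x
    constructor
    · rintro ⟨D, rfl⟩
      refine Quotient.inductionOn D fun D => ?_
      obtain ⟨D, hD, hD'⟩ := D
      obtain ⟨k, hk⟩ := exists_isStep D
      obtain ⟨a, ha⟩ := hk.2
      have k0 := hk.pos (by omega)
      have hi := hk.index_eq k0
      rw [hD] at hi
      refine ⟨⟨⟨k, Finset.mem_filter.2 ⟨Nat.mem_divisors.2 ⟨⟨_, hi⟩, hn⟩, (hH D k hD hk).1 hD'⟩⟩,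
        Quotient.mk _ (lat D, cosetOf (lat D ⊔ (subOne (φ ^ k)).range) a), _,
          ⟨?_, hk.smul_lat, a, rfl⟩, rfl⟩, ?_⟩
      · dsimp only
        rw [hi, Nat.mul_div_cancel_left _ k0]
      · exact (invariant_eq hk ha).symm
    · rintro ⟨⟨⟨k, hk⟩, _, ⟨Λ, c⟩, ⟨h1, h2, a, h3⟩, rfl⟩, rfl⟩
      dsimp only at h1 h2 h3
      subst h3
      obtain ⟨hk1, hk2⟩ := Finset.mem_filter.1 hk
      have hk1 := Nat.mem_divisors.1 hk1
      have k0 := Nat.pos_of_dvd_of_pos hk1.1 (by omega)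
      have hs : IsStep (ofData k Λ h2 a) k := isStep_ofData
      have hi : (ofData k Λ h2 a).index = n := by
        rw [hs.index_eq k0, lat_ofData k0, h1, Nat.mul_div_cancel' hk1.1]
      refine ⟨Quotient.mk _ ⟨ofData k Λ h2 a, hi, (hH _ k hi hs).2 hk2⟩, ?_⟩
      change invariant φ (ofData k Λ h2 a) = _
      rw [invariant_eq hs (a := a) ((mk_mem_ofData k0).2 (by simp)), lat_ofData k0]
  have : ∀ k : F, Finite (O k) := fun k => hO k.1 k.2
  refine ⟨?_, ?_⟩
  · have : Finite (Set.range h) := Set.finite_range h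
    rw [← hr] at this
    exact Finite.of_injective_finite_range hf
  · rw [← Nat.card_range_of_injective hf, hr, Nat.card_range_of_injective hh, Nat.card_sigma,
      Finset.univ_eq_attach, Finset.sum_attach F (fun k => Nat.card (O k))]
    rfl

end Platycosm

/-! ### Counting sublattices of a lattice of rank two. -/

namespace Platycosm
open CyclicExt

lemma one_pow_smul_addSubgroup {A C : Type} [AddCommGroup A] [Group C] [DistribMulAction C A]
    (k : ℕ) (Λ : AddSubgroup A) : (1 : C) ^ k • Λ = Λ := by
  rw [one_pow, one_smul]

section RankTwo

/-- `ℤ²` as an extension of `ℤ` by `ℤ`. -/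
def prodEquivCyclicExt : Multiplicative (Fin 2 → ℤ) ≃* CyclicExt ℤ (1 : ℤˣ) where
  toFun x := ⟨x.toAdd 0, x.toAdd 1⟩
  invFun x := Multiplicative.ofAdd ![x.v, x.k]
  left_inv x := by
    apply Multiplicative.toAdd.injective
    ext i
    fin_cases i <;> rfl
  right_inv x := rfl
  map_mul' x y := by ext <;> simp

/-- This is the Hermite normal form: a subgroup of index `l` is given by its step `k ∣ l`, the
lattice `(l / k) ℤ` and a residue `a` modulo `l / k`. The total is the sum of `l / k` over `k ∣ l`.
-/
lemma card_subgroup_cyclicExt_int {l : ℕ} (hl : l ≠ 0) :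
    Nat.card {D : Subgroup (CyclicExt ℤ (1 : ℤˣ)) // D.index = l} = sigmaOne l := by
  classical
  have hpos : ∀ k : l.divisors, 0 < k.1 ∧ 0 < l / k.1 ∧ k.1 * (l / k.1) = l := by
    rintro ⟨k, hk⟩
    have hk := Nat.mem_divisors.1 hk
    have := Nat.pos_of_dvd_of_pos hk.1 (by omega)
    exact ⟨this, Nat.div_pos (Nat.le_of_dvd (by omega) hk.1) this, Nat.mul_div_cancel' hk.1⟩
  let f : (Σ k : l.divisors, Fin (l / k.1)) →
      {D : Subgroup (CyclicExt ℤ (1 : ℤˣ)) // D.index = l} := fun x =>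
    ⟨ofData x.1.1 (AddSubgroup.zmultiples ((l / x.1.1 : ℕ) : ℤ)) (one_pow_smul_addSubgroup _ _) (x.2.1 : ℤ), by
      rw [isStep_ofData.index_eq (hpos x.1).1, lat_ofData (hpos x.1).1, Int.index_zmultiples,
        Int.natAbs_natCast, (hpos x.1).2.2]⟩
  have hf : Function.Bijective f := by
    constructor
    · rintro ⟨k, r⟩ ⟨k', r'⟩ h
      have h := congrArg Subtype.val h
      dsimp only [f] at h
      have hk : k.1 = k'.1 := by
        have h1 := isStep_ofData (φ := (1 : ℤˣ)) (hΛ := one_pow_smul_addSubgroup k.1 (AddSubgroup.zmultiples ((l / k.1 : ℕ) : ℤ)))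
          (a := (r.1 : ℤ))
        rw [h] at h1
        exact h1.unique isStep_ofData
      obtain rfl : k = k' := Subtype.ext hk
      have h1 := (mk_mem_ofData (φ := (1 : ℤˣ)) (hΛ := one_pow_smul_addSubgroup k.1 (AddSubgroup.zmultiples ((l / k.1 : ℕ) : ℤ)))
        (a := (r.1 : ℤ)) (hpos k).1 (b := r.1)).2 (by simp)
      rw [h, mk_mem_ofData (hpos k).1, Int.mem_zmultiples_iff] at h1
      have h2 := r.2
      have h3 := r'.2
      have h4 := Int.eq_zero_of_abs_lt_dvd h1 (by rw [abs_lt]; omega)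
      congr 1
      ext
      omega
    · rintro ⟨D, hD⟩
      obtain ⟨k, hk⟩ := exists_isStep D
      have k0 := hk.pos (by omega)
      have hi := hk.index_eq k0
      obtain ⟨a, ha⟩ := hk.2
      have hkl : k ∈ l.divisors := Nat.mem_divisors.2 ⟨⟨_, by rw [← hi, hD]⟩, hl⟩
      have hm : (lat D).index = l / k := by
        rw [← hD, hi, Nat.mul_div_cancel_left _ k0]
      have hlat : lat D = AddSubgroup.zmultiples ((l / k : ℕ) : ℤ) := by
        obtain ⟨g, hg⟩ := Int.subgroup_cyclic (lat D)
        rw [← AddSubgroup.zmultiples_eq_closure] at hg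
        rw [hg, Int.index_zmultiples] at hm
        rw [hg, ← hm, Int.zmultiples_natAbs]
      have hm0 : (0 : ℤ) < (l / k : ℕ) := by exact_mod_cast (hpos ⟨k, hkl⟩).2.1
      have e1 := Int.emod_nonneg a hm0.ne'
      have e2 := Int.emod_lt_of_pos a hm0
      refine ⟨⟨⟨k, hkl⟩, ⟨(a % (l / k : ℕ)).toNat, (Int.toNat_lt e1).2 e2⟩⟩, Subtype.ext ?_⟩
      have hst := hk.smul_lat
      rw [hlat] at hst
      change ofData k (AddSubgroup.zmultiples ((l / k : ℕ) : ℤ)) hst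
        ((a % (l / k : ℕ)).toNat : ℤ) = D
      refine isStep_ofData.ext hk ?_ ((mk_mem_ofData k0).2 ?_) ha ?_ (a := a % (l / k : ℕ))
      · rw [lat_ofData k0, hlat]
      · rw [Int.toNat_of_nonneg e1, sub_self]
        exact zero_mem _
      · rw [lat_ofData k0, Int.mem_zmultiples_iff]
        exact Int.dvd_self_sub_emod
  rw [← Nat.card_congr (Equiv.ofBijective f hf), Nat.card_sigma]
  simp only [Nat.card_eq_fintype_card, Fintype.card_fin]
  rw [Finset.univ_eq_attach, Finset.sum_attach l.divisors (fun k => l / k), sigmaOne]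
  exact Nat.sum_div_divisors l (fun k => k)

variable {L : Type} [AddCommGroup L]

/-- A free abelian group of rank two has `σ₁(l)` subgroups of index `l`. -/
theorem card_addSubgroup_index (e : L ≃+ (Fin 2 → ℤ)) {l : ℕ} (hl : l ≠ 0) :
    Nat.card {Λ : AddSubgroup L // Λ.index = l} = sigmaOne l := by
  rw [← card_subgroup_cyclicExt_int hl]
  let E : Multiplicative L ≃* CyclicExt ℤ (1 : ℤˣ) := e.toMultiplicative.trans prodEquivCyclicExt
  refine Nat.card_congr ((AddSubgroup.toSubgroup.toEquiv.trans E.mapSubgroup.toEquiv).subtypeEquiv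
    fun Λ => ?_)
  have : ((AddSubgroup.toSubgroup.toEquiv.trans E.mapSubgroup.toEquiv) Λ).index = Λ.index := by
    rw [← AddSubgroup.index_toSubgroup]
    exact Subgroup.index_map_equiv _ E
  rw [this]

lemma sigmaOne_pos {l : ℕ} (hl : l ≠ 0) : 0 < sigmaOne l := by
  have := Finset.single_le_sum (f := fun k : ℕ => k) (fun _ _ => Nat.zero_le _)
    (Nat.mem_divisors_self l hl)
  exact lt_of_lt_of_le (by omega) this

lemma finite_addSubgroup_index (e : L ≃+ (Fin 2 → ℤ)) {l : ℕ} (hl : l ≠ 0) :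
    {Λ : AddSubgroup L | Λ.index = l}.Finite := by
  have h := card_addSubgroup_index e hl
  exact Nat.finite_of_card_ne_zero (α := {Λ : AddSubgroup L // Λ.index = l})
    (by rw [h]; exact (sigmaOne_pos hl).ne')

lemma exists_addEquiv_of_index_ne_zero (e : L ≃+ (Fin 2 → ℤ)) {Λ : AddSubgroup L}
    (hΛ : Λ.index ≠ 0) : Nonempty (Λ ≃+ (Fin 2 → ℤ)) := by
  have h : (Λ.map (e : L →+ (Fin 2 → ℤ))).index ≠ 0 := by
    rwa [AddSubgroup.index_map_of_bijective (f := (e : L →+ (Fin 2 → ℤ))) e.bijective]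
  obtain ⟨f⟩ := Int.addSubgroup_index_ne_zero_iff.1 h
  exact ⟨(e.addSubgroupMap Λ).trans f⟩

/-- `Λ'` is again free of rank two, so it has `σ₁(2) = 3` subgroups of index two. -/
lemma card_addSubgroup_relIndex_two (e : L ≃+ (Fin 2 → ℤ)) {Λ' : AddSubgroup L}
    (hΛ' : Λ'.index ≠ 0) :
    Nat.card {Λ : AddSubgroup L // Λ ≤ Λ' ∧ Λ.relIndex Λ' = 2} = 3 := by
  obtain ⟨f⟩ := exists_addEquiv_of_index_ne_zero e hΛ'
  rw [show 3 = sigmaOne 2 from rfl, ← card_addSubgroup_index f two_ne_zero]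
  have hK : ∀ K : AddSubgroup Λ', (K.map Λ'.subtype).addSubgroupOf Λ' = K := fun K =>
    AddSubgroup.comap_map_eq_self_of_injective Λ'.subtype_injective K
  refine Nat.card_congr
    { toFun Λ := ⟨Λ.1.addSubgroupOf Λ', Λ.2.2⟩
      invFun K := ⟨K.1.map Λ'.subtype, ?_, ?_⟩
      left_inv Λ := Subtype.ext (AddSubgroup.map_addSubgroupOf_eq_of_le Λ.2.1)
      right_inv K := Subtype.ext (hK K.1) }
  · exact AddSubgroup.map_subtype_le _
  · rw [AddSubgroup.relIndex, hK, K.2]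

/-- The pairs of a subgroup of index `l` and an element of order two in the quotient. -/
lemma card_sigma_two_torsion (e : L ≃+ (Fin 2 → ℤ)) {l : ℕ} (hl : l ≠ 0) :
    Nat.card (Σ Λ : {Λ : AddSubgroup L // Λ.index = l},
      {x : L ⧸ Λ.1 // x ≠ 0 ∧ x + x = 0}) = if 2 ∣ l then 3 * sigmaOne (l / 2) else 0 := by
  have card2 : ∀ {Λ : AddSubgroup L} {x : L ⧸ Λ}, x ≠ 0 → x + x = 0 →
      Nat.card (AddSubgroup.zmultiples x) = 2 := by
    intro Λ x h1 h2
    rw [Nat.card_zmultiples]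
    have : Fact (Nat.Prime 2) := ⟨Nat.prime_two⟩
    exact addOrderOf_eq_prime (by rw [two_nsmul, h2]) h1
  have rel : ∀ {Λ : AddSubgroup L} (V : AddSubgroup (L ⧸ Λ)),
      Λ ≤ V.comap (QuotientAddGroup.mk' Λ) ∧
      Λ.relIndex (V.comap (QuotientAddGroup.mk' Λ)) = Nat.card V := by
    intro Λ V
    -- `Λ` is the kernel of the quotient map, that is, the preimage of `⊥`. The separate variable
    -- `K` keeps the `Λ` inside the quotient type untouched.
    have key : ∀ K, K = (⊥ : AddSubgroup (L ⧸ Λ)).comap (QuotientAddGroup.mk' Λ) →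
        K ≤ V.comap (QuotientAddGroup.mk' Λ) ∧
        K.relIndex (V.comap (QuotientAddGroup.mk' Λ)) = Nat.card V := by
      rintro _ rfl
      refine ⟨AddSubgroup.comap_mono bot_le, ?_⟩
      rw [AddSubgroup.relIndex_comap, AddSubgroup.map_comap_eq_self_of_surjective
        (QuotientAddGroup.mk'_surjective Λ), AddSubgroup.relIndex_bot_left]
    exact key Λ (QuotientAddGroup.ker_mk' Λ).symm
  -- Double counting: an element `x` of order two in `L / Λ` corresponds to the lattice `Λ'` of
  -- index `l / 2` that is the preimage of `⟨x⟩`, as a group of order two has one nonzero element.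
  -- Each `Λ'` contains three `Λ` of relative index two.
  let T := Σ Λ' : {Λ : AddSubgroup L // Λ.index * 2 = l},
    {Λ : AddSubgroup L // Λ ≤ Λ'.1 ∧ Λ.relIndex Λ'.1 = 2}
  let f : (Σ Λ : {Λ : AddSubgroup L // Λ.index = l}, {x : L ⧸ Λ.1 // x ≠ 0 ∧ x + x = 0}) → T :=
    fun y => ⟨⟨(AddSubgroup.zmultiples y.2.1).comap (QuotientAddGroup.mk' y.1.1), by
        have h := rel (AddSubgroup.zmultiples y.2.1)
        rw [card2 y.2.2.1 y.2.2.2] at h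
        rw [mul_comm, ← h.2, AddSubgroup.relIndex_mul_index h.1, y.1.2]⟩,
      ⟨y.1.1, (rel _).1, by rw [(rel _).2, card2 y.2.2.1 y.2.2.2]⟩⟩
  have hf : Function.Bijective f := by
    constructor
    · rintro ⟨⟨Λ, h1⟩, x, h2, h3⟩ ⟨⟨Λ', h1'⟩, x', h2', h3'⟩ h
      have hL : Λ = Λ' := by
        have := congrArg (fun t : T => t.2.1) h
        exact this
      subst hL
      have hL : (AddSubgroup.zmultiples x).comap (QuotientAddGroup.mk' Λ) =
          (AddSubgroup.zmultiples x').comap (QuotientAddGroup.mk' Λ) :=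
        congrArg (fun t : T => t.1.1) h
      have hz := AddSubgroup.comap_injective (QuotientAddGroup.mk'_surjective Λ) hL
      have hx : x ∈ AddSubgroup.zmultiples x' := by
        rw [← hz]; exact AddSubgroup.mem_zmultiples x
      obtain ⟨m, hm⟩ := hx
      have hm : m • x' = x := hm
      have : x' = x := by
        rcases Int.even_or_odd' m with ⟨c, rfl | rfl⟩
        · rw [mul_comm, mul_smul, two_zsmul, h3', smul_zero] at hm
          exact absurd hm.symm h2
        · rw [add_smul, mul_comm, mul_smul, two_zsmul, h3', smul_zero, zero_add, one_smul] at hm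
          exact hm
      subst this
      rfl
    · rintro ⟨⟨Λ', h1⟩, Λ, h2, h3⟩
      set V := Λ'.map (QuotientAddGroup.mk' Λ) with hV
      have hVc : V.comap (QuotientAddGroup.mk' Λ) = Λ' := by
        rw [hV, AddSubgroup.comap_map_eq, QuotientAddGroup.ker_mk', sup_eq_left.2 h2]
      have hc : Nat.card V = 2 := by rw [← (rel V).2, hVc, h3]
      have : Fact (Nat.Prime 2) := ⟨Nat.prime_two⟩
      obtain ⟨⟨x, hxV⟩, hx⟩ := (isAddCyclic_of_prime_card hc).exists_generator
      have hzV : AddSubgroup.zmultiples x = V := by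
        apply le_antisymm
        · rwa [AddSubgroup.zmultiples_le]
        · intro y hy
          obtain ⟨m, hm⟩ := hx ⟨y, hy⟩
          exact ⟨m, congrArg Subtype.val hm⟩
      have ho : addOrderOf x = 2 := by rw [← Nat.card_zmultiples, hzV, hc]
      have hx0 : x ≠ 0 := by
        rintro rfl
        simp at ho
      have hxx : x + x = 0 := by
        rw [← two_nsmul, ← ho, addOrderOf_nsmul_eq_zero]
      have hi : Λ.index = l := by
        rw [← AddSubgroup.relIndex_mul_index h2, h3, mul_comm, h1]
      refine ⟨⟨⟨Λ, hi⟩, x, hx0, hxx⟩, ?_⟩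
      have e1 : (AddSubgroup.zmultiples x).comap (QuotientAddGroup.mk' Λ) = Λ' := by
        rw [hzV, hVc]
      dsimp only [f]
      subst e1
      rfl
  rw [Nat.card_congr (Equiv.ofBijective f hf)]
  have hne : ∀ Λ' : {Λ : AddSubgroup L // Λ.index * 2 = l}, Λ'.1.index ≠ 0 := by
    rintro ⟨Λ', h⟩ h0
    rw [h0] at h
    omega
  have e3 : ∀ Λ' : {Λ : AddSubgroup L // Λ.index * 2 = l},
      Nonempty ({Λ : AddSubgroup L // Λ ≤ Λ'.1 ∧ Λ.relIndex Λ'.1 = 2} ≃ Fin 3) := by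
    intro Λ'
    have h := card_addSubgroup_relIndex_two e (hne Λ')
    have : Finite {Λ : AddSubgroup L // Λ ≤ Λ'.1 ∧ Λ.relIndex Λ'.1 = 2} :=
      Nat.finite_of_card_ne_zero (by rw [h]; norm_num)
    exact Finite.card_eq.1 (by rw [h]; simp)
  rw [Nat.card_congr (Equiv.sigmaCongrRight fun Λ' => (e3 Λ').some),
    Nat.card_congr (Equiv.sigmaEquivProd _ _), Nat.card_prod, Nat.card_fin]
  split_ifs with h2
  · obtain ⟨m, rfl⟩ := h2
    rw [Nat.mul_div_cancel_left _ two_pos, mul_comm, ← card_addSubgroup_index e (l := m) (by omega)]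
    congr 1
    exact Nat.card_congr (Equiv.subtypeEquivRight fun Λ => by omega)
  · have : IsEmpty {Λ : AddSubgroup L // Λ.index * 2 = l} :=
      ⟨fun Λ => h2 ⟨_, by rw [mul_comm]; exact Λ.2.symm⟩⟩
    simp

end RankTwo

/-! ### Fixed-point counts when `φ ^ g` acts as `1` or `-1`. -/

section latCount

variable {A C : Type} [AddCommGroup A] [Group C] [DistribMulAction C A] {φ : C}

/-- Every `Λ` is stable and `(φ ^ g - 1) A = 0`, so each of the `σ₁(l)` lattices contributes `|A /
Λ| = l`. -/
lemma latCount_of_forall_smul_eq (e : A ≃+ (Fin 2 → ℤ)) {g l : ℕ} (hl : l ≠ 0)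
    (hφ : ∀ a : A, φ ^ g • a = a) : latCount A φ g l = l * sigmaOne l := by
  have hΛ : ∀ Λ : AddSubgroup A, φ ^ g • Λ = Λ := by
    intro Λ
    ext x
    rw [AddSubgroup.mem_pointwise_smul_iff_inv_smul_mem]
    rw [show (φ ^ g)⁻¹ • x = x by rw [inv_smul_eq_iff, hφ]]
  have hR : (subOne (φ ^ g) : A →+ A).range = ⊥ := by
    rw [eq_bot_iff]
    rintro _ ⟨y, rfl⟩
    simp [hφ]
  have e3 : ∀ Λ : {Λ : AddSubgroup A // Λ.index = l ∧ φ ^ g • Λ = Λ},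
      Nonempty (A ⧸ (Λ.1 ⊔ (subOne (φ ^ g)).range) ≃ Fin l) := by
    intro Λ
    rw [hR, sup_bot_eq]
    have : Finite (A ⧸ Λ.1) := finite_quotient_of_index_ne_zero (by rw [Λ.2.1]; exact hl)
    refine Finite.card_eq.1 ?_
    rw [Nat.card_fin]
    exact Λ.2.1
  rw [latCount, Nat.card_congr (Equiv.sigmaCongrRight fun Λ => (e3 Λ).some),
    Nat.card_congr (Equiv.sigmaEquivProd _ _), Nat.card_prod, Nat.card_fin, mul_comm,
    ← card_addSubgroup_index e hl]
  congr 1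
  exact Nat.card_congr (Equiv.subtypeEquivRight fun Λ => by simp [hΛ])

/-- Every `Λ` is stable, and `A / (Λ + 2A)` has the size of the 2-torsion of `A / Λ`. The zero
elements give `σ₁(l)`; the elements of order two are counted by `card_sigma_two_torsion`. -/
lemma latCount_of_forall_smul_eq_neg (e : A ≃+ (Fin 2 → ℤ)) {g l : ℕ} (hl : l ≠ 0)
    (hφ : ∀ a : A, φ ^ g • a = -a) :
    latCount A φ g l = sigmaOne l + if 2 ∣ l then 3 * sigmaOne (l / 2) else 0 := by
  classical
  have hΛ : ∀ Λ : AddSubgroup A, φ ^ g • Λ = Λ := by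
    intro Λ
    ext x
    rw [AddSubgroup.mem_pointwise_smul_iff_inv_smul_mem]
    rw [show (φ ^ g)⁻¹ • x = -x by rw [inv_smul_eq_iff, hφ, neg_neg], neg_mem_iff]
  have e3 : ∀ Λ : {Λ : AddSubgroup A // Λ.index = l ∧ φ ^ g • Λ = Λ},
      Nonempty (A ⧸ (Λ.1 ⊔ (subOne (φ ^ g)).range) ≃ {x : A ⧸ Λ.1 // x + x = 0}) := by
    intro Λ
    have hW : Λ.1 ≤ Λ.1.comap (subOne (φ ^ g)) := by
      intro x hx
      change φ ^ g • x - x ∈ Λ.1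
      rw [hφ]
      exact Λ.1.sub_mem (Λ.1.neg_mem hx) hx
    have hi : Λ.1.index ≠ 0 := by rw [Λ.2.1]; exact hl
    have h := card_fixed_quotient Λ.1 hi (subOne (φ ^ g)) hW
    have f0 : Finite (A ⧸ Λ.1) := finite_quotient_of_index_ne_zero hi
    have f1 : Finite (A ⧸ (Λ.1 ⊔ (subOne (φ ^ g)).range)) :=
      finite_quotient_of_index_ne_zero
        (ne_zero_of_dvd_ne_zero hi (AddSubgroup.index_dvd_of_le le_sup_left))
    obtain ⟨E⟩ := Finite.card_eq.1 h
    refine ⟨E.symm.trans (Equiv.subtypeEquivRight fun x => ?_)⟩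
    induction x using QuotientAddGroup.induction_on with | H a => ?_
    rw [QuotientAddGroup.map_mk, subOne_apply, hφ, ← QuotientAddGroup.mk_add,
      QuotientAddGroup.eq_zero_iff, QuotientAddGroup.eq_zero_iff, ← neg_mem_iff]
    rw [neg_sub, sub_neg_eq_add]
  let I := {Λ : AddSubgroup A // Λ.index = l}
  have hfI : Finite I := finite_addSubgroup_index e hl
  have split : Nonempty ((Σ Λ : I, {x : A ⧸ Λ.1 // x + x = 0}) ≃
      I ⊕ Σ Λ : I, {x : A ⧸ Λ.1 // x ≠ 0 ∧ x + x = 0}) := by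
    refine ⟨⟨fun y => if h : y.2.1 = 0 then .inl y.1 else .inr ⟨y.1, y.2.1, h, y.2.2⟩,
      fun y => y.elim (fun Λ => ⟨Λ, 0, by simp⟩) (fun z => ⟨z.1, z.2.1, z.2.2.2⟩), ?_, ?_⟩⟩
    · rintro ⟨Λ, x, hx⟩
      by_cases h : x = 0
      · subst h
        simp only [dif_pos, Sum.elim_inl]
      · simp only [dif_neg h, Sum.elim_inr]
    · rintro (Λ | ⟨Λ, x, h, h'⟩)
      · exact dif_pos rfl
      · exact dif_neg h
  have fin2 : Finite (Σ Λ : I, {x : A ⧸ Λ.1 // x ≠ 0 ∧ x + x = 0}) := by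
    have : ∀ Λ : I, Finite (A ⧸ Λ.1) := fun Λ =>
      finite_quotient_of_index_ne_zero (by rw [Λ.2]; exact hl)
    infer_instance
  rw [← card_addSubgroup_index e hl, ← card_sigma_two_torsion e hl, ← Nat.card_sum,
    ← Nat.card_congr split.some, latCount,
    Nat.card_congr (Equiv.sigmaCongrRight fun Λ => (e3 Λ).some)]
  exact Nat.card_congr
    { toFun y := ⟨⟨y.1.1, y.1.2.1⟩, y.2⟩
      invFun y := ⟨⟨y.1.1, y.1.2, hΛ _⟩, y.2⟩
      left_inv _ := rfl
      right_inv _ := rfl }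

end latCount
end Platycosm

/-! ### Eisenstein integers: Euclidean division, principal ideals and `θ`. -/

namespace Platycosm

open scoped QuadraticAlgebra

/-- The ring of Eisenstein integers. -/
abbrev Eisenstein : Type := QuadraticAlgebra ℤ (-1) (-1)

namespace Eisenstein

/-- The primitive third root of unity. -/
abbrev om : Eisenstein := ⟨0, 1⟩

/-- The primitive sixth root of unity, as a unit of the ring. -/
def zetaUnit : Eisensteinˣ where
  val := ⟨1, 1⟩
  inv := ⟨0, -1⟩
  val_inv := by ext <;> simp
  inv_val := by ext <;> simp

/-- The units of the Eisenstein integers, acting by multiplication. -/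
def UnitGroup : Type := Eisensteinˣ

instance : Group UnitGroup := inferInstanceAs (Group Eisensteinˣ)

instance : DistribMulAction UnitGroup Eisenstein :=
  inferInstanceAs (DistribMulAction Eisensteinˣ Eisenstein)

/-- A unit as an Eisenstein integer. -/
def UnitGroup.val : UnitGroup →* Eisenstein := Units.coeHom Eisenstein

lemma UnitGroup.val_injective : Function.Injective UnitGroup.val :=
  Units.val_injective (α := Eisenstein)

lemma UnitGroup.smul_def (u : UnitGroup) (a : Eisenstein) : u • a = u.val * a := rfl

/-- The primitive sixth root of unity. -/
def zeta : UnitGroup := zetaUnit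

lemma val_zetaUnit : (zetaUnit : Eisenstein) = ⟨1, 1⟩ := rfl

lemma val_zetaUnit_pow_two : ((zetaUnit ^ 2 : Eisensteinˣ) : Eisenstein) = om := by
  rw [Units.val_pow_eq_pow_val, val_zetaUnit, pow_two]
  ext <;> simp

lemma val_zeta : zeta.val = ⟨1, 1⟩ := rfl

lemma val_zeta_pow_two : (zeta ^ 2).val = om := val_zetaUnit_pow_two

lemma val_zeta_pow_three : (zeta ^ 3).val = -1 := by
  rw [pow_succ, map_mul, val_zeta_pow_two, val_zeta]
  ext <;> simp

lemma zeta_pow_six : zeta ^ 6 = 1 := by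
  rw [show 6 = 3 * 2 from rfl, pow_mul]
  apply UnitGroup.val_injective
  rw [map_pow, val_zeta_pow_three, map_one]
  simp

lemma orderOf_zeta : orderOf zeta = 6 := by
  refine orderOf_eq_of_pow_and_pow_div_prime (by norm_num) zeta_pow_six fun p hp h => ?_
  have : p = 2 ∨ p = 3 := by
    have := (Nat.Prime.dvd_mul hp).1 (show p ∣ 2 * 3 from h)
    rcases this with h | h
    · exact .inl ((Nat.prime_dvd_prime_iff_eq hp Nat.prime_two).1 h)
    · exact .inr ((Nat.prime_dvd_prime_iff_eq hp Nat.prime_three).1 h)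
  intro e
  have e := congrArg UnitGroup.val e
  rw [map_one] at e
  rcases this with rfl | rfl
  · rw [show 6 / 2 = 3 from rfl, val_zeta_pow_three] at e
    have := congrArg QuadraticAlgebra.re e
    simp at this
  · rw [show 6 / 3 = 2 from rfl, val_zeta_pow_two] at e
    have := congrArg QuadraticAlgebra.im e
    simp at this

/-- The coordinates of an Eisenstein integer. -/
def coords : Eisenstein ≃+ (Fin 2 → ℤ) :=
  (QuadraticAlgebra.linearEquivTuple (R := ℤ) (-1) (-1)).toAddEquiv

lemma norm_eq (z : Eisenstein) : z.norm = z.re ^ 2 - z.re * z.im + z.im ^ 2 := by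
  rw [QuadraticAlgebra.norm_def]; ring

lemma norm_nonneg (z : Eisenstein) : 0 ≤ z.norm := by
  rw [norm_eq]
  nlinarith [sq_nonneg (2 * z.re - z.im), sq_nonneg z.im]

lemma norm_eq_zero {z : Eisenstein} : z.norm = 0 ↔ z = 0 := by
  refine ⟨fun h => ?_, fun h => by simp [h]⟩
  rw [norm_eq] at h
  have h1 : z.im ^ 2 = 0 := by
    nlinarith [sq_nonneg (2 * z.re - z.im), sq_nonneg z.im]
  have h1 : z.im = 0 := by simpa using h1
  rw [h1] at h
  have h2 : z.re = 0 := by simpa using h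
  exact QuadraticAlgebra.ext h2 h1

instance : NoZeroDivisors Eisenstein where
  eq_zero_or_eq_zero_of_mul_eq_zero {a b} h := by
    rw [← norm_eq_zero, ← norm_eq_zero (z := b), ← mul_eq_zero, ← map_mul, h, QuadraticAlgebra.norm_zero]

/-- The principal ideal generated by `α`. -/
def gen (α : Eisenstein) : AddSubgroup Eisenstein := (AddMonoidHom.mulLeft α).range

lemma mul_right_mem_gen {α v : Eisenstein} (hv : v ∈ gen α) (w : Eisenstein) : v * w ∈ gen α := by
  obtain ⟨u, rfl⟩ := hv
  exact ⟨u * w, (mul_assoc _ _ _).symm⟩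

lemma self_mem_gen (α : Eisenstein) : α ∈ gen α := ⟨1, mul_one α⟩

lemma gen_unit_mul (u : Eisensteinˣ) (α : Eisenstein) : gen (u * α) = gen α := by
  ext v
  constructor
  · rintro ⟨w, rfl⟩
    exact ⟨u * w, by simp; ring⟩
  · rintro ⟨w, rfl⟩
    refine ⟨((u⁻¹ : Eisensteinˣ) : Eisenstein) * w, ?_⟩
    have : (u : Eisenstein) * ((u⁻¹ : Eisensteinˣ) : Eisenstein) = 1 := u.mul_inv
    simp only [AddMonoidHom.coe_mulLeft]
    linear_combination α * w * this

lemma smul_gen (u : UnitGroup) (α : Eisenstein) : u • gen α = gen α := by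
  ext v
  rw [AddSubgroup.mem_pointwise_smul_iff_inv_smul_mem, UnitGroup.smul_def]
  constructor
  · intro h
    have := mul_right_mem_gen h u.val
    rwa [mul_comm, ← mul_assoc, ← map_mul, mul_inv_cancel, map_one, one_mul] at this
  · intro h
    rw [mul_comm]
    exact mul_right_mem_gen h _

/-- The index of the image of an injective endomorphism is the absolute value of its determinant,
and multiplication by `α` has determinant the norm of `α`. -/
lemma index_gen {α : Eisenstein} (hα : α ≠ 0) : (gen α).index = α.norm.natAbs := by
  let f : Eisenstein →ₗ[ℤ] Eisenstein := LinearMap.mulLeft ℤ α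
  have hf : Function.Injective f := mul_right_injective₀ hα
  have h := Submodule.natAbs_det_equiv f.range (LinearEquiv.ofInjective f hf)
  have e : f.range.subtype ∘ₗ (LinearEquiv.ofInjective f hf).toLinearMap = f := by
    ext <;> rfl
  have h2 : Nat.card (Eisenstein ⧸ f.range) = (gen α).index := rfl
  rw [← h2, ← h]
  erw [e]
  congr 1
  exact QuadraticAlgebra.det_toLinearMap_eq_norm α

/-- Euclidean division: rounding both coordinates of `v / α = v ᾱ / N(α)` to nearest integers leaves
an error of norm at most `3/4`. -/
lemma exists_norm_sub_mul_lt {α : Eisenstein} (hα : α ≠ 0) (v : Eisenstein) :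
    ∃ w, (v - α * w).norm < α.norm := by
  have hn : 0 < α.norm := lt_of_le_of_ne (norm_nonneg α) (fun h => hα (norm_eq_zero.1 h.symm))
  have hst : ((α.norm : ℤ) : Eisenstein) = α * star α := by
    exact QuadraticAlgebra.algebraMap_norm_eq_mul_star α
  set n := α.norm with hn'
  have round : ∀ r : ℤ, ∃ a : ℤ, |2 * (r - n * a)| ≤ n := by
    intro r
    -- This is `r / n` rounded to a nearest integer, written with integer floor division.
    refine ⟨(2 * r + n) / (2 * n), ?_⟩
    have h1 := Int.emod_nonneg (2 * r + n) (show 2 * n ≠ 0 by omega)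
    have h2 := Int.emod_lt_of_pos (2 * r + n) (show 0 < 2 * n by omega)
    have h3 := Int.emod_add_mul_ediv (2 * r + n) (2 * n)
    rw [abs_le]
    constructor <;> nlinarith
  obtain ⟨a, ha⟩ := round (v * star α).re
  obtain ⟨b, hb⟩ := round (v * star α).im
  refine ⟨⟨a, b⟩, ?_⟩
  have key : ((v - α * ⟨a, b⟩) * star α) =
      ⟨(v * star α).re - n * a, (v * star α).im - n * b⟩ := by
    have : α * ⟨a, b⟩ * star α = (n : Eisenstein) * ⟨a, b⟩ := by rw [hst]; ring
    rw [sub_mul, this]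
    ext <;> simp
  have hk := congrArg QuadraticAlgebra.norm key
  rw [map_mul, QuadraticAlgebra.norm_star, ← hn'] at hk
  generalize (v * star α).re - n * a = x at *
  generalize (v * star α).im - n * b = y at *
  have hxy : (⟨x, y⟩ : Eisenstein).norm = x ^ 2 - x * y + y ^ 2 := norm_eq _
  rw [hxy] at hk
  have hx := sq_le_sq' (abs_le.1 ha).1 (abs_le.1 ha).2
  have hy := sq_le_sq' (abs_le.1 hb).1 (abs_le.1 hb).2
  have : 4 * ((v - α * ⟨a, b⟩).norm * n) ≤ 3 * n ^ 2 := by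
    rw [hk]
    nlinarith [sq_nonneg (x + y)]
  nlinarith

/-- Since `1` and `ω` span the ring, a subgroup stable under `ω` is an ideal. -/
lemma mul_mem_of_om_mul_mem {Λ : AddSubgroup Eisenstein} (h : ∀ v ∈ Λ, om * v ∈ Λ)
    {v : Eisenstein} (hv : v ∈ Λ) (w : Eisenstein) : v * w ∈ Λ := by
  have : v * w = w.re • v + w.im • (om * v) := by
    ext <;> simp <;> ring
  rw [this]
  exact Λ.add_mem (Λ.zsmul_mem hv _) (Λ.zsmul_mem (h v hv) _)

/-- The ring is Euclidean, so a nonzero element of least norm generates the ideal. Finite index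
provides a nonzero element, namely the index itself. -/
lemma exists_eq_gen {Λ : AddSubgroup Eisenstein} (h : ∀ v ∈ Λ, om * v ∈ Λ) (hi : Λ.index ≠ 0) :
    ∃ α, α ≠ 0 ∧ Λ = gen α := by
  classical
  have hne : ∃ m : ℕ, ∃ α ∈ Λ, α ≠ 0 ∧ α.norm.natAbs = m := by
    have h1 := Λ.nsmul_index_mem 1
    exact ⟨_, _, h1, by simpa using hi, rfl⟩
  obtain ⟨α, hα, h0, hm⟩ := Nat.find_spec hne
  refine ⟨α, h0, le_antisymm (fun v hv => ?_) ?_⟩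
  · obtain ⟨w, hw⟩ := exists_norm_sub_mul_lt h0 v
    have hmem : v - α * w ∈ Λ := Λ.sub_mem hv (mul_mem_of_om_mul_mem h hα w)
    by_cases hz : v - α * w = 0
    · exact ⟨w, (sub_eq_zero.1 hz).symm⟩
    · exfalso
      have := Nat.find_min' hne ⟨_, hmem, hz, rfl⟩
      have h1 := norm_nonneg (v - α * w)
      omega
  · rintro _ ⟨w, rfl⟩
    exact mul_mem_of_om_mul_mem h hα w

/-- `ω = ζ - 1` and `ω = ζ²`, so stability under either power makes `Λ` an ideal. -/
lemma om_mul_mem_of_smul_eq {Λ : AddSubgroup Eisenstein} {g : ℕ} (hg : g = 1 ∨ g = 2)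
    (h : zeta ^ g • Λ = Λ) : ∀ v ∈ Λ, om * v ∈ Λ := by
  intro v hv
  have h1 := AddSubgroup.smul_mem_pointwise_smul v (zeta ^ g) Λ hv
  rw [h, UnitGroup.smul_def] at h1
  rcases hg with rfl | rfl
  · rw [pow_one] at h1
    convert Λ.sub_mem h1 hv using 1
    rw [val_zeta]
    ext <;> simp
    ring
  · rwa [val_zeta_pow_two] at h1

/-- Multiplication by `ζ` is the rotation `(a, b) ↦ (a - b, a)` of order six. The six cases are the
half-open sectors that tile the nonzero plane. -/
lemma exists_unit_mul_sector {α : Eisenstein} (hα : α ≠ 0) :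
    ∃ u : Eisensteinˣ, 0 ≤ ((u : Eisenstein) * α).im ∧
      ((u : Eisenstein) * α).im < ((u : Eisenstein) * α).re := by
  have h : ¬ (α.re = 0 ∧ α.im = 0) := fun h => hα (QuadraticAlgebra.ext h.1 h.2)
  have e1 : ((1 : Eisensteinˣ) : Eisenstein) = ⟨1, 0⟩ := rfl
  have e2 : ((zetaUnit : Eisensteinˣ) : Eisenstein) = ⟨1, 1⟩ := rfl
  have e3 := val_zetaUnit_pow_two
  have hneg : ∀ u : Eisensteinˣ, ((-u : Eisensteinˣ) : Eisenstein) = -(u : Eisenstein) :=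
    Units.val_neg
  by_cases c1 : 0 ≤ α.im ∧ α.im < α.re
  · exact ⟨1, by simpa using c1⟩
  by_cases c2 : 0 ≤ α.re ∧ α.re < α.re - α.im
  · exact ⟨zetaUnit, by rw [e2]; simp; omega⟩
  by_cases c3 : 0 ≤ α.re - α.im ∧ α.re - α.im < -α.im
  · exact ⟨zetaUnit ^ 2, by rw [e3]; simp; omega⟩
  by_cases c4 : 0 ≤ -α.im ∧ -α.im < -α.re
  · exact ⟨-1, by rw [hneg]; simp; omega⟩
  by_cases c5 : 0 ≤ -α.re ∧ -α.re < -(α.re - α.im)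
  · exact ⟨-zetaUnit, by rw [hneg, e2]; simp; omega⟩
  · exact ⟨-zetaUnit ^ 2, by rw [hneg, e3]; simp; omega⟩

/-- Two generators of one ideal differ by a factor `u` of norm one, whose coordinates lie in `{-1,
0, 1}`. Only `u = 1` keeps the sector. -/
lemma eq_of_gen_eq_of_sector {α β : Eisenstein} (h : gen α = gen β)
    (ha : 0 ≤ α.im ∧ α.im < α.re) (hb : 0 ≤ β.im ∧ β.im < β.re) : α = β := by
  obtain ⟨u, hu⟩ : β ∈ gen α := h ▸ self_mem_gen β
  obtain ⟨w, hw⟩ : α ∈ gen β := h ▸ self_mem_gen α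
  have hu : α * u = β := hu
  have hw : β * w = α := hw
  have h0 : α ≠ 0 := by
    rintro rfl
    simp at ha
  have huw : u * w = 1 := by
    have : α * (u * w) = α * 1 := by rw [← mul_assoc, hu, hw, mul_one]
    exact mul_left_cancel₀ h0 this
  have hn : u.norm = 1 := by
    have := congrArg QuadraticAlgebra.norm huw
    rw [map_mul, map_one] at this
    rcases Int.mul_eq_one_iff_eq_one_or_neg_one.1 this with h | h
    · exact h.1
    · have := norm_nonneg u
      omega
  rw [norm_eq] at hn
  -- From `4 N(u) = (2 re - im)² + 3 im²`, so `3 im² ≤ 4`; `re` is bounded symmetrically.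
  have h1 : u.im ^ 2 ≤ 1 := by nlinarith [sq_nonneg (2 * u.re - u.im)]
  have h2 : u.re ^ 2 ≤ 1 := by nlinarith [sq_nonneg (2 * u.im - u.re)]
  have h1 := abs_le.1 ((sq_le_one_iff_abs_le_one _).1 h1)
  have h2 := abs_le.1 ((sq_le_one_iff_abs_le_one _).1 h2)
  have r := congrArg QuadraticAlgebra.re hu
  have i := congrArg QuadraticAlgebra.im hu
  simp only [QuadraticAlgebra.re_mul, QuadraticAlgebra.im_mul] at r i
  obtain ⟨p, q⟩ := u
  obtain ⟨a, b⟩ := α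
  obtain ⟨c, d⟩ := β
  dsimp only at *
  have hp : p = -1 ∨ p = 0 ∨ p = 1 := by omega
  have hq : q = -1 ∨ q = 0 ∨ q = 1 := by omega
  rcases hp with rfl | rfl | rfl <;> rcases hq with rfl | rfl | rfl <;> simp at hn <;>
    ext <;> dsimp only <;> omega

/-- The ideals of index `l` are counted by `θ`. -/
lemma card_stable_eq_theta {g l : ℕ} (hg : g = 1 ∨ g = 2) (hl : l ≠ 0) :
    Nat.card {Λ : AddSubgroup Eisenstein // Λ.index = l ∧ zeta ^ g • Λ = Λ} = theta l := by
  rw [theta, ← Nat.card_coe_set_eq]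
  symm
  have hne : ∀ {v : ℤ × ℤ}, 0 ≤ v.2 ∧ v.2 < v.1 → (⟨v.1, v.2⟩ : Eisenstein) ≠ 0 := by
    intro v h h0
    have := congrArg QuadraticAlgebra.re h0
    simp at this
    omega
  refine Nat.card_congr (Equiv.ofBijective (fun v => ⟨gen ⟨v.1.1, v.1.2⟩, ?_, smul_gen _ _⟩) ⟨?_, ?_⟩)
  · obtain ⟨v, h1, h2, h3⟩ := v
    rw [index_gen (hne ⟨h1, h2⟩), norm_eq]
    dsimp only
    rw [h3, Int.natAbs_natCast]
  · rintro ⟨v, h1, h2, h3⟩ ⟨w, h1', h2', h3'⟩ h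
    have := eq_of_gen_eq_of_sector (congrArg Subtype.val h) ⟨h1, h2⟩ ⟨h1', h2'⟩
    exact Subtype.ext (Prod.ext (congrArg QuadraticAlgebra.re this)
      (congrArg QuadraticAlgebra.im this))
  · rintro ⟨Λ, hi, hΛ⟩
    obtain ⟨α, h0, rfl⟩ := exists_eq_gen (om_mul_mem_of_smul_eq hg hΛ) (by omega)
    obtain ⟨u, h1, h2⟩ := exists_unit_mul_sector h0
    refine ⟨⟨((u * α).re, (u * α).im), h1, h2, ?_⟩, Subtype.ext (gen_unit_mul u α)⟩
    have h3 := index_gen (α := u * α) (by simpa using h0)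
    rw [gen_unit_mul, hi, norm_eq] at h3
    have h4 := norm_nonneg (u * α)
    rw [norm_eq] at h4
    dsimp only
    omega

/-- `ζ - 1 = ω` is a unit with inverse `ω²`, so `(ζ - 1) A = A` and each ideal carries a single
coset. -/
lemma latCount_one {l : ℕ} (hl : l ≠ 0) : latCount Eisenstein zeta 1 l = theta l := by
  rw [← card_stable_eq_theta (.inl rfl) hl]
  have hR : (subOne (zeta ^ 1) : Eisenstein →+ Eisenstein).range = ⊤ := by
    rw [eq_top_iff]
    intro v _
    refine ⟨om * (om * v), ?_⟩
    rw [subOne_apply, pow_one, UnitGroup.smul_def, val_zeta]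
    ext <;> simp
  have : ∀ Λ : {Λ : AddSubgroup Eisenstein // Λ.index = l ∧ zeta ^ 1 • Λ = Λ},
      Unique (Eisenstein ⧸ (Λ.1 ⊔ (subOne (zeta ^ 1)).range)) := by
    intro Λ
    rw [hR, sup_top_eq]
    have := QuotientAddGroup.subsingleton_quotient_top (G := Eisenstein)
    exact ⟨⟨0⟩, fun _ => Subsingleton.elim _ _⟩
  exact Nat.card_congr (Equiv.sigmaUnique _ _)

/-- `ζ² - 1 = ω - 1` generates the prime of norm three. -/
lemma range_subOne_zeta_pow_two :
    (subOne (zeta ^ 2) : Eisenstein →+ Eisenstein).range = gen ⟨-1, 1⟩ := by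
  ext v
  constructor
  · rintro ⟨w, rfl⟩
    refine ⟨w, ?_⟩
    rw [subOne_apply, UnitGroup.smul_def, val_zeta_pow_two]
    ext <;> simp <;> ring
  · rintro ⟨w, rfl⟩
    refine ⟨w, ?_⟩
    rw [subOne_apply, UnitGroup.smul_def, val_zeta_pow_two]
    ext <;> simp <;> ring

/-- With `π = ω - 1`, the ideals inside `(π)` are `π` times an ideal, and multiplication by `π`
triples the index. -/
lemma card_stable_le {l : ℕ} (hl : l ≠ 0) :
    Nat.card {Λ : AddSubgroup Eisenstein //
      (Λ.index = l ∧ zeta ^ 2 • Λ = Λ) ∧ Λ ≤ gen ⟨-1, 1⟩} =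
      if 3 ∣ l then theta (l / 3) else 0 := by
  set π : Eisenstein := ⟨-1, 1⟩ with hπ
  have hπ0 : π ≠ 0 := fun h => by simpa [hπ] using congrArg QuadraticAlgebra.re h
  have hπn : π.norm = 3 := by rw [norm_eq]; norm_num [hπ]
  have hidx : ∀ β, β ≠ 0 → (gen (π * β)).index = 3 * (gen β).index := by
    intro β hβ
    rw [index_gen hβ, index_gen (mul_ne_zero hπ0 hβ), map_mul, Int.natAbs_mul, hπn]
    rfl
  have key : ∀ {Λ : AddSubgroup Eisenstein}, (Λ.index = l ∧ zeta ^ 2 • Λ = Λ) ∧ Λ ≤ gen π →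
      ∃ β, β ≠ 0 ∧ Λ = gen (π * β) ∧ l = 3 * (gen β).index := by
    rintro Λ ⟨⟨hi, hs⟩, hle⟩
    obtain ⟨α, h0, rfl⟩ := exists_eq_gen (om_mul_mem_of_smul_eq (.inr rfl) hs) (by omega)
    obtain ⟨β, hβ⟩ := hle (self_mem_gen α)
    have hβ : π * β = α := hβ
    subst hβ
    have hb := right_ne_zero_of_mul h0
    exact ⟨β, hb, rfl, by rw [← hidx β hb, hi]⟩
  split_ifs with h3
  · obtain ⟨m, rfl⟩ := h3
    rw [Nat.mul_div_cancel_left _ three_pos, ← card_stable_eq_theta (.inr rfl) (by omega)]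
    symm
    have hmap : ∀ β, (gen β).map (AddMonoidHom.mulLeft π) = gen (π * β) := by
      intro β
      ext v
      constructor
      · rintro ⟨_, ⟨w, rfl⟩, rfl⟩
        exact ⟨w, mul_assoc _ _ _⟩
      · rintro ⟨w, rfl⟩
        exact ⟨_, ⟨w, rfl⟩, (mul_assoc _ _ _).symm⟩
    refine Nat.card_congr (Equiv.ofBijective
      (fun Λ => ⟨Λ.1.map (AddMonoidHom.mulLeft π), ?_⟩) ⟨?_, ?_⟩)
    · obtain ⟨Λ, hi, hs⟩ := Λ
      obtain ⟨α, h0, rfl⟩ := exists_eq_gen (om_mul_mem_of_smul_eq (.inr rfl) hs) (by omega)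
      dsimp only
      rw [hmap]
      refine ⟨⟨by rw [hidx α h0, hi], smul_gen _ _⟩, ?_⟩
      rintro _ ⟨w, rfl⟩
      exact ⟨α * w, (mul_assoc _ _ _).symm⟩
    · rintro ⟨Λ, _⟩ ⟨Λ', _⟩ h
      exact Subtype.ext (AddSubgroup.map_injective (mul_right_injective₀ hπ0)
        (congrArg Subtype.val h))
    · rintro ⟨Λ, h⟩
      obtain ⟨β, hβ, rfl, hl'⟩ := key h
      exact ⟨⟨gen β, by omega, smul_gen _ _⟩, Subtype.ext (hmap β)⟩
  · have : IsEmpty {Λ : AddSubgroup Eisenstein //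
        (Λ.index = l ∧ zeta ^ 2 • Λ = Λ) ∧ Λ ≤ gen π} := by
      refine ⟨fun Λ => ?_⟩
      obtain ⟨β, -, -, hl'⟩ := key Λ.2
      exact h3 ⟨_, hl'⟩
    simp

/-- `(π)` has prime index three, so `A / (Λ + (π))` has three elements if `Λ ⊆ (π)` and one
otherwise. Each ideal counts once, and those inside `(π)` count twice more. -/
lemma latCount_two {l : ℕ} (hl : l ≠ 0) : latCount Eisenstein zeta 2 l =
    theta l + if 3 ∣ l then 2 * theta (l / 3) else 0 := by
  classical
  let I := {Λ : AddSubgroup Eisenstein // Λ.index = l ∧ zeta ^ 2 • Λ = Λ}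
  have : Finite I := ((finite_addSubgroup_index coords hl).subset fun Λ h => h.1 :
    {Λ : AddSubgroup Eisenstein | Λ.index = l ∧ zeta ^ 2 • Λ = Λ}.Finite)
  have := Fintype.ofFinite I
  have hidx : (gen ⟨-1, 1⟩).index = 3 := by
    rw [index_gen (fun h => by simpa using congrArg QuadraticAlgebra.re h), norm_eq]
    norm_num
  have hc : ∀ Λ : I, Nat.card (Eisenstein ⧸ (Λ.1 ⊔ (subOne (zeta ^ 2)).range)) =
      1 + if Λ.1 ≤ gen ⟨-1, 1⟩ then 2 else 0 := by
    intro Λ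
    rw [range_subOne_zeta_pow_two]
    change (Λ.1 ⊔ gen ⟨-1, 1⟩).index = _
    split_ifs with h
    · rw [sup_eq_right.2 h, hidx]
    · have hd := AddSubgroup.relIndex_mul_index (le_sup_right : gen ⟨-1, 1⟩ ≤ Λ.1 ⊔ gen ⟨-1, 1⟩)
      rw [hidx] at hd
      rcases (Nat.dvd_prime Nat.prime_three).1 (Dvd.intro_left _ hd) with h1 | h1
      · exact h1
      · rw [h1] at hd
        have : (gen ⟨-1, 1⟩).relIndex (Λ.1 ⊔ gen ⟨-1, 1⟩) = 1 := by omega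
        exact absurd (le_sup_left.trans (AddSubgroup.relIndex_eq_one.1 this)) h
  have hfin : ∀ Λ : I, Finite (Eisenstein ⧸ (Λ.1 ⊔ (subOne (zeta ^ 2)).range)) := by
    intro Λ
    refine Nat.finite_of_card_ne_zero ?_
    rw [hc]
    omega
  have h1 := card_stable_eq_theta (.inr rfl) hl
  have h2 := card_stable_le hl
  have e : latCount Eisenstein zeta 2 l =
      Nat.card (Σ Λ : I, Eisenstein ⧸ (Λ.1 ⊔ (subOne (zeta ^ 2)).range)) := rfl
  rw [e, Nat.card_sigma, Finset.sum_congr rfl fun Λ _ => hc Λ, Finset.sum_add_distrib,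
    Finset.sum_const, smul_eq_mul, mul_one, Finset.card_univ, ← Nat.card_eq_fintype_card, h1,
    ← Finset.sum_filter, Finset.sum_const, smul_eq_mul]
  have h3 : (Finset.univ.filter fun Λ : I => Λ.1 ≤ gen ⟨-1, 1⟩).card =
      if 3 ∣ l then theta (l / 3) else 0 := by
    rw [← h2, ← Fintype.card_subtype, ← Nat.card_eq_fintype_card]
    exact Nat.card_congr (Equiv.subtypeSubtypeEquivSubtypeInter
      (fun Λ : AddSubgroup Eisenstein => Λ.index = l ∧ zeta ^ 2 • Λ = Λ)
      (fun Λ => Λ ≤ gen ⟨-1, 1⟩))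
  rw [h3]
  split_ifs <;> ring

lemma latCount_three {l : ℕ} (hl : l ≠ 0) : latCount Eisenstein zeta 3 l =
    sigmaOne l + if 2 ∣ l then 3 * sigmaOne (l / 2) else 0 :=
  latCount_of_forall_smul_eq_neg coords hl fun a => by
    rw [UnitGroup.smul_def, val_zeta_pow_three, neg_one_mul]

lemma latCount_six {l : ℕ} (hl : l ≠ 0) : latCount Eisenstein zeta 6 l = l * sigmaOne l :=
  latCount_of_forall_smul_eq coords hl fun a => by rw [zeta_pow_six, one_smul]

theorem orbCount_zeta {k l : ℕ} (hl : l ≠ 0) :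
    orbCount Eisenstein zeta k l * 6 =
      ∑ j ∈ Finset.range 6, latCount Eisenstein zeta ((k.gcd j).gcd 6) l := by
  have h := orbCount_mul (A := Eisenstein) zeta (k := k) hl (finite_addSubgroup_index coords hl)
    (orderOf_pos_iff.1 (by rw [orderOf_zeta]; norm_num))
  rwa [orderOf_zeta] at h

end Eisenstein
end Platycosm

/-! ### Presentations and the isomorphism types of subgroups. -/

namespace Platycosm

open scoped QuadraticAlgebra
open CyclicExt Eisenstein

section NormalForm

variable {P : Type*} [Group P] {x y z : P}

/-- In a group generated by `x`, `y`, `z`, where `z` normalizes the abelian group generated by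
`x` and `y`, every element has the form `xⁱ yʲ zᵐ`. -/
lemma exists_normal_form (hgen : Subgroup.closure {x, y, z} = ⊤) (hxy : Commute x y)
    {a b c d a' b' c' d' : ℤ} (h1 : z * x * z⁻¹ = x ^ a * y ^ b) (h2 : z * y * z⁻¹ = x ^ c * y ^ d)
    (h1' : z⁻¹ * x * z = x ^ a' * y ^ b') (h2' : z⁻¹ * y * z = x ^ c' * y ^ d') (p : P) :
    ∃ i j m : ℤ, p = x ^ i * y ^ j * z ^ m := by
  have pw : ∀ i j a b c d : ℤ, (x ^ a * y ^ b) ^ i * (x ^ c * y ^ d) ^ j =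
      x ^ (a * i + c * j) * y ^ (b * i + d * j) := by
    intro i j a b c d
    rw [(hxy.zpow_zpow a b).mul_zpow, (hxy.zpow_zpow c d).mul_zpow, zpow_add, zpow_add,
      zpow_mul, zpow_mul, zpow_mul, zpow_mul, mul_assoc, mul_assoc]
    congr 1
    rw [← mul_assoc, ← mul_assoc]
    congr 1
    rw [← zpow_mul, ← zpow_mul]
    exact (hxy.zpow_zpow _ _).symm
  have hp : p ∈ Subgroup.closure {x, y, z} := hgen ▸ Subgroup.mem_top p
  -- A letter `z` or `z⁻¹` on the left moves past `xⁱ yʲ` by conjugation, which changes the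
  -- exponents linearly. The primed exponents serve `z⁻¹`.
  induction hp using Subgroup.closure_induction_left with
  | one => exact ⟨0, 0, 0, by simp⟩
  | mul_left s hs p _ ih =>
    obtain ⟨i, j, m, rfl⟩ := ih
    rcases hs with rfl | rfl | rfl
    · exact ⟨1 + i, j, m, by rw [zpow_add, zpow_one]; group⟩
    · exact ⟨i, 1 + j, m, by
        rw [zpow_add, zpow_one, ← mul_assoc, ← mul_assoc, ← mul_assoc, (hxy.zpow_left i).eq]⟩
    · refine ⟨a * i + c * j, b * i + d * j, m + 1, ?_⟩
      rw [← pw, ← h1, ← h2, conj_zpow, conj_zpow, zpow_add_one]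
      group
  | inv_mul_cancel s hs p _ ih =>
    obtain ⟨i, j, m, rfl⟩ := ih
    rcases hs with rfl | rfl | rfl
    · exact ⟨-1 + i, j, m, by rw [zpow_add, zpow_neg_one]; group⟩
    · exact ⟨i, -1 + j, m, by
        rw [zpow_add, zpow_neg_one, ← mul_assoc, ← mul_assoc, ← mul_assoc,
          (hxy.zpow_left i).inv_right.eq]⟩
    · refine ⟨a' * i + c' * j, b' * i + d' * j, m - 1, ?_⟩
      have e1 := conj_zpow (i := i) (a := s⁻¹) (b := x)
      have e2 := conj_zpow (i := j) (a := s⁻¹) (b := y)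
      rw [inv_inv] at e1 e2
      rw [← pw, ← h1', ← h2', e1, e2, zpow_sub_one]
      group

lemma injective_of_normal_form {D : Type*} [Group D] (f : P →* D)
    (hnf : ∀ p : P, ∃ i j m : ℤ, p = x ^ i * y ^ j * z ^ m)
    (h : ∀ i j m : ℤ, f x ^ i * f y ^ j * f z ^ m = 1 → i = 0 ∧ j = 0 ∧ m = 0) :
    Function.Injective f := by
  rw [injective_iff_map_eq_one]
  intro p hp
  obtain ⟨i, j, m, rfl⟩ := hnf p
  rw [map_mul, map_mul, map_zpow, map_zpow, map_zpow] at hp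
  obtain ⟨rfl, rfl, rfl⟩ := h i j m hp
  simp

end NormalForm

section Presentations

lemma closure_gens (rels : Set (FreeGroup Gen)) :
    Subgroup.closure {PresentedGroup.of (rels := rels) Gen.x, PresentedGroup.of Gen.y,
      PresentedGroup.of Gen.z} = ⊤ := by
  rw [← PresentedGroup.closure_range_of rels]
  congr 1
  ext g
  constructor
  · rintro (rfl | rfl | rfl) <;> exact ⟨_, rfl⟩
  · rintro ⟨⟨⟩ | ⟨⟩ | ⟨⟩, rfl⟩ <;> simp

namespace PiG5

/-- The generators of `π₁(G₅)`. -/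
abbrev gen (g : Gen) : PiG5 := PresentedGroup.of g

lemma rel_xy : gen .x * gen .y * (gen .x)⁻¹ * (gen .y)⁻¹ = 1 :=
  PresentedGroup.one_of_mem (.inl rfl)

lemma rel_zx : gen .z * gen .x * (gen .z)⁻¹ * (gen .x * gen .y)⁻¹ = 1 :=
  PresentedGroup.one_of_mem (.inr (.inl rfl))

lemma rel_zy : gen .z * gen .y * (gen .z)⁻¹ * ((gen .x)⁻¹)⁻¹ = 1 :=
  PresentedGroup.one_of_mem (.inr (.inr rfl))

lemma normal_form (p : PiG5) :
    ∃ i j m : ℤ, p = gen .x ^ i * gen .y ^ j * gen .z ^ m := by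
  have h0 : Commute (gen .x) (gen .y) := by
    have := rel_xy
    rwa [mul_inv_eq_one, mul_inv_eq_iff_eq_mul] at this
  have h1 := mul_inv_eq_one.1 rel_zx
  have h2 := mul_inv_eq_one.1 rel_zy
  have h3 : (gen .z)⁻¹ * gen .x * gen .z = (gen .y)⁻¹ := by
    rw [show (gen .z)⁻¹ * gen .x * gen .z = ((gen .z)⁻¹ * (gen .x)⁻¹ * gen .z)⁻¹ by group, ← h2]
    group
  have h4 : (gen .z)⁻¹ * gen .y * gen .z = gen .y * gen .x := by
    rw [show (gen .z)⁻¹ * gen .y * gen .z =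
      ((gen .z)⁻¹ * gen .x * gen .z)⁻¹ * ((gen .z)⁻¹ * (gen .x * gen .y) * gen .z) by group,
      h3, ← h1]
    group
  refine exists_normal_form (closure_gens _) h0 (a := 1) (b := 1) (c := -1) (d := 0)
    (a' := 0) (b' := -1) (c' := 1) (d' := 1) ?_ ?_ ?_ ?_ p
  · simpa using h1
  · simpa using h2
  · simpa using h3
  · simpa [h0.eq] using h4

/-- The homomorphism given by the images of the generators. -/
def lift {G : Type*} [Group G] (X Y Z : G) (h0 : X * Y * X⁻¹ * Y⁻¹ = 1)
    (h1 : Z * X * Z⁻¹ = X * Y) (h2 : Z * Y * Z⁻¹ = X⁻¹) : PiG5 →* G :=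
  PresentedGroup.toGroup (f := fun g => match g with | .x => X | .y => Y | .z => Z) (by
    rintro r (rfl | rfl | rfl) <;> simp [fg, h0, h1, h2])

end PiG5

namespace PiG3

/-- The generators of `π₁(G₃)`. -/
abbrev gen (g : Gen) : PiG3 := PresentedGroup.of g

lemma rel_xy : gen .x * gen .y * (gen .x)⁻¹ * (gen .y)⁻¹ = 1 :=
  PresentedGroup.one_of_mem (.inl rfl)

lemma rel_zx : gen .z * gen .x * (gen .z)⁻¹ * (gen .y)⁻¹ = 1 :=
  PresentedGroup.one_of_mem (.inr (.inl rfl))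

lemma rel_zy : gen .z * gen .y * (gen .z)⁻¹ * ((gen .x * gen .y)⁻¹)⁻¹ = 1 :=
  PresentedGroup.one_of_mem (.inr (.inr rfl))

lemma normal_form (p : PiG3) :
    ∃ i j m : ℤ, p = gen .x ^ i * gen .y ^ j * gen .z ^ m := by
  have h0 : Commute (gen .x) (gen .y) := by
    have := rel_xy
    rwa [mul_inv_eq_one, mul_inv_eq_iff_eq_mul] at this
  have h1 := mul_inv_eq_one.1 rel_zx
  have h2 := mul_inv_eq_one.1 rel_zy
  have h3 : (gen .z)⁻¹ * gen .y * gen .z = gen .x := by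
    rw [← h1]
    group
  have h4 : (gen .z)⁻¹ * gen .x * gen .z = (gen .y)⁻¹ * (gen .x)⁻¹ := by
    rw [show (gen .z)⁻¹ * gen .x * gen .z = ((gen .z)⁻¹ * (gen .x * gen .y)⁻¹ * gen .z)⁻¹ *
      ((gen .z)⁻¹ * gen .y * gen .z)⁻¹ by group, h3, ← h2]
    group
  refine exists_normal_form (closure_gens _) h0 (a := 0) (b := 1) (c := -1) (d := -1)
    (a' := -1) (b' := -1) (c' := 1) (d' := 0) ?_ ?_ ?_ ?_ p
  · simpa using h1
  · rw [h2, zpow_neg_one, zpow_neg_one]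
    exact (mul_inv_rev _ _).trans h0.inv_inv.eq.symm
  · rw [h4, zpow_neg_one, zpow_neg_one]
    exact h0.inv_inv.eq.symm
  · simpa using h3

/-- The homomorphism given by the images of the generators. -/
def lift {G : Type*} [Group G] (X Y Z : G) (h0 : X * Y * X⁻¹ * Y⁻¹ = 1)
    (h1 : Z * X * Z⁻¹ = Y) (h2 : Z * Y * Z⁻¹ = (X * Y)⁻¹) : PiG3 →* G :=
  PresentedGroup.toGroup (f := fun g => match g with | .x => X | .y => Y | .z => Z) (by
    rintro r (rfl | rfl | rfl) <;> simp [fg, h0, h1, h2])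

end PiG3

namespace PiG2

/-- The generators of `π₁(G₂)`. -/
abbrev gen (g : Gen) : PiG2 := PresentedGroup.of g

lemma rel_xy : gen .x * gen .y * (gen .x)⁻¹ * (gen .y)⁻¹ = 1 :=
  PresentedGroup.one_of_mem (.inl rfl)

lemma rel_zx : gen .z * gen .x * (gen .z)⁻¹ * ((gen .x)⁻¹)⁻¹ = 1 :=
  PresentedGroup.one_of_mem (.inr (.inl rfl))

lemma rel_zy : gen .z * gen .y * (gen .z)⁻¹ * ((gen .y)⁻¹)⁻¹ = 1 :=
  PresentedGroup.one_of_mem (.inr (.inr rfl))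

lemma normal_form (p : PiG2) :
    ∃ i j m : ℤ, p = gen .x ^ i * gen .y ^ j * gen .z ^ m := by
  have h0 : Commute (gen .x) (gen .y) := by
    have := rel_xy
    rwa [mul_inv_eq_one, mul_inv_eq_iff_eq_mul] at this
  have h1 := mul_inv_eq_one.1 rel_zx
  have h2 := mul_inv_eq_one.1 rel_zy
  have inv : ∀ w : PiG2, gen .z * w * (gen .z)⁻¹ = w⁻¹ → (gen .z)⁻¹ * w * gen .z = w⁻¹ := by
    intro w hw
    have h : (gen .z)⁻¹ * w⁻¹ * gen .z = w := by
      rw [← hw]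
      group
    calc (gen .z)⁻¹ * w * gen .z = ((gen .z)⁻¹ * w⁻¹ * gen .z)⁻¹ := by group
      _ = w⁻¹ := by rw [h]
  refine exists_normal_form (closure_gens _) h0 (a := -1) (b := 0) (c := 0) (d := -1)
    (a' := -1) (b' := 0) (c' := 0) (d' := -1) ?_ ?_ ?_ ?_ p
  · simpa using h1
  · simpa using h2
  · simpa using inv _ h1
  · simpa using inv _ h2

/-- The homomorphism given by the images of the generators. -/
def lift {G : Type*} [Group G] (X Y Z : G) (h0 : X * Y * X⁻¹ * Y⁻¹ = 1)
    (h1 : Z * X * Z⁻¹ = X⁻¹) (h2 : Z * Y * Z⁻¹ = Y⁻¹) : PiG2 →* G :=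
  PresentedGroup.toGroup (f := fun g => match g with | .x => X | .y => Y | .z => Z) (by
    rintro r (rfl | rfl | rfl) <;> simp [fg, h0, h1, h2])

end PiG2

end Presentations

section Distinction

/-- `H` maps onto `(ℤ/m)²`. -/
def MapsOntoSq (m : ℕ) (H : Type) [Group H] : Prop :=
  ∃ f : H →* Multiplicative (ZMod m × ZMod m), Function.Surjective f

lemma MapsOntoSq.congr {m : ℕ} {H K : Type} [Group H] [Group K] (e : H ≃* K)
    (h : MapsOntoSq m H) : MapsOntoSq m K := by
  obtain ⟨f, hf⟩ := h
  exact ⟨f.comp e.symm.toMonoidHom, hf.comp e.symm.surjective⟩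

lemma mapsOntoSq_of_mem {m : ℕ} {H : Type} [Group H]
    (f : H →* Multiplicative (ZMod m × ZMod m)) (s t : H) (hs : f s = .ofAdd (1, 0))
    (ht : f t = .ofAdd (0, 1)) : MapsOntoSq m H := by
  refine ⟨f, fun v => ?_⟩
  obtain ⟨i, hi⟩ := ZMod.intCast_surjective v.toAdd.1
  obtain ⟨j, hj⟩ := ZMod.intCast_surjective v.toAdd.2
  refine ⟨s ^ i * t ^ j, ?_⟩
  rw [map_mul, map_zpow, map_zpow, hs, ht]
  apply Multiplicative.toAdd.injective
  ext
  · simpa using hi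
  · simpa using hj

lemma not_surjective_zpowers {m : ℕ} (hm : 1 < m) (c : ZMod m × ZMod m) :
    ¬ ∀ v, ∃ j : ℤ, j • c = v := by
  intro h
  have : Fact (1 < m) := ⟨hm⟩
  obtain ⟨i, hi⟩ := h (1, 0)
  obtain ⟨j, hj⟩ := h (0, 1)
  -- Computed in two ways this is `(j, 0) = (0, i)`. So `i = 0` in `ℤ/m`, although `i` times the
  -- first coordinate of `c` is `1`.
  have e : j • i • c = i • j • c := smul_comm _ _ _
  rw [hi, hj] at e
  have e2 : (0 : ZMod m) = i := by simpa using congrArg Prod.snd e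
  have e3 : (i : ZMod m) * c.1 = 1 := by simpa using congrArg Prod.fst hi
  rw [← e2, zero_mul] at e3
  exact zero_ne_one e3

/-- If `x` and `y` die, the image is generated by `f z`, but `(ℤ/m)²` is not cyclic. -/
lemma not_mapsOntoSq {m : ℕ} (hm : 1 < m) {H : Type} [Group H] {x y z : H}
    (hnf : ∀ p : H, ∃ i j m : ℤ, p = x ^ i * y ^ j * z ^ m)
    (h : ∀ f : H →* Multiplicative (ZMod m × ZMod m), f x = 1 ∧ f y = 1) : ¬ MapsOntoSq m H := by
  rintro ⟨f, hf⟩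
  refine not_surjective_zpowers hm (f z).toAdd fun v => ?_
  obtain ⟨p, hp⟩ := hf (.ofAdd v)
  obtain ⟨i, j, l, rfl⟩ := hnf p
  refine ⟨l, ?_⟩
  rw [map_mul, map_mul, map_zpow, map_zpow, map_zpow, (h f).1, (h f).2] at hp
  simpa using congrArg Multiplicative.toAdd hp

lemma mapsOntoSq_piG1 (m : ℕ) : MapsOntoSq m PiG1 := by
  let f : (Fin 3 → ℤ) →+ ZMod m × ZMod m :=
    { toFun v := (v 0, v 1)
      map_zero' := by simp
      map_add' v w := by simp }
  refine mapsOntoSq_of_mem f.toMultiplicative (.ofAdd ![1, 0, 0]) (.ofAdd ![0, 1, 0]) ?_ ?_ <;>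
  · apply Multiplicative.toAdd.injective
    simp [f]

lemma mapsOntoSq_two_piG2 : MapsOntoSq 2 PiG2 := by
  refine mapsOntoSq_of_mem (PiG2.lift (.ofAdd (1, 0)) (.ofAdd (0, 1)) 1 (by simp) ?_ ?_)
    (PiG2.gen .x) (PiG2.gen .y) (PresentedGroup.toGroup.of _) (PresentedGroup.toGroup.of _)
  all_goals decide

/-- With `x` and `y` both sent to `(1, 0)`, the last relation becomes `3 · (1, 0) = 0`. -/
lemma mapsOntoSq_three_piG3 : MapsOntoSq 3 PiG3 := by
  refine mapsOntoSq_of_mem (PiG3.lift (.ofAdd (1, 0)) (.ofAdd (1, 0)) (.ofAdd (0, 1))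
    (by simp) ?_ ?_)
    (PiG3.gen .x) (PiG3.gen .z) (PresentedGroup.toGroup.of _) (PresentedGroup.toGroup.of _)
  all_goals decide

/-- In an abelian target the relations read `x = xy` and `y = x⁻¹`, which kill `y` and then `x`. -/
lemma not_mapsOntoSq_piG5 {m : ℕ} (hm : 1 < m) : ¬ MapsOntoSq m PiG5 := by
  refine not_mapsOntoSq hm PiG5.normal_form fun f => ?_
  have h1 := congrArg f (mul_inv_eq_one.1 PiG5.rel_zx)
  have h2 := congrArg f (mul_inv_eq_one.1 PiG5.rel_zy)
  simp only [map_mul, map_inv, mul_inv_cancel_comm] at h1 h2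
  have hy : f (PiG5.gen .y) = 1 := by simpa using h1
  rw [hy] at h2
  exact ⟨by simpa using h2, hy⟩

lemma not_mapsOntoSq_two_piG3 : ¬ MapsOntoSq 2 PiG3 := by
  refine not_mapsOntoSq one_lt_two PiG3.normal_form fun f => ?_
  have h1 := congrArg f (mul_inv_eq_one.1 PiG3.rel_zx)
  have h2 := congrArg f (mul_inv_eq_one.1 PiG3.rel_zy)
  simp only [map_mul, map_inv, mul_inv_cancel_comm] at h1 h2
  rw [h1] at h2 ⊢
  revert h2
  generalize f (PiG3.gen .y) = v
  revert v
  decide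

lemma not_mapsOntoSq_three_piG2 : ¬ MapsOntoSq 3 PiG2 := by
  refine not_mapsOntoSq (by norm_num) PiG2.normal_form fun f => ?_
  have h1 := congrArg f (mul_inv_eq_one.1 PiG2.rel_zx)
  have h2 := congrArg f (mul_inv_eq_one.1 PiG2.rel_zy)
  simp only [map_mul, map_inv, mul_inv_cancel_comm] at h1 h2
  have : ∀ v : Multiplicative (ZMod 3 × ZMod 3), v = v⁻¹ → v = 1 := by decide
  exact ⟨this _ h1, this _ h2⟩

end Distinction

section IsoType

/-- `u`, `v` is a basis of `Λ`. -/
structure IsBasisPair {A : Type} [AddCommGroup A] (Λ : AddSubgroup A) (u v : A) : Prop where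
  left_mem : u ∈ Λ
  right_mem : v ∈ Λ
  span : ∀ w ∈ Λ, ∃ i j : ℤ, i • u + j • v = w
  indep : ∀ i j : ℤ, i • u + j • v = 0 → i = 0 ∧ j = 0

lemma exists_isBasisPair {A : Type} [AddCommGroup A] {Λ : AddSubgroup A} (e : Λ ≃+ (Fin 2 → ℤ)) :
    ∃ u v, IsBasisPair Λ u v := by
  have key : ∀ i j : ℤ, i • e.symm ![1, 0] + j • e.symm ![0, 1] = e.symm ![i, j] := by
    intro i j
    rw [← map_zsmul, ← map_zsmul, ← map_add]
    simp
  refine ⟨e.symm ![1, 0], e.symm ![0, 1], Subtype.prop _, Subtype.prop _, fun w hw => ?_,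
    fun i j h => ?_⟩
  · refine ⟨e ⟨w, hw⟩ 0, e ⟨w, hw⟩ 1, ?_⟩
    have := congrArg Subtype.val (key (e ⟨w, hw⟩ 0) (e ⟨w, hw⟩ 1))
    push_cast at this
    rw [this, show ![e ⟨w, hw⟩ 0, e ⟨w, hw⟩ 1] = e ⟨w, hw⟩ by ext i; fin_cases i <;> rfl,
      e.symm_apply_apply]
  · have h' : e.symm ![i, j] = 0 := by
      rw [← key]
      ext
      push_cast
      exact h
    rw [AddEquiv.map_eq_zero_iff] at h'
    exact ⟨by simpa using congrFun h' 0, by simpa using congrFun h' 1⟩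

/-- Since `t = ±1`, the elements `1` and `s + tω` form a basis of the ring. Multiplication by `α`
carries it to a basis of the ideal. -/
lemma isBasisPair_gen {α : Eisenstein} (hα : α ≠ 0) (s t : ℤ) (ht : t * t = 1) :
    IsBasisPair (gen α) α (α * ⟨s, t⟩) where
  left_mem := self_mem_gen α
  right_mem := ⟨_, rfl⟩
  span := by
    rintro _ ⟨w, rfl⟩
    refine ⟨w.re - w.im * t * s, w.im * t, ?_⟩
    have : w = (w.re - w.im * t * s : ℤ) + (w.im * t : ℤ) * (⟨s, t⟩ : Eisenstein) := by
      ext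
      · simp
      · simp [mul_assoc, ht]
    conv_rhs => rw [AddMonoidHom.coe_mulLeft, this]
    simp only [zsmul_eq_mul]
    ring
  indep i j h := by
    have h' : α * ((i : ℤ) + (j : ℤ) * (⟨s, t⟩ : Eisenstein)) = 0 := by
      rw [← h]
      simp only [zsmul_eq_mul]
      ring
    have h' := (mul_eq_zero.1 h').resolve_left hα
    have e2 : j * t = 0 := by simpa using congrArg QuadraticAlgebra.im h'
    have e1 : i + j * s = 0 := by simpa using congrArg QuadraticAlgebra.re h'
    have hj : j = 0 := by
      rcases mul_eq_zero.1 e2 with h | h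
      · exact h
      · simp [h] at ht
    subst hj
    exact ⟨by simpa using e1, rfl⟩

variable {A C : Type} [AddCommGroup A] [Group C] [DistribMulAction C A] {φ : C}

lemma zpow_mul_zpow_mul_zpow (u v a : A) (k i j m : ℤ) :
    (⟨u, 0⟩ : CyclicExt A φ) ^ i * ⟨v, 0⟩ ^ j * ⟨a, k⟩ ^ m = ⟨i • u + j • v, 0⟩ * ⟨a, k⟩ ^ m := by
  rw [mk_zero_zpow, mk_zero_zpow]
  congr 1
  ext <;> simp

/-- `D` consists of the products `(i u + j v, 0)(a, k)ᵐ`, with `i`, `j`, `m` unique because `u`, `v`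
are independent and `k > 0`. Normal forms in `P` thus map bijectively onto `D`. -/
lemma nonempty_mulEquiv_of_lift {D : Subgroup (CyclicExt A φ)} {k : ℕ} (hk : IsStep D k)
    (h0 : 0 < k) {a : A} (ha : (⟨a, k⟩ : CyclicExt A φ) ∈ D) {u v : A}
    (huv : IsBasisPair (lat D) u v) {P : Type} [Group P] {x y z : P} (f : P →* CyclicExt A φ)
    (hnf : ∀ p : P, ∃ i j m : ℤ, p = x ^ i * y ^ j * z ^ m)
    (hx : f x = ⟨u, 0⟩) (hy : f y = ⟨v, 0⟩) (hz : f z = ⟨a, k⟩) : Nonempty (D ≃* P) := by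
  have hf : Function.Injective f := by
    refine injective_of_normal_form f hnf fun i j m h => ?_
    rw [hx, hy, hz, zpow_mul_zpow_mul_zpow] at h
    have e := congrArg CyclicExt.k h
    have hm : m = 0 := by simpa [h0.ne'] using e
    subst hm
    have e := congrArg CyclicExt.v h
    have := huv.indep i j (by simpa using e)
    exact ⟨this.1, this.2, rfl⟩
  have hr : f.range = D := by
    ext g
    constructor
    · rintro ⟨p, rfl⟩
      obtain ⟨i, j, m, rfl⟩ := hnf p
      rw [map_mul, map_mul, map_zpow, map_zpow, map_zpow, hx, hy, hz]
      exact D.mul_mem (D.mul_mem (D.zpow_mem huv.left_mem _) (D.zpow_mem huv.right_mem _))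
        (D.zpow_mem ha _)
    · intro hg
      rw [hk.eq_ofData ha] at hg
      obtain ⟨w, hw, m, rfl⟩ := hg
      obtain ⟨i, j, rfl⟩ := huv.span w hw
      refine ⟨x ^ i * y ^ j * z ^ m, ?_⟩
      rw [map_mul, map_mul, map_zpow, map_zpow, map_zpow, hx, hy, hz, zpow_mul_zpow_mul_zpow]
  exact ⟨((MonoidHom.ofInjective hf).trans (MulEquiv.subgroupCongr hr)).symm⟩

lemma mk_zero_comm (u v : A) :
    (⟨u, 0⟩ : CyclicExt A φ) * ⟨v, 0⟩ * ⟨u, 0⟩⁻¹ * ⟨v, 0⟩⁻¹ = 1 := by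
  ext <;> simp

lemma mk_conj_zero (a u : A) (k : ℕ) :
    (⟨a, k⟩ : CyclicExt A φ) * ⟨u, 0⟩ * ⟨a, k⟩⁻¹ = ⟨φ ^ k • u, 0⟩ := by
  ext <;> simp

lemma mk_zero_mul_mk_zero (u v : A) :
    (⟨u, 0⟩ : CyclicExt A φ) * ⟨v, 0⟩ = ⟨u + v, 0⟩ := by
  ext <;> simp

lemma mk_zero_inv (u : A) : (⟨u, 0⟩ : CyclicExt A φ)⁻¹ = ⟨-u, 0⟩ := by
  ext <;> simp

variable {D : Subgroup (CyclicExt Eisenstein zeta)} {k : ℕ}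

lemma zeta_pow_mod (k : ℕ) : zeta ^ k = zeta ^ (k % 6) := by
  rw [← orderOf_zeta, pow_mod_orderOf]

lemma zeta_gcd_smul_lat (hk : IsStep D k) : zeta ^ (k.gcd 6) • lat D = lat D := by
  have h := (zpow_smul_gcd zeta (k : ℤ) (6 : ℕ) (lat D)).2 ⟨by
    rw [zpow_natCast]; exact hk.smul_lat, by rw [zpow_natCast, zeta_pow_six, one_smul]⟩
  rwa [Int.gcd_natCast_natCast, zpow_natCast] at h

lemma lat_index_ne_zero (hD : D.index ≠ 0) (hk : IsStep D k) : (lat D).index ≠ 0 := by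
  rw [hk.index_eq (hk.pos hD)] at hD
  exact right_ne_zero_of_mul hD

lemma nonempty_mulEquiv_piG5 (hD : D.index ≠ 0) (hk : IsStep D k) (h6 : k.gcd 6 = 1) :
    Nonempty (D ≃* PiG5) := by
  have hst := zeta_gcd_smul_lat hk
  rw [h6] at hst
  obtain ⟨α, hα, hlat⟩ := exists_eq_gen (om_mul_mem_of_smul_eq (.inl rfl) hst)
    (lat_index_ne_zero hD hk)
  obtain ⟨a, ha⟩ := hk.2
  -- Here `k ≡ ±1` mod 6, so `μ = ζ ^ k` is a primitive sixth root of unity. With `x = α` and `y = α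
  -- (μ - 1)` the relations become `μ = 1 + (μ - 1)` and `μ (μ - 1) = -1`.
  have hmu : ∃ s t : ℤ, t * t = 1 ∧ ((zeta ^ k).val = 1 + ⟨s, t⟩) ∧
      (1 + ⟨s, t⟩) * ⟨s, t⟩ = (-1 : Eisenstein) := by
    have : k % 6 = 1 ∨ k % 6 = 5 := by
      have h2 : ¬ 2 ∣ k := fun h => by
        have := Nat.dvd_gcd h (show 2 ∣ 6 by norm_num)
        omega
      have h3 : ¬ 3 ∣ k := fun h => by
        have := Nat.dvd_gcd h (show 3 ∣ 6 by norm_num)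
        omega
      omega
    rw [zeta_pow_mod]
    rcases this with h | h <;> rw [h]
    · refine ⟨0, 1, rfl, ?_, ?_⟩
      · rw [pow_one, val_zeta]
        ext <;> simp
      · ext <;> simp
    · refine ⟨-1, -1, rfl, ?_, ?_⟩
      · rw [show 5 = 3 + 2 from rfl, pow_add, map_mul, val_zeta_pow_two, val_zeta_pow_three]
        ext <;> simp
      · ext <;> simp
  obtain ⟨s, t, ht, hμ, hμ2⟩ := hmu
  refine nonempty_mulEquiv_of_lift hk (hk.pos hD) ha (hlat ▸ isBasisPair_gen hα s t ht)
    (PiG5.lift ⟨α, 0⟩ ⟨α * ⟨s, t⟩, 0⟩ ⟨a, k⟩ (mk_zero_comm _ _) ?_ ?_) PiG5.normal_form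
    (PresentedGroup.toGroup.of _) (PresentedGroup.toGroup.of _) (PresentedGroup.toGroup.of _)
  · rw [mk_conj_zero, mk_zero_mul_mk_zero, UnitGroup.smul_def, hμ]
    congr 1
    ring
  · rw [mk_conj_zero, mk_zero_inv, UnitGroup.smul_def, hμ]
    congr 1
    linear_combination α * hμ2

lemma nonempty_mulEquiv_piG3 (hD : D.index ≠ 0) (hk : IsStep D k) (h6 : k.gcd 6 = 2) :
    Nonempty (D ≃* PiG3) := by
  have hst := zeta_gcd_smul_lat hk
  rw [h6] at hst
  obtain ⟨α, hα, hlat⟩ := exists_eq_gen (om_mul_mem_of_smul_eq (.inr rfl) hst)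
    (lat_index_ne_zero hD hk)
  obtain ⟨a, ha⟩ := hk.2
  -- Now `k ≡ ±2` mod 6, so `μ = ζ ^ k` is a primitive third root of unity. With `x = α` and `y = α
  -- μ` the last relation is `μ² = -(1 + μ)`.
  have hmu : ∃ s t : ℤ, t * t = 1 ∧ ((zeta ^ k).val = ⟨s, t⟩) ∧
      (⟨s, t⟩ : Eisenstein) * ⟨s, t⟩ = -(1 + ⟨s, t⟩) := by
    have : k % 6 = 2 ∨ k % 6 = 4 := by
      have h2 : 2 ∣ k := h6 ▸ Nat.gcd_dvd_left k 6
      have h3 : ¬ 3 ∣ k := fun h => by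
        have := Nat.dvd_gcd h (show 3 ∣ 6 by norm_num)
        omega
      omega
    rw [zeta_pow_mod]
    rcases this with h | h <;> rw [h]
    · refine ⟨0, 1, rfl, val_zeta_pow_two, ?_⟩
      ext <;> simp
    · refine ⟨-1, -1, rfl, ?_, ?_⟩
      · rw [show 4 = 2 + 2 from rfl, pow_add, map_mul, val_zeta_pow_two]
        ext <;> simp
      · ext <;> simp
  obtain ⟨s, t, ht, hμ, hμ2⟩ := hmu
  refine nonempty_mulEquiv_of_lift hk (hk.pos hD) ha (hlat ▸ isBasisPair_gen hα s t ht)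
    (PiG3.lift ⟨α, 0⟩ ⟨α * ⟨s, t⟩, 0⟩ ⟨a, k⟩ (mk_zero_comm _ _) ?_ ?_) PiG3.normal_form
    (PresentedGroup.toGroup.of _) (PresentedGroup.toGroup.of _) (PresentedGroup.toGroup.of _)
  · rw [mk_conj_zero, UnitGroup.smul_def, hμ, mul_comm]
  · rw [mk_conj_zero, mk_zero_mul_mk_zero, mk_zero_inv, UnitGroup.smul_def, hμ]
    congr 1
    linear_combination α * hμ2

lemma exists_isBasisPair_lat (hD : D.index ≠ 0) (hk : IsStep D k) :
    ∃ u v, IsBasisPair (lat D) u v := by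
  obtain ⟨e⟩ := exists_addEquiv_of_index_ne_zero coords (lat_index_ne_zero hD hk)
  exact exists_isBasisPair e

lemma nonempty_mulEquiv_piG2 (hD : D.index ≠ 0) (hk : IsStep D k) (h6 : k.gcd 6 = 3) :
    Nonempty (D ≃* PiG2) := by
  obtain ⟨u, v, huv⟩ := exists_isBasisPair_lat hD hk
  obtain ⟨a, ha⟩ := hk.2
  have hmu : (zeta ^ k).val = -1 := by
    have : k % 6 = 3 := by
      have h3 : 3 ∣ k := h6 ▸ Nat.gcd_dvd_left k 6
      have h2 : ¬ 2 ∣ k := fun h => by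
        have := Nat.dvd_gcd h (show 2 ∣ 6 by norm_num)
        omega
      omega
    rw [zeta_pow_mod, this, val_zeta_pow_three]
  refine nonempty_mulEquiv_of_lift hk (hk.pos hD) ha huv
    (PiG2.lift ⟨u, 0⟩ ⟨v, 0⟩ ⟨a, k⟩ (mk_zero_comm _ _) ?_ ?_) PiG2.normal_form
    (PresentedGroup.toGroup.of _) (PresentedGroup.toGroup.of _) (PresentedGroup.toGroup.of _) <;>
  · rw [mk_conj_zero, mk_zero_inv, UnitGroup.smul_def, hmu, neg_one_mul]

lemma nonempty_mulEquiv_piG1 (hD : D.index ≠ 0) (hk : IsStep D k) (h6 : k.gcd 6 = 6) :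
    Nonempty (D ≃* PiG1) := by
  obtain ⟨u, v, huv⟩ := exists_isBasisPair_lat hD hk
  obtain ⟨a, ha⟩ := hk.2
  have hmu : zeta ^ k = 1 := by
    obtain ⟨m, rfl⟩ : 6 ∣ k := h6 ▸ Nat.gcd_dvd_left k 6
    rw [pow_mul, zeta_pow_six, one_pow]
  have hc : ∀ w : Eisenstein, Commute (⟨w, 0⟩ : CyclicExt Eisenstein zeta) ⟨a, k⟩ := by
    refine fun w => CyclicExt.ext ?_ ?_
    · simp [hmu, add_comm]
    · simp
  let f : PiG1 →* CyclicExt Eisenstein zeta :=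
    { toFun w := ⟨w.toAdd 0 • u + w.toAdd 1 • v, 0⟩ * ⟨a, k⟩ ^ (w.toAdd 2)
      map_one' := by
        ext <;> simp
      map_mul' w w' := by
        rw [(((hc _).zpow_right _).symm).mul_mul_mul_comm, mk_zero_mul_mk_zero, ← zpow_add]
        congr 2
        simp [add_smul]
        abel }
  refine nonempty_mulEquiv_of_lift hk (hk.pos hD) ha huv f
    (x := .ofAdd ![1, 0, 0]) (y := .ofAdd ![0, 1, 0]) (z := .ofAdd ![0, 0, 1]) ?_ ?_ ?_ ?_
  · intro p
    refine ⟨p.toAdd 0, p.toAdd 1, p.toAdd 2, ?_⟩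
    apply Multiplicative.toAdd.injective
    ext i
    fin_cases i <;> simp
  all_goals
    ext <;> simp [f]

lemma gcd_six_cases (k : ℕ) : k.gcd 6 = 1 ∨ k.gcd 6 = 2 ∨ k.gcd 6 = 3 ∨ k.gcd 6 = 6 := by
  have h := Nat.gcd_dvd_right k 6
  have h1 := Nat.le_of_dvd (by norm_num) h
  interval_cases hk : k.gcd 6 <;> revert h <;> decide

/-- Surjectivity onto `(ℤ/2)²` and `(ℤ/3)²` is no/no for `PiG5`, no/yes for `PiG3`, yes/no for
`PiG2` and yes/yes for `PiG1`. The four types are thus pairwise distinct, and the type recovers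
`gcd(k, 6)`. -/
theorem nonempty_mulEquiv_iff (hD : D.index ≠ 0) (hk : IsStep D k) :
    (Nonempty (D ≃* PiG5) ↔ k.gcd 6 = 1) ∧ (Nonempty (D ≃* PiG3) ↔ k.gcd 6 = 2) ∧
    (Nonempty (D ≃* PiG2) ↔ k.gcd 6 = 3) ∧ (Nonempty (D ≃* PiG1) ↔ k.gcd 6 = 6) := by
  have n5 := fun m (hm : 1 < m) => not_mapsOntoSq_piG5 hm
  have n5_2 := not_mapsOntoSq_piG5 (m := 2) (by norm_num)
  have n5_3 := not_mapsOntoSq_piG5 (m := 3) (by norm_num)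
  have n3_2 := not_mapsOntoSq_two_piG3
  have y3_3 := mapsOntoSq_three_piG3
  have n2_3 := not_mapsOntoSq_three_piG2
  have y2_2 := mapsOntoSq_two_piG2
  have y1_2 := mapsOntoSq_piG1 2
  have y1_3 := mapsOntoSq_piG1 3
  have key : ∀ {H : Type} [Group H], Nonempty (D ≃* H) →
      ∀ m, (MapsOntoSq m D ↔ MapsOntoSq m H) := by
    rintro H _ ⟨e⟩ m
    exact ⟨fun h => h.congr e, fun h => h.congr e.symm⟩
  have i5 := fun h => nonempty_mulEquiv_piG5 hD hk h
  have i3 := fun h => nonempty_mulEquiv_piG3 hD hk h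
  have i2 := fun h => nonempty_mulEquiv_piG2 hD hk h
  have i1 := fun h => nonempty_mulEquiv_piG1 hD hk h
  have k5 := key (H := PiG5)
  have k3 := key (H := PiG3)
  have k2 := key (H := PiG2)
  have k1 := key (H := PiG1)
  have c : (k.gcd 6 = 1 ↔ ¬ MapsOntoSq 2 D ∧ ¬ MapsOntoSq 3 D) ∧
      (k.gcd 6 = 2 ↔ ¬ MapsOntoSq 2 D ∧ MapsOntoSq 3 D) ∧
      (k.gcd 6 = 3 ↔ MapsOntoSq 2 D ∧ ¬ MapsOntoSq 3 D) ∧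
      (k.gcd 6 = 6 ↔ MapsOntoSq 2 D ∧ MapsOntoSq 3 D) := by
    rcases gcd_six_cases k with h | h | h | h
    · have e2 := k5 (i5 h) 2; have e3 := k5 (i5 h) 3
      simp [h, e2, e3, n5_2, n5_3]
    · have e2 := k3 (i3 h) 2; have e3 := k3 (i3 h) 3
      simp [h, e2, e3, n3_2, y3_3]
    · have e2 := k2 (i2 h) 2; have e3 := k2 (i2 h) 3
      simp [h, e2, e3, y2_2, n2_3]
    · have e2 := k1 (i1 h) 2; have e3 := k1 (i1 h) 3
      simp [h, e2, e3, y1_2, y1_3]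
  refine ⟨⟨fun h => c.1.2 ?_, i5⟩, ⟨fun h => c.2.1.2 ?_, i3⟩, ⟨fun h => c.2.2.1.2 ?_, i2⟩,
    ⟨fun h => c.2.2.2.2 ?_, i1⟩⟩
  · rw [k5 h, k5 h]; exact ⟨n5_2, n5_3⟩
  · rw [k3 h, k3 h]; exact ⟨n3_2, y3_3⟩
  · rw [k2 h, k2 h]; exact ⟨y2_2, n2_3⟩
  · rw [k1 h, k1 h]; exact ⟨y1_2, y1_3⟩

end IsoType
end Platycosm

/-! ### Galois correspondence for quotients of a simply connected covering. -/

namespace Platycosm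

section CoveringTheory

open Topology MulAction

/-- Two quotient maps with the same fibers have homeomorphic targets. -/
lemma exists_homeomorph_of_isQuotientMap {E N N' : Type*} [TopologicalSpace E]
    [TopologicalSpace N] [TopologicalSpace N'] {r : E → N} {r' : E → N'}
    (hr : IsQuotientMap r) (hr' : IsQuotientMap r') (h : ∀ a b, r a = r b ↔ r' a = r' b) :
    ∃ φ : N ≃ₜ N', ∀ e, φ (r e) = r' e := by
  have h1 : ∀ e, r' (Function.surjInv hr.surjective (r e)) = r' e := fun e =>
    (h _ _).1 (Function.surjInv_eq hr.surjective (r e))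
  have h2 : ∀ e, r (Function.surjInv hr'.surjective (r' e)) = r e := fun e =>
    (h _ _).2 (Function.surjInv_eq hr'.surjective (r' e))
  refine ⟨{ toFun := fun y => r' (Function.surjInv hr.surjective y)
            invFun := fun y => r (Function.surjInv hr'.surjective y)
            left_inv := ?_, right_inv := ?_, continuous_toFun := ?_, continuous_invFun := ?_ }, h1⟩
  · intro y
    obtain ⟨e, rfl⟩ := hr.surjective y
    simp only [h1, h2]
  · intro y
    obtain ⟨e, rfl⟩ := hr'.surjective y
    simp only [h1, h2]
  · rw [hr.continuous_iff]
    exact hr'.continuous.congr fun e => (h1 e).symm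
  · rw [hr'.continuous_iff]
    exact hr.continuous.congr fun e => (h2 e).symm

variable {E X Γ : Type*} [TopologicalSpace E] [TopologicalSpace X] [Group Γ] [MulAction Γ E]
  {q : E → X} (hq : IsQuotientCoveringMap q Γ)
include hq

lemma isQuotientCoveringMap_mk_subgroup (D : Subgroup Γ) :
    IsQuotientCoveringMap (Quotient.mk (orbitRel D E)) D where
  __ := isQuotientMap_quotient_mk'
  continuous_const_smul d := hq.continuous_const_smul (d : Γ)
  apply_eq_iff_mem_orbit := Quotient.eq''
  disjoint e := by
    obtain ⟨U, hU, h⟩ := hq.disjoint e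
    exact ⟨U, hU, fun d hd => Subtype.ext (h d hd)⟩

variable {N : Type*} [TopologicalSpace N] {D : Subgroup Γ} {r : E → N}
  (hr : IsQuotientCoveringMap r D) {p : N → X} (hp : ∀ e, p (r e) = q e)

omit hq in
include hr in
lemma apply_eq_iff_exists_mem {e₁ e₂ : E} : r e₁ = r e₂ ↔ ∃ d ∈ D, d • e₂ = e₁ := by
  rw [hr.apply_eq_iff_mem_orbit]
  constructor
  · rintro ⟨d, rfl⟩
    exact ⟨d, d.2, rfl⟩
  · rintro ⟨d, hd, rfl⟩
    exact ⟨⟨d, hd⟩, rfl⟩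

include hr in
lemma apply_smul_eq_iff_mem {g : Γ} {e : E} : r (g • e) = r e ↔ g ∈ D := by
  rw [apply_eq_iff_exists_mem hr]
  constructor
  · rintro ⟨d, hd, h⟩
    have := hq.isCancelSMul
    rwa [← IsCancelSMul.right_cancel _ _ _ h]
  · exact fun h => ⟨g, h, rfl⟩

include hr hp

/-- An intermediate space of a quotient covering is a covering space of the base. -/
lemma isCoveringMap_of_comp_eq : IsCoveringMap p := by
  have hqo := hq.isOpenQuotientMap.isOpenMap
  have hro := hr.isOpenQuotientMap.isOpenMap
  have hpc : Continuous p := hr.continuous_iff.2 (hq.continuous.congr fun e => (hp e).symm)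
  have hpo : IsOpenMap p := fun W hW => by
    have : p '' W = q '' (r ⁻¹' W) := by
      ext x
      constructor
      · rintro ⟨y, hy, rfl⟩
        obtain ⟨e, rfl⟩ := hr.surjective y
        exact ⟨e, hy, (hp e).symm⟩
      · rintro ⟨e, he, rfl⟩
        exact ⟨r e, he, hp e⟩
    rw [this]
    exact hqo _ (hW.preimage hr.continuous)
  intro x
  obtain ⟨e, rfl⟩ := hq.surjective x
  obtain ⟨U', hU', hdisj'⟩ := hq.disjoint e
  obtain ⟨U, hUU', hUo, heU⟩ := mem_nhds_iff.1 hU'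
  have hdisj : ∀ u ∈ U, ∀ u' ∈ U, ∀ g : Γ, g • u' = u → g = 1 := fun u hu u' hu' g h =>
    hdisj' g ⟨u, ⟨u', hUU' hu', h⟩, hUU' hu⟩
  let _ : TopologicalSpace (Γ ⧸ D) := ⊥
  have : DiscreteTopology (Γ ⧸ D) := ⟨rfl⟩
  have : Nonempty (X → N) := ⟨fun x => r (Function.surjInv hq.surjective x)⟩
  -- Over `q(U)` the sheets of `p` are the sets `r(g⁻¹ U)`, one for each left coset `gD`. Inversion
  -- turns left cosets into the `D`-orbits that `r` collapses.
  let S : Γ ⧸ D → Set N := fun c => {y | ∃ g : Γ, (g : Γ ⧸ D) = c ∧ ∃ u ∈ U, r (g⁻¹ • u) = y}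
  have hS : ∀ g : Γ, S g = r '' ((fun x => g⁻¹ • x) '' U) := by
    intro g
    ext y
    constructor
    · rintro ⟨h, hh, u, hu, rfl⟩
      refine ⟨_, ⟨u, hu, rfl⟩, ?_⟩
      rw [apply_eq_iff_exists_mem hr]
      exact ⟨_, QuotientGroup.eq.1 hh.symm, by rw [smul_smul]; simp⟩
    · rintro ⟨_, ⟨u, hu, rfl⟩, rfl⟩
      exact ⟨g, rfl, u, hu, rfl⟩
  have hsurj : ∀ c, (S c).SurjOn p (q '' U) := by
    rintro ⟨g⟩ _ ⟨u, hu, rfl⟩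
    exact ⟨r (g⁻¹ • u), ⟨g, rfl, u, hu, rfl⟩, by rw [hp, hq.map_smul]⟩
  have hopen : ∀ c, IsOpen (S c) := by
    rintro ⟨g⟩
    refine (hS g).symm ▸ hro _ ?_
    have := hq.toContinuousConstSMul
    exact isOpenMap_smul (g⁻¹) _ hUo
  refine (IsEvenlyCovered.of_trivialization (t := IsOpen.trivializationDiscrete (f := p) S (q '' U)
    (hqo _ hUo) (fun c W hW => ⟨fun h => (h.preimage hpc).inter (hopen c), fun h => ?_⟩)
    ?_ hsurj ?_ ?_) (Set.mem_image_of_mem q heU)).to_isEvenlyCovered_preimage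
  · convert hpo _ h using 1
    ext x
    constructor
    · intro hx
      obtain ⟨y, hy, rfl⟩ := hsurj c (hW hx)
      exact ⟨y, ⟨hx, hy⟩, rfl⟩
    · rintro ⟨y, ⟨hy, -⟩, rfl⟩
      exact hy
  · rintro _ _ ⟨g, rfl, u, hu, rfl⟩ _ ⟨h, hh, u', hu', rfl⟩ heq
    rw [hp, hp, hq.map_smul, hq.map_smul, hq.apply_eq_iff_mem_orbit] at heq
    obtain ⟨γ, hγ⟩ := heq
    obtain rfl := hdisj u hu u' hu' γ hγ
    simp only [one_smul] at hγ
    subst hγ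
    rw [apply_eq_iff_exists_mem hr]
    exact ⟨_, QuotientGroup.eq.1 hh.symm, by rw [smul_smul]; simp⟩
  · intro c c' hne
    refine Set.disjoint_left.2 ?_
    rintro _ ⟨g, rfl, u, hu, rfl⟩ ⟨h, rfl, u', hu', heq⟩
    obtain ⟨d, hd, hd'⟩ := (apply_eq_iff_exists_mem hr).1 heq
    refine hne (QuotientGroup.eq.2 ?_)
    have := hdisj u' hu' u hu (h * d * g⁻¹) (by
      rw [mul_smul, mul_smul, hd', smul_inv_smul])
    have h3 : g⁻¹ * h = d⁻¹ := by
      rw [mul_inv_eq_one] at this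
      rw [← this]
      group
    rw [h3]
    exact inv_mem hd
  · intro y hy
    obtain ⟨e', rfl⟩ := hr.surjective y
    obtain ⟨u, hu, hue⟩ := hy
    rw [hp, eq_comm, hq.apply_eq_iff_mem_orbit] at hue
    obtain ⟨g, rfl⟩ := hue
    exact Set.mem_iUnion.2 ⟨(g⁻¹ : Γ), g⁻¹, rfl, u, hu, by simp⟩

lemma card_fiber_of_comp_eq (x : X) : Nat.card (p ⁻¹' {x}) = D.index := by
  obtain ⟨e, rfl⟩ := hq.surjective x
  symm
  refine Nat.card_congr (Equiv.ofBijective (fun c : Γ ⧸ D => (⟨Quotient.liftOn c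
    (fun g => r (g⁻¹ • e)) ?_, ?_⟩ : p ⁻¹' {q e})) ⟨?_, ?_⟩)
  · intro g h hgh
    rw [apply_eq_iff_exists_mem hr]
    exact ⟨_, QuotientGroup.leftRel_apply.1 hgh, by rw [smul_smul]; simp⟩
  · obtain ⟨g⟩ := c
    change p (r (g⁻¹ • e)) = q e
    rw [hp, hq.map_smul]
  · rintro ⟨g⟩ ⟨h⟩ hgh
    obtain ⟨d, hd, hd'⟩ := (apply_eq_iff_exists_mem hr).1 (congrArg Subtype.val hgh)
    have := hq.isCancelSMul
    rw [smul_smul] at hd'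
    refine QuotientGroup.eq.2 ?_
    rw [← IsCancelSMul.right_cancel _ _ _ hd']
    simpa using hd
  · rintro ⟨y, hy⟩
    obtain ⟨e', rfl⟩ := hr.surjective y
    change p (r e') = q e at hy
    rw [hp, hq.apply_eq_iff_mem_orbit] at hy
    obtain ⟨g, rfl⟩ := hy
    refine ⟨(g⁻¹ : Γ), Subtype.ext ?_⟩
    change r ((g⁻¹)⁻¹ • e) = r (g • e)
    rw [inv_inv]

omit hq hp in
lemma nonempty_fundamentalGroup_mulEquiv [SimplyConnectedSpace E] (y : N) :
    Nonempty (FundamentalGroup N y ≃* D) := by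
  obtain ⟨e, rfl⟩ := hr.surjective y
  -- The fundamental group appears as the opposite of the deck group; inversion removes the `op`.
  exact ⟨(hr.fundamentalGroupEquiv ⟨e, rfl⟩).trans (MulEquiv.inv' D).symm⟩

/-- Isomorphic coverings correspond to conjugate subgroups. -/
lemma exists_homeomorph_iff_exists_conj [PreconnectedSpace E] [Nonempty E] {N' : Type*}
    [TopologicalSpace N'] {D' : Subgroup Γ} {r' : E → N'} (hr' : IsQuotientCoveringMap r' D')
    {p' : N' → X} (hp' : ∀ e, p' (r' e) = q e) :
    (∃ φ : N ≃ₜ N', p = p' ∘ φ) ↔ ∃ g : Γ, MulAut.conj g • D = D' := by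
  have := hq.toContinuousConstSMul
  constructor
  · rintro ⟨φ, hφ⟩
    obtain ⟨e⟩ := ‹Nonempty E›
    have hq' : ∀ e, p' (φ (r e)) = q e := fun e => by rw [← hp e, hφ]; rfl
    obtain ⟨e', he'⟩ := hr'.surjective (φ (r e))
    have h1 : q e' = q e := by rw [← hp', he', hq']
    obtain ⟨g, rfl⟩ := hq.apply_eq_iff_mem_orbit.1 h1
    -- Both maps lift `q` through `p'` and agree at `e`, so they agree on the connected space `E`.
    -- Comparing which `γ` each side ignores then yields the conjugacy.
    have key : (fun x => r' (g • x)) = fun x => φ (r x) := by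
      refine (isCoveringMap_of_comp_eq hq hr' hp').eq_of_comp_eq
        (hr'.continuous.comp (continuous_const_smul g)) (φ.continuous.comp hr.continuous) ?_ e he'
      ext x
      simp only [Function.comp_apply, hp', hq', hq.map_smul]
    have key' : ∀ x, r' (g • x) = φ (r x) := congrFun key
    refine ⟨g, ?_⟩
    ext γ
    rw [Subgroup.mem_pointwise_smul_iff_inv_smul_mem, ← apply_smul_eq_iff_mem hq hr (e := e),
      ← φ.injective.eq_iff, ← key', ← key', ← apply_smul_eq_iff_mem hq hr' (e := g • e),
      ← map_inv, MulAut.smul_def, MulAut.conj_apply, smul_smul, smul_smul]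
    simp [mul_assoc]
  · rintro ⟨g, rfl⟩
    obtain ⟨φ, hφ⟩ := exists_homeomorph_of_isQuotientMap (r' := fun x => r' (g • x))
      hr.toIsQuotientMap (hr'.toIsQuotientMap.comp (Homeomorph.smul g).isQuotientMap) (by
        intro a b
        rw [apply_eq_iff_exists_mem hr, apply_eq_iff_exists_mem hr']
        constructor
        · rintro ⟨d, hd, rfl⟩
          refine ⟨MulAut.conj g d, Subgroup.smul_mem_pointwise_smul _ _ _ hd, ?_⟩
          rw [MulAut.conj_apply, smul_smul, smul_smul]
          simp
        · rintro ⟨d, hd, h⟩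
          obtain ⟨d, hd, rfl⟩ := hd
          refine ⟨d, hd, ?_⟩
          simp only [MulDistribMulAction.toMonoidEnd_apply, MulDistribMulAction.toMonoidHom_apply,
            MulAut.smul_def, MulAut.conj_apply, smul_smul, inv_mul_cancel_right] at h
          rw [mul_smul] at h
          exact smul_left_cancel g h)
    refine ⟨φ, funext fun y => ?_⟩
    obtain ⟨e, rfl⟩ := hr.surjective y
    rw [Function.comp_apply, hφ, hp, hp', hq.map_smul]

omit hr hp in
/-- Every connected covering of the base is a quotient of the simply connected covering. -/
lemma exists_isQuotientCoveringMap_of_isCoveringMap [SimplyConnectedSpace E]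
    [LocallyPathConnectedSpace E] [ConnectedSpace N] (hp : IsCoveringMap p) {e₀ : E} {y₀ : N}
    (h₀ : p y₀ = q e₀) :
    ∃ (D : Subgroup Γ) (r : E → N), IsQuotientCoveringMap r D ∧ ∀ e, p (r e) = q e := by
  have := hq.toContinuousConstSMul
  have lift : ∀ (e : E) (y : N), p y = q e →
      ∃ r : E → N, Continuous r ∧ r e = y ∧ ∀ e, p (r e) = q e := by
    intro e y h
    obtain ⟨r, ⟨h1, h2⟩, -⟩ := hp.existsUnique_continuousMap_lifts ⟨q, hq.continuous⟩ e y h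
    exact ⟨r, r.continuous, h1, congrFun h2⟩
  have uniq : ∀ r r' : E → N, Continuous r → Continuous r' → (∀ e, p (r e) = q e) →
      (∀ e, p (r' e) = q e) → ∀ e, r e = r' e → r = r' := by
    intro r r' hr hr' h h' e he
    exact hp.eq_of_comp_eq hr hr' (funext fun e => (h e).trans (h' e).symm) e he
  have opn : ∀ r : E → N, Continuous r → (∀ e, p (r e) = q e) → IsOpenMap r := by
    intro r hr h
    have h1 : p ∘ r = q := funext h
    exact (IsLocalHomeomorph.of_comp (h1 ▸ hq.isCoveringMap.isLocalHomeomorph)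
      hp.isLocalHomeomorph hr).isOpenMap
  have tr : ∀ (r : E → N) (g : Γ), Continuous r → (∀ e, p (r e) = q e) →
      Continuous (fun e => r (g • e)) ∧ ∀ e, p (r (g • e)) = q e := fun r g hr h =>
    ⟨hr.comp (continuous_const_smul g), fun e => by rw [h, hq.map_smul]⟩
  obtain ⟨r, hr, -, hrq⟩ := lift e₀ y₀ h₀
  have hsurj : Function.Surjective r := by
    rw [← Set.range_eq_univ]
    -- The range of `r` is open. Its complement is open as well: a lift `r'` through a missed point
    -- has open range, and if that range met the range of `r`, uniqueness of lifts would make `r'` a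
    -- deck translate of `r`.
    refine IsClopen.eq_univ ⟨⟨?_⟩, (opn r hr hrq).isOpen_range⟩ ⟨r e₀, e₀, rfl⟩
    rw [isOpen_iff_forall_mem_open]
    intro y hy
    obtain ⟨e, he⟩ := hq.surjective (p y)
    obtain ⟨r', hr', hy', hrq'⟩ := lift e y he.symm
    refine ⟨Set.range r', ?_, (opn r' hr' hrq').isOpen_range, e, hy'⟩
    rintro _ ⟨e₁, rfl⟩ ⟨e₂, h2⟩
    have h3 : q e₂ = q e₁ := by rw [← hrq, ← hrq', h2]
    obtain ⟨g, rfl⟩ := hq.apply_eq_iff_mem_orbit.1 h3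
    have := uniq _ r' (tr r g hr hrq).1 hr' (tr r g hr hrq).2 hrq' e₁ h2
    exact hy ⟨g • e, by rw [← hy', ← this]⟩
  -- The deck transformations that `r` ignores. By uniqueness of lifts, `r (g • e) = r e` at a
  -- single `e` already puts `g` in `D`.
  let D : Subgroup Γ :=
    { carrier := {g | ∀ e, r (g • e) = r e}
      one_mem' := fun e => by rw [one_smul]
      mul_mem' := fun {a b} ha hb e => by rw [mul_smul, ha, hb]
      inv_mem' := fun {a} ha e => by rw [← ha, smul_inv_smul] }
  refine ⟨D, r, ⟨((opn r hr hrq).isQuotientMap hr hsurj), ⟨fun d =>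
    continuous_const_smul (d : Γ)⟩, ?_, ?_⟩, hrq⟩
  · intro e₁ e₂
    constructor
    · intro h
      have h3 : q e₁ = q e₂ := by rw [← hrq, ← hrq, h]
      obtain ⟨g, rfl⟩ := hq.apply_eq_iff_mem_orbit.1 h3
      exact ⟨⟨g, congrFun (uniq _ r (tr r g hr hrq).1 hr (tr r g hr hrq).2 hrq e₂ h)⟩, rfl⟩
    · rintro ⟨d, rfl⟩
      exact d.2 e₂
  · intro e
    obtain ⟨U, hU, h⟩ := hq.disjoint e
    exact ⟨U, hU, fun d hd => Subtype.ext (h d hd)⟩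

end CoveringTheory

section Classification

open MulAction

variable {E X Γ : Type} [TopologicalSpace E] [TopologicalSpace X] [Group Γ] [MulAction Γ E]
  [SimplyConnectedSpace E] {q : E → X} (hq : IsQuotientCoveringMap q Γ) {H : Type} [Group H] {n : ℕ}

/-- The covering that belongs to a subgroup of the deck transformation group. -/
def coveringOfSubgroup (D : SubgroupsOfType H Γ n) : Covering X H n :=
  have hr := isQuotientCoveringMap_mk_subgroup hq D.1
  let p : Quotient (orbitRel D.1 E) → X := fun y => Quotient.liftOn y q (by
    rintro a b ⟨d, rfl⟩
    exact hq.map_smul (d : Γ))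
  { N := Quotient (orbitRel D.1 E)
    conn := Quotient.instConnectedSpace
    p := p
    isCoveringMap := isCoveringMap_of_comp_eq hq hr fun _ => rfl
    card_fiber x := (card_fiber_of_comp_eq hq hr (p := p) (fun _ => rfl) x).trans D.2.1
    fundamentalGroup y := (nonempty_fundamentalGroup_mulEquiv hr y).map
      fun e => e.trans D.2.2.some }

include hq in
/-- The classification of coverings: the equivalence classes of connected `n`-fold coverings
correspond to the conjugacy classes of subgroups of index `n`. -/
theorem nonempty_subgroupClasses_equiv_coveringClasses [LocallyPathConnectedSpace E] (hn : n ≠ 0) :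
    Nonempty (SubgroupClasses H Γ n ≃ CoveringClasses X H n) := by
  have hiff : ∀ D D' : SubgroupsOfType H Γ n,
      (coveringSetoid X H n).r (coveringOfSubgroup hq D) (coveringOfSubgroup hq D') ↔
        (conjSetoid H Γ n).r D D' := fun D D' =>
    exists_homeomorph_iff_exists_conj hq (isQuotientCoveringMap_mk_subgroup hq D.1)
      (fun _ => rfl) (isQuotientCoveringMap_mk_subgroup hq D'.1) (fun _ => rfl)
  refine ⟨Equiv.ofBijective (Quotient.map (coveringOfSubgroup hq) fun D D' h => (hiff D D').2 h)
    ⟨?_, ?_⟩⟩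
  · rintro ⟨D⟩ ⟨D'⟩ h
    exact Quotient.sound ((hiff D D').1 (Quotient.exact h))
  · rintro ⟨C⟩
    obtain ⟨e₀⟩ := (inferInstance : Nonempty E)
    have hcard := C.card_fiber (q e₀)
    -- `n ≠ 0` is essential here: `Nat.card` is also `0` for infinite fibers, and a base point over
    -- `q e₀` is needed.
    obtain ⟨y₀, hy₀⟩ : Nonempty (C.p ⁻¹' {q e₀}) := by
      by_contra h
      rw [not_nonempty_iff] at h
      rw [Nat.card_of_isEmpty] at hcard
      exact hn hcard.symm
    obtain ⟨D, r, hr, hrq⟩ := exists_isQuotientCoveringMap_of_isCoveringMap hq C.isCoveringMap hy₀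
    obtain ⟨f⟩ := C.fundamentalGroup y₀
    obtain ⟨f'⟩ := nonempty_fundamentalGroup_mulEquiv hr y₀
    refine ⟨Quotient.mk _ ⟨D, ?_, ⟨f'.symm.trans f⟩⟩, Quotient.sound ?_⟩
    · rw [← card_fiber_of_comp_eq hq hr hrq (q e₀), hcard]
    · exact (exists_homeomorph_iff_exists_conj hq (isQuotientCoveringMap_mk_subgroup hq D)
        (fun _ => rfl) hr hrq).2 ⟨1, by simp⟩

end Classification

end Platycosm

/-! ### The deck group of `G5` acting on Euclidean space. -/

namespace Platycosm

section Transport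

/-- Isomorphic groups have the same conjugacy classes of subgroups. -/
lemma nonempty_subgroupClasses_equiv {H G G' : Type} [Group H] [Group G] [Group G'] (e : G ≃* G')
    (n : ℕ) : Nonempty (SubgroupClasses H G n ≃ SubgroupClasses H G' n) := by
  let f : SubgroupsOfType H G n ≃ SubgroupsOfType H G' n :=
    e.mapSubgroup.toEquiv.subtypeEquiv fun D => by
      have h1 : (D.map (e : G →* G')).index = D.index := Subgroup.index_map_equiv D e
      have h2 : Nonempty (D.map (e : G →* G') ≃* H) ↔ Nonempty (D ≃* H) :=
        ⟨fun ⟨g⟩ => ⟨(e.subgroupMap D).trans g⟩, fun ⟨g⟩ => ⟨(e.subgroupMap D).symm.trans g⟩⟩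
      exact and_congr (by rw [← h1]; rfl) h2.symm
  refine ⟨Quotient.congr f fun D D' => ?_⟩
  have key : ∀ g, (MulAut.conj g • D.1).map (e : G →* G') =
      MulAut.conj (e g) • D.1.map (e : G →* G') := by
    intro g
    ext x
    constructor
    · rintro ⟨_, ⟨y, hy, rfl⟩, rfl⟩
      exact ⟨e y, ⟨y, hy, rfl⟩, by simp⟩
    · rintro ⟨_, ⟨y, hy, rfl⟩, rfl⟩
      exact ⟨g * y * g⁻¹, ⟨y, hy, by simp⟩, by simp⟩
  constructor
  · rintro ⟨g, hg⟩
    exact ⟨e g, (key g).symm.trans (congrArg (Subgroup.map (e : G →* G')) hg)⟩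
  · rintro ⟨g, hg⟩
    refine ⟨e.symm g, Subgroup.map_injective (f := (e : G →* G')) e.injective ?_⟩
    rw [key, e.apply_symm_apply]
    exact hg

/-- The whole group is the subgroup of step one, so the identification of subgroup types applies to
it. -/
lemma nonempty_cyclicExt_mulEquiv : Nonempty (CyclicExt Eisenstein Eisenstein.zeta ≃* PiG5) := by
  have h : CyclicExt.IsStep (⊤ : Subgroup (CyclicExt Eisenstein Eisenstein.zeta)) 1 :=
    ⟨fun _ _ => by simp, ⟨0, Subgroup.mem_top _⟩⟩
  obtain ⟨f⟩ := nonempty_mulEquiv_piG5 (by simp) h rfl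
  exact ⟨Subgroup.topEquiv.symm.trans f⟩

end Transport

section DeckGroup

/-- The primitive sixth root of unity `e^{πi/3}`. -/
noncomputable def sixthRoot : ℂ := Complex.exp (Real.pi * Complex.I / 3)

lemma sixthRoot_eq : sixthRoot = ⟨1 / 2, √3 / 2⟩ := by
  rw [sixthRoot, show (Real.pi * Complex.I / 3 : ℂ) = ((Real.pi / 3 : ℝ) : ℂ) * Complex.I by
    push_cast; ring, Complex.exp_mul_I, ← Complex.ofReal_cos, ← Complex.ofReal_sin,
    Real.cos_pi_div_three, Real.sin_pi_div_three]
  apply Complex.ext <;> simp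

lemma sixthRoot_mul_self : sixthRoot * sixthRoot = sixthRoot - 1 := by
  have h3 : √3 * √3 = 3 := Real.mul_self_sqrt (by norm_num)
  rw [sixthRoot_eq]
  apply Complex.ext
  · simp only [Complex.mul_re, Complex.sub_re, Complex.one_re]
    linarith
  · simp only [Complex.mul_im, Complex.sub_im, Complex.one_im]
    ring

lemma exp_two_pi_div_three : Complex.exp (2 * Real.pi * Complex.I / 3) = sixthRoot - 1 := by
  rw [← sixthRoot_mul_self, sixthRoot, ← Complex.exp_add]
  congr 1
  ring

lemma sixthRoot_ne_zero : sixthRoot ≠ 0 := Complex.exp_ne_zero _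

@[simp] lemma translation_apply (a : ℂ) (p : ℂ × ℝ) : translation a p = (p.1 + a, p.2) :=
  Prod.ext rfl (add_zero _)

@[simp] lemma screw_apply (p : ℂ × ℝ) : screw p = (sixthRoot * p.1, p.2 + 1) := rfl

lemma translation_zpow_apply (a : ℂ) (i : ℤ) (p : ℂ × ℝ) :
    (translation a ^ i) p = (p.1 + i * a, p.2) := by
  have h : translation a ^ i = translation (i * a) := by
    induction i with
    | zero => ext p <;> simp
    | succ i ih =>
      rw [zpow_add_one, ih]
      ext p <;> simp; ring
    | pred i ih =>
      rw [zpow_sub_one, ih, mul_inv_eq_iff_eq_mul]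
      ext p <;> simp; ring
  rw [h, translation_apply]

lemma screw_zpow_apply (m : ℤ) (p : ℂ × ℝ) :
    (screw ^ m) p = (sixthRoot ^ m * p.1, p.2 + m) := by
  have h : ∀ p : ℂ × ℝ, (screw ^ m) p = (sixthRoot ^ m * p.1, p.2 + m) := by
    induction m with
    | zero => intro p; simp
    | succ m ih =>
      intro p
      rw [zpow_add_one, Equiv.Perm.mul_apply, ih, zpow_add_one₀ sixthRoot_ne_zero]
      ext <;> simp <;> ring
    | pred m ih =>
      intro p
      obtain ⟨p, rfl⟩ := screw.surjective p
      rw [zpow_sub_one, Equiv.Perm.mul_apply, Equiv.Perm.inv_def, Equiv.symm_apply_apply, ih,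
        zpow_sub_one₀ sixthRoot_ne_zero]
      ext
      · simp [mul_assoc, inv_mul_cancel_left₀ sixthRoot_ne_zero]
      · simp
  exact h p

/-- The action of `π₁(G₅)` on Euclidean space. -/
noncomputable def deckHom : PiG5 →* Equiv.Perm (ℂ × ℝ) :=
  PiG5.lift (translation 1) (translation (Complex.exp (2 * Real.pi * Complex.I / 3))) screw
    (by
      rw [mul_inv_eq_one, mul_inv_eq_iff_eq_mul]
      ext p <;> simp; ring)
    (by
      rw [mul_inv_eq_iff_eq_mul, exp_two_pi_div_three]
      ext p <;> simp; ring)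
    (by
      rw [mul_inv_eq_iff_eq_mul, eq_inv_mul_iff_mul_eq, exp_two_pi_div_three]
      refine Equiv.ext fun p => Prod.ext ?_ ?_
      · simp only [Equiv.Perm.mul_apply, translation_apply, screw_apply]
        linear_combination sixthRoot_mul_self
      · simp)

lemma deckHom_x : deckHom (PiG5.gen .x) = translation 1 := by
  unfold deckHom PiG5.lift
  exact PresentedGroup.toGroup.of _

lemma deckHom_y : deckHom (PiG5.gen .y) =
    translation (Complex.exp (2 * Real.pi * Complex.I / 3)) := by
  unfold deckHom PiG5.lift
  exact PresentedGroup.toGroup.of _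

lemma deckHom_z : deckHom (PiG5.gen .z) = screw := by
  unfold deckHom PiG5.lift
  exact PresentedGroup.toGroup.of _

lemma deckHom_normal_form_apply (i j m : ℤ) (p : ℂ × ℝ) :
    (deckHom (PiG5.gen .x) ^ i * deckHom (PiG5.gen .y) ^ j * deckHom (PiG5.gen .z) ^ m) p =
      (sixthRoot ^ m * p.1 + (j * (sixthRoot - 1) + i), p.2 + m) := by
  rw [deckHom_x, deckHom_y, deckHom_z, Equiv.Perm.mul_apply, Equiv.Perm.mul_apply,
    screw_zpow_apply, translation_zpow_apply, translation_zpow_apply, exp_two_pi_div_three]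
  ext <;> simp; ring

/-- The horizontal lattice has no nonzero vector of length less than one. -/
lemma eq_zero_of_norm_lt_one {i j : ℤ} (h : ‖(j * (sixthRoot - 1) + i : ℂ)‖ < 1) :
    i = 0 ∧ j = 0 := by
  have h3 : √3 * √3 = 3 := Real.mul_self_sqrt (by norm_num)
  have h1 : ‖(j * (sixthRoot - 1) + i : ℂ)‖ ^ 2 < 1 := by
    have := norm_nonneg (j * (sixthRoot - 1) + i : ℂ)
    nlinarith
  rw [← Complex.normSq_eq_norm_sq, Complex.normSq_apply, sixthRoot_eq] at h1
  simp only [Complex.add_re, Complex.mul_re, Complex.sub_re, Complex.one_re, Complex.intCast_re,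
    Complex.intCast_im, Complex.add_im, Complex.mul_im, Complex.sub_im, Complex.one_im] at h1
  -- The squared length of a lattice vector is this integer, so being less than one forces it to
  -- vanish.
  have h2 : (i ^ 2 - i * j + j ^ 2 : ℤ) < 1 := by
    have : ((i ^ 2 - i * j + j ^ 2 : ℤ) : ℝ) < 1 := by
      push_cast
      nlinarith
    exact_mod_cast this
  have hj : j ^ 2 ≤ 0 := by nlinarith [sq_nonneg (2 * i - j)]
  obtain rfl : j = 0 := pow_eq_zero_iff two_ne_zero |>.1 (le_antisymm hj (sq_nonneg j))
  exact ⟨pow_eq_zero_iff two_ne_zero |>.1 (le_antisymm (by linarith) (sq_nonneg i)), rfl⟩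

/-- The image of the origin under `xⁱ yʲ zᵐ` already determines `i`, `j` and `m`. -/
lemma deckHom_injective : Function.Injective deckHom := by
  refine injective_of_normal_form deckHom PiG5.normal_form fun i j m h => ?_
  have h1 := deckHom_normal_form_apply i j m 0
  rw [h] at h1
  simp only [Equiv.Perm.one_apply, Prod.fst_zero, Prod.snd_zero, mul_zero, zero_add] at h1
  have h2 := (congrArg Prod.fst h1).symm
  have h3 := (congrArg Prod.snd h1).symm
  simp only [Prod.fst_zero, Prod.snd_zero] at h2 h3
  obtain ⟨rfl, rfl⟩ := eq_zero_of_norm_lt_one (i := i) (j := j) (by rw [h2]; simp)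
  exact ⟨rfl, rfl, by exact_mod_cast h3⟩

lemma range_deckHom : deckHom.range = deckGroup := by
  rw [MonoidHom.range_eq_map, ← closure_gens, MonoidHom.map_closure, deckGroup]
  congr 1
  rw [Set.image_insert_eq, Set.image_insert_eq, Set.image_singleton]
  rw [← deckHom_x, ← deckHom_y, ← deckHom_z]

lemma nonempty_deckGroup_mulEquiv : Nonempty (deckGroup ≃* PiG5) :=
  ⟨((MonoidHom.ofInjective deckHom_injective).trans
    (MulEquiv.subgroupCongr range_deckHom)).symm⟩

lemma exists_deckGroup_smul_eq (g : deckGroup) : ∃ i j m : ℤ, ∀ p : ℂ × ℝ,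
    g • p = (sixthRoot ^ m * p.1 + (j * (sixthRoot - 1) + i), p.2 + m) := by
  obtain ⟨g, hg⟩ := g
  rw [← range_deckHom] at hg
  obtain ⟨w, rfl⟩ := hg
  obtain ⟨i, j, m, rfl⟩ := PiG5.normal_form w
  refine ⟨i, j, m, fun p => ?_⟩
  rw [← deckHom_normal_form_apply, ← map_zpow, ← map_zpow, ← map_zpow, ← map_mul, ← map_mul]
  rfl

/-- Balls of radius `1/2` work: an element whose translate of the ball meets the ball moves some
point by less than one in the maximum metric. So its height shift `m` vanishes, and then so does its
horizontal translation. -/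
theorem isQuotientCoveringMap_G5 :
    IsQuotientCoveringMap (Quotient.mk (MulAction.orbitRel deckGroup (ℂ × ℝ))) deckGroup where
  __ := isQuotientMap_quotient_mk'
  continuous_const_smul g := by
    obtain ⟨i, j, m, h⟩ := exists_deckGroup_smul_eq g
    simp_rw [h]
    fun_prop
  apply_eq_iff_mem_orbit := Quotient.eq''
  disjoint e := by
    refine ⟨Metric.ball e (1 / 2), Metric.ball_mem_nhds _ (by norm_num), ?_⟩
    rintro g ⟨_, ⟨p, hp, rfl⟩, hgp⟩
    obtain ⟨i, j, m, h⟩ := exists_deckGroup_smul_eq g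
    have hd : dist (g • p) p < 1 := by
      have h1 := Metric.mem_ball.1 hp
      have h2 := Metric.mem_ball'.1 hgp
      have := dist_triangle_right (g • p) p e
      rw [dist_comm] at h2
      linarith
    rw [h, Prod.dist_eq, max_lt_iff] at hd
    obtain ⟨hd1, hd2⟩ := hd
    obtain rfl : m = 0 := by
      simp only [Real.dist_eq, add_sub_cancel_left] at hd2
      rw [← Int.cast_abs] at hd2
      exact Int.abs_lt_one_iff.1 (by exact_mod_cast hd2)
    simp only [zpow_zero, one_mul, dist_eq_norm, add_sub_cancel_left] at hd1
    obtain ⟨rfl, rfl⟩ := eq_zero_of_norm_lt_one hd1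
    refine Subtype.ext (Equiv.ext fun p => ?_)
    exact (h p).trans (by simp)

instance : SimplyConnectedSpace (ℂ × ℝ) := SimplyConnectedSpace.ofContractible _

lemma nonempty_coveringClasses_G5_equiv {H : Type} [Group H] {n : ℕ} (hn : n ≠ 0) :
    Nonempty (CoveringClasses G5 H n ≃ SubgroupClasses H PiG5 n) := by
  obtain ⟨e⟩ := nonempty_deckGroup_mulEquiv
  obtain ⟨f⟩ := nonempty_subgroupClasses_equiv (H := H) e n
  obtain ⟨g⟩ := nonempty_subgroupClasses_equiv_coveringClasses (H := H)
    isQuotientCoveringMap_G5 hn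
  exact ⟨g.symm.trans f⟩

end DeckGroup

end Platycosm

/-! ### Sums over divisors and the four formulas. -/

namespace Platycosm

section DivisorSums

lemma sum_divisors_filter_dvd {n d : ℕ} (hn : n ≠ 0) (F : ℕ → ℚ) :
    ∑ k ∈ n.divisors with d ∣ k, F k =
      if d ∣ n then ∑ k ∈ (n / d).divisors, F (d * k) else 0 := by
  split_ifs with hd
  · obtain ⟨m, rfl⟩ := hd
    have hd0 : 0 < d := Nat.pos_of_ne_zero (left_ne_zero_of_mul hn)
    have hm0 : m ≠ 0 := right_ne_zero_of_mul hn
    rw [Nat.mul_div_cancel_left _ hd0]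
    symm
    refine Finset.sum_bij (fun k _ => d * k) ?_ ?_ ?_ (fun _ _ => rfl)
    · intro k hk
      rw [Finset.mem_filter, Nat.mem_divisors]
      exact ⟨⟨Nat.mul_dvd_mul_left d (Nat.dvd_of_mem_divisors hk), hn⟩, dvd_mul_right _ _⟩
    · intro a _ b _ h
      exact Nat.eq_of_mul_eq_mul_left hd0 h
    · intro b hb
      rw [Finset.mem_filter, Nat.mem_divisors] at hb
      obtain ⟨⟨hb, -⟩, k, rfl⟩ := hb
      exact ⟨k, Nat.mem_divisors.2 ⟨Nat.dvd_of_mul_dvd_mul_left hd0 hb, hm0⟩, rfl⟩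
  · refine Finset.sum_eq_zero fun k hk => ?_
    rw [Finset.mem_filter, Nat.mem_divisors] at hk
    exact absurd (hk.2.trans hk.1.1) hd

lemma sum_divisors_atQuot {n e : ℕ} (hn : n ≠ 0) (he : e ≠ 0) (f : ℕ → ℕ) :
    ∑ k ∈ n.divisors, atQuot f k e = atQuot (fun m => ∑ k ∈ m.divisors, f k) n e := by
  simp only [atQuot]
  rw [← Finset.sum_filter, sum_divisors_filter_dvd hn]
  simp [Nat.mul_div_cancel_left _ (Nat.pos_of_ne_zero he)]

/-- `∑_{k ∣ n, d ∣ k} f((n / k) / e) = ∑_{k ∣ n / (d e)} f(k)`. -/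
lemma sum_divisors_filter_atQuot {n d e : ℕ} (hn : n ≠ 0) (he : e ≠ 0) (f : ℕ → ℕ) :
    ∑ k ∈ n.divisors with d ∣ k, atQuot f (n / k) e =
      atQuot (fun m => ∑ k ∈ m.divisors, f k) n (d * e) := by
  rw [sum_divisors_filter_dvd hn]
  split_ifs with hd
  · obtain ⟨m, rfl⟩ := hd
    have hd0 : 0 < d := Nat.pos_of_ne_zero (left_ne_zero_of_mul hn)
    have hm0 : m ≠ 0 := right_ne_zero_of_mul hn
    simp only [Nat.mul_div_mul_left _ _ hd0, Nat.mul_div_cancel_left _ hd0]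
    rw [Nat.sum_div_divisors m (fun k => atQuot f k e), sum_divisors_atQuot hm0 he]
    simp only [atQuot, Nat.mul_dvd_mul_iff_left hd0, Nat.mul_div_mul_left _ _ hd0]
  · rw [atQuot, if_neg fun h => hd ((dvd_mul_right d e).trans h)]

lemma sum_divisors_filter_cast {n d : ℕ} (hn : n ≠ 0) (f : ℕ → ℕ) :
    ∑ k ∈ n.divisors with d ∣ k, (f (n / k) : ℚ) =
      atQuot (fun m => ∑ k ∈ m.divisors, f k) n d := by
  have := sum_divisors_filter_atQuot (d := d) hn one_ne_zero f
  simpa [atQuot] using this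

lemma sigmaTwo_eq : (fun m : ℕ => ∑ k ∈ m.divisors, sigmaOne k) = sigmaTwo := rfl

lemma thetaSum_eq : (fun m : ℕ => ∑ k ∈ m.divisors, theta k) = thetaSum := rfl

lemma omega_eq : (fun m : ℕ => ∑ k ∈ m.divisors, k * sigmaOne k) = omega := rfl

/-- For `g = 2, 3`, `gcd(k, 6) = g` means that `g ∣ k` but not `6 ∣ k`. -/
lemma sum_divisors_filter_gcd_six {n g : ℕ} (hg : g = 2 ∨ g = 3) (F : ℕ → ℚ) :
    ∑ k ∈ n.divisors with k.gcd 6 = g, F k =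
      ∑ k ∈ n.divisors with g ∣ k, F k - ∑ k ∈ n.divisors with 6 ∣ k, F k := by
  rw [Finset.sum_filter, Finset.sum_filter, Finset.sum_filter, ← Finset.sum_sub_distrib]
  refine Finset.sum_congr rfl fun k _ => ?_
  have h2 : 2 ∣ k ↔ 2 ∣ k.gcd 6 := ⟨fun h => Nat.dvd_gcd h (by norm_num), fun h =>
    h.trans (Nat.gcd_dvd_left _ _)⟩
  have h3 : 3 ∣ k ↔ 3 ∣ k.gcd 6 := ⟨fun h => Nat.dvd_gcd h (by norm_num), fun h =>
    h.trans (Nat.gcd_dvd_left _ _)⟩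
  have h6 : 6 ∣ k ↔ 6 ∣ k.gcd 6 := ⟨fun h => Nat.dvd_gcd h (by norm_num), fun h =>
    h.trans (Nat.gcd_dvd_left _ _)⟩
  rcases hg with rfl | rfl
  · simp only [h2, h6]
    rcases gcd_six_cases k with h | h | h | h <;> simp only [h] <;> norm_num
  · simp only [h3, h6]
    rcases gcd_six_cases k with h | h | h | h <;> simp only [h] <;> norm_num

end DivisorSums

section OrbitCounts

open Eisenstein

variable {k l : ℕ}

/-- The Burnside sum depends on `k` only through `gcd(k, 6)`, which leaves four cases. -/
lemma orbCount_zeta_eq_sum (hl : l ≠ 0) : (orbCount Eisenstein zeta k l : ℚ) =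
    (∑ j ∈ Finset.range 6, (latCount Eisenstein zeta ((k.gcd 6).gcd j) l : ℚ)) / 6 := by
  have h := orbCount_zeta (k := k) hl
  rw [eq_div_iff (by norm_num)]
  have h' : ((orbCount Eisenstein zeta k l * 6 : ℕ) : ℚ) =
    ((∑ j ∈ Finset.range 6, latCount Eisenstein zeta ((k.gcd j).gcd 6) l : ℕ) : ℚ) := by rw [h]
  push_cast at h'
  rw [h']
  exact Finset.sum_congr rfl fun j _ => by rw [Nat.gcd_right_comm]

lemma cast_latCount_two (hl : l ≠ 0) :
    (latCount Eisenstein zeta 2 l : ℚ) = theta l + 2 * atQuot theta l 3 := by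
  rw [latCount_two hl, atQuot]
  split_ifs <;> push_cast <;> ring

lemma cast_latCount_three (hl : l ≠ 0) :
    (latCount Eisenstein zeta 3 l : ℚ) = sigmaOne l + 3 * atQuot sigmaOne l 2 := by
  rw [latCount_three hl, atQuot]
  split_ifs <;> push_cast <;> ring

lemma orbCount_zeta_of_gcd_eq_one (hl : l ≠ 0) (hk : k.gcd 6 = 1) :
    orbCount Eisenstein zeta k l = theta l := by
  have : (orbCount Eisenstein zeta k l : ℚ) = theta l := by
    rw [orbCount_zeta_eq_sum hl, hk]
    simp [latCount_one hl]
  exact_mod_cast this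

lemma orbCount_zeta_of_gcd_eq_two (hl : l ≠ 0) (hk : k.gcd 6 = 2) :
    (orbCount Eisenstein zeta k l : ℚ) = theta l + atQuot theta l 3 := by
  rw [orbCount_zeta_eq_sum hl, hk]
  simp only [Finset.sum_range_succ, Finset.sum_range_zero,
    show Nat.gcd 2 0 = 2 from rfl, show Nat.gcd 2 1 = 1 from rfl, show Nat.gcd 2 2 = 2 from rfl,
    show Nat.gcd 2 3 = 1 from rfl, show Nat.gcd 2 4 = 2 from rfl, show Nat.gcd 2 5 = 1 from rfl,
    latCount_one hl, cast_latCount_two hl]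
  ring

lemma orbCount_zeta_of_gcd_eq_three (hl : l ≠ 0) (hk : k.gcd 6 = 3) :
    (orbCount Eisenstein zeta k l : ℚ) =
      (sigmaOne l + 3 * atQuot sigmaOne l 2 + 2 * theta l) / 3 := by
  rw [orbCount_zeta_eq_sum hl, hk]
  simp only [Finset.sum_range_succ, Finset.sum_range_zero,
    show Nat.gcd 3 0 = 3 from rfl, show Nat.gcd 3 1 = 1 from rfl, show Nat.gcd 3 2 = 1 from rfl,
    show Nat.gcd 3 3 = 3 from rfl, show Nat.gcd 3 4 = 1 from rfl, show Nat.gcd 3 5 = 1 from rfl,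
    latCount_one hl, cast_latCount_three hl]
  ring

lemma orbCount_zeta_of_gcd_eq_six (hl : l ≠ 0) (hk : k.gcd 6 = 6) :
    (orbCount Eisenstein zeta k l : ℚ) =
      (((l * sigmaOne l : ℕ) : ℚ) + sigmaOne l + 3 * atQuot sigmaOne l 2 + 4 * theta l
        + 4 * atQuot theta l 3) / 6 := by
  rw [orbCount_zeta_eq_sum hl, hk]
  simp only [Finset.sum_range_succ, Finset.sum_range_zero,
    show Nat.gcd 6 0 = 6 from rfl, show Nat.gcd 6 1 = 1 from rfl, show Nat.gcd 6 2 = 2 from rfl,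
    show Nat.gcd 6 3 = 3 from rfl, show Nat.gcd 6 4 = 2 from rfl, show Nat.gcd 6 5 = 1 from rfl,
    latCount_one hl, cast_latCount_two hl, cast_latCount_three hl, latCount_six hl]
  ring

end OrbitCounts

section Main

open Eisenstein

variable {n : ℕ}

lemma hasCard_of_equiv.{u, v} {A : Type u} {B : Type v} (e : Nonempty (A ≃ B)) {c : ℚ}
    (h : HasCard B c) : HasCard A c := by
  obtain ⟨e⟩ := e
  have := h.1
  exact ⟨Finite.of_equiv B e.symm, by rw [Nat.card_congr e, h.2]⟩

lemma hasCard_subgroupClasses {H : Type} [Group H] (hn : n ≠ 0) (g : ℕ)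
    (hH : ∀ (D : Subgroup (CyclicExt Eisenstein zeta)) (k : ℕ), D.index ≠ 0 →
      CyclicExt.IsStep D k → (Nonempty (D ≃* H) ↔ k.gcd 6 = g)) :
    HasCard (SubgroupClasses H PiG5 n)
      (∑ k ∈ n.divisors with k.gcd 6 = g, (orbCount Eisenstein zeta k (n / k) : ℚ)) := by
  obtain ⟨e⟩ := nonempty_cyclicExt_mulEquiv
  obtain ⟨f⟩ := nonempty_subgroupClasses_equiv (H := H) e n
  obtain ⟨h1, h2⟩ := card_subgroupClasses hn (fun k => k.gcd 6 = g)
    (fun l hl => finite_addSubgroup_index coords hl)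
    (fun D k hD hk => hH D k (hD.symm ▸ hn) hk)
  refine hasCard_of_equiv ⟨f.symm⟩ ⟨h1, ?_⟩
  rw [h2]
  push_cast
  rfl

lemma div_ne_zero_of_mem_divisors {k : ℕ} (hk : k ∈ n.divisors) : n / k ≠ 0 :=
  (Nat.div_pos (Nat.divisor_le hk) (Nat.pos_of_mem_divisors hk)).ne'

lemma hasCard_piG5 (hn : n ≠ 0) : HasCard (SubgroupClasses PiG5 PiG5 n)
    ((∑ k ∈ n.divisors with Nat.Coprime (n / k) 6, theta k : ℕ) : ℚ) := by
  convert hasCard_subgroupClasses hn 1 (fun D k hD hk => (nonempty_mulEquiv_iff hD hk).1) using 1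
  -- Exchanging `k` with `n / k` turns the condition on the step into coprimality of `n / k` with 6.
  rw [Finset.sum_filter, ← Nat.sum_div_divisors, Finset.sum_filter]
  push_cast
  refine Finset.sum_congr rfl fun k hk => ?_
  rw [Nat.div_div_self (Nat.dvd_of_mem_divisors hk) hn]
  simp only [Nat.coprime_iff_gcd_eq_one]
  split_ifs with h
  · rw [orbCount_zeta_of_gcd_eq_one (div_ne_zero_of_mem_divisors hk) h]
  · rfl

/-- The orbit count is `θ(l) + θ(l/3)`. Summing over `2 ∣ k` minus `6 ∣ k`, the two terms at `n/6`
cancel. -/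
lemma hasCard_piG3 (hn : n ≠ 0) : HasCard (SubgroupClasses PiG3 PiG5 n)
    (atQuot thetaSum n 2 - atQuot thetaSum n 18) := by
  convert hasCard_subgroupClasses hn 2 (fun D k hD hk => (nonempty_mulEquiv_iff hD hk).2.1) using 1
  rw [Finset.sum_congr rfl fun k hk => orbCount_zeta_of_gcd_eq_two
    (div_ne_zero_of_mem_divisors (Finset.mem_filter.1 hk).1) (Finset.mem_filter.1 hk).2,
    sum_divisors_filter_gcd_six (.inl rfl)]
  simp only [Finset.sum_add_distrib, sum_divisors_filter_cast hn,
    sum_divisors_filter_atQuot hn three_ne_zero, Nat.reduceMul]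
  simp only [thetaSum_eq]
  ring

lemma hasCard_piG2 (hn : n ≠ 0) : HasCard (SubgroupClasses PiG2 PiG5 n)
    (1 / 3 * (atQuot sigmaTwo n 3 + 2 * atQuot sigmaTwo n 6 - 3 * atQuot sigmaTwo n 12
      + 2 * atQuot thetaSum n 3 - 2 * atQuot thetaSum n 6)) := by
  convert hasCard_subgroupClasses hn 3 (fun D k hD hk => (nonempty_mulEquiv_iff hD hk).2.2.1)
    using 1
  rw [Finset.sum_congr rfl fun k hk => orbCount_zeta_of_gcd_eq_three
    (div_ne_zero_of_mem_divisors (Finset.mem_filter.1 hk).1) (Finset.mem_filter.1 hk).2,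
    sum_divisors_filter_gcd_six (.inr rfl)]
  simp only [← Finset.sum_div, Finset.sum_add_distrib, ← Finset.mul_sum,
    sum_divisors_filter_cast hn, sum_divisors_filter_atQuot hn two_ne_zero, Nat.reduceMul]
  simp only [sigmaTwo_eq, thetaSum_eq]
  ring

lemma hasCard_piG1 (hn : n ≠ 0) : HasCard (SubgroupClasses PiG1 PiG5 n)
    (1 / 6 * (atQuot omega n 6 + atQuot sigmaTwo n 6 + 3 * atQuot sigmaTwo n 12
      + 4 * atQuot thetaSum n 6 + 4 * atQuot thetaSum n 18)) := by
  convert hasCard_subgroupClasses hn 6 (fun D k hD hk => (nonempty_mulEquiv_iff hD hk).2.2.2)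
    using 1
  have h6 : ∀ k : ℕ, k.gcd 6 = 6 ↔ 6 ∣ k := fun k => Nat.gcd_eq_right_iff_dvd
  rw [Finset.sum_congr rfl fun k hk => orbCount_zeta_of_gcd_eq_six
    (div_ne_zero_of_mem_divisors (Finset.mem_filter.1 hk).1) (Finset.mem_filter.1 hk).2]
  simp only [h6, ← Finset.sum_div, Finset.sum_add_distrib, ← Finset.mul_sum,
    sum_divisors_filter_cast hn, sum_divisors_filter_cast hn (fun l => l * sigmaOne l),
    sum_divisors_filter_atQuot hn two_ne_zero,
    sum_divisors_filter_atQuot hn three_ne_zero, Nat.reduceMul]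
  simp only [sigmaTwo_eq, thetaSum_eq, omega_eq]
  ring

end Main

end Platycosm

theorem theorem4 (n : ℕ) (hn : 0 < n) :
    -- the numbers of conjugacy classes of subgroups of index `n` of each isomorphism type
    (Platycosm.HasCard (Platycosm.SubgroupClasses Platycosm.PiG5 Platycosm.PiG5 n)
        ((∑ k ∈ n.divisors with Nat.Coprime (n / k) 6, Platycosm.theta k : ℕ) : ℚ) ∧
      Platycosm.HasCard (Platycosm.SubgroupClasses Platycosm.PiG3 Platycosm.PiG5 n)
        (Platycosm.atQuot Platycosm.thetaSum n 2 - Platycosm.atQuot Platycosm.thetaSum n 18) ∧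
      Platycosm.HasCard (Platycosm.SubgroupClasses Platycosm.PiG2 Platycosm.PiG5 n)
        (1 / 3 * (Platycosm.atQuot Platycosm.sigmaTwo n 3
          + 2 * Platycosm.atQuot Platycosm.sigmaTwo n 6
          - 3 * Platycosm.atQuot Platycosm.sigmaTwo n 12
          + 2 * Platycosm.atQuot Platycosm.thetaSum n 3
          - 2 * Platycosm.atQuot Platycosm.thetaSum n 6)) ∧
      Platycosm.HasCard (Platycosm.SubgroupClasses Platycosm.PiG1 Platycosm.PiG5 n)
        (1 / 6 * (Platycosm.atQuot Platycosm.omega n 6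
          + Platycosm.atQuot Platycosm.sigmaTwo n 6
          + 3 * Platycosm.atQuot Platycosm.sigmaTwo n 12
          + 4 * Platycosm.atQuot Platycosm.thetaSum n 6
          + 4 * Platycosm.atQuot Platycosm.thetaSum n 18))) ∧
    -- the numbers of non-equivalent `n`-fold coverings of `G₅` of each type
    (Platycosm.HasCard (Platycosm.CoveringClasses Platycosm.G5 Platycosm.PiG5 n)
        ((∑ k ∈ n.divisors with Nat.Coprime (n / k) 6, Platycosm.theta k : ℕ) : ℚ) ∧
      Platycosm.HasCard (Platycosm.CoveringClasses Platycosm.G5 Platycosm.PiG3 n)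
        (Platycosm.atQuot Platycosm.thetaSum n 2 - Platycosm.atQuot Platycosm.thetaSum n 18) ∧
      Platycosm.HasCard (Platycosm.CoveringClasses Platycosm.G5 Platycosm.PiG2 n)
        (1 / 3 * (Platycosm.atQuot Platycosm.sigmaTwo n 3
          + 2 * Platycosm.atQuot Platycosm.sigmaTwo n 6
          - 3 * Platycosm.atQuot Platycosm.sigmaTwo n 12
          + 2 * Platycosm.atQuot Platycosm.thetaSum n 3
          - 2 * Platycosm.atQuot Platycosm.thetaSum n 6)) ∧
      Platycosm.HasCard (Platycosm.CoveringClasses Platycosm.G5 Platycosm.PiG1 n)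
        (1 / 6 * (Platycosm.atQuot Platycosm.omega n 6
          + Platycosm.atQuot Platycosm.sigmaTwo n 6
          + 3 * Platycosm.atQuot Platycosm.sigmaTwo n 12
          + 4 * Platycosm.atQuot Platycosm.thetaSum n 6
          + 4 * Platycosm.atQuot Platycosm.thetaSum n 18))) := by
  have hn' := hn.ne'
  exact ⟨⟨Platycosm.hasCard_piG5 hn', Platycosm.hasCard_piG3 hn', Platycosm.hasCard_piG2 hn', Platycosm.hasCard_piG1 hn'⟩,
    Platycosm.hasCard_of_equiv (Platycosm.nonempty_coveringClasses_G5_equiv hn') (Platycosm.hasCard_piG5 hn'),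
    Platycosm.hasCard_of_equiv (Platycosm.nonempty_coveringClasses_G5_equiv hn') (Platycosm.hasCard_piG3 hn'),
    Platycosm.hasCard_of_equiv (Platycosm.nonempty_coveringClasses_G5_equiv hn') (Platycosm.hasCard_piG2 hn'),
    Platycosm.hasCard_of_equiv (Platycosm.nonempty_coveringClasses_G5_equiv hn') (Platycosm.hasCard_piG1 hn')⟩
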